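/- Let $N\ge 4$, $n=\lfloor N/2\rfloor$, $i'=N+1-i$, and let $q\in\mathbb C\setminus\{0\}$ be not a root of unity, with a fixed square root $q^{1/2}$. Put $\rho_i=\frac N2-i$ for $i\le n$, $\rho_{i'}=-\rho_i$, and $\rho_{n+1}=0$ if $N=2n+1$. Write $[a]=\frac{1-q^a}{1-q}$, $[a]_q=\frac{q^a-q^{-a}}{q-q^{-1}}$, $(a;b)_k=\prod_{j=0}^{k-1}(1-ab^j)$. **The algebra.** $\mathcal A$ is the unital associative $\mathbb C$-algebra generated by $x_1,\dots,x_N$ with the relations $x_ix_j=q\,x_jx_i$ ($i<j$, $i\ne j'$); $x_{i'}x_i-x_ix_{i'}=\frac{q-q^{-1}}{q^{\rho_i-1}+q^{-\rho_i+1}}\sum_{j=i+1}^{(i+1)'}q^{\rho_{j'}}x_jx_{j'}$ ($i<n$); $x_{n'}x_n-x_nx_{n'}=(q^{1/2}-q^{-1/2})x_{n+1}^2$ if $N=2n+1$, and $x_{n'}x_n=x_nx_{n'}$ if $N=2n$. The monomials $x^\nu=x_1^{\nu_1}\cdots x_N^{\nu_N}$ form a basis of $\mathcal A$; $\mathcal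 A_m$ is the span of those of degree $m$. Let $\varepsilon_i$ be the $i$-th unit multi-index. **Harmonic polynomials.** Let $Q=\sum_{i=1}^N q^{\rho_{i'}}x_ix_{i'}$ and $\Delta_q=\sum_{i=1}^N q^{\rho_i}\partial_i\partial_{i'}$, where the linear operators $\partial_i$ on $\mathcal A$ are given by $\partial_kx^\nu=[\nu_k]_q\,q^{\nu_{k+1}+\cdots+\nu_N}x^{\nu-\varepsilon_k}$ ($k\le n$), $\partial_{n+1}x^\nu=[\nu_{n+1}]\,q^{\nu_{n+2}+\cdots+\nu_N}x^{\nu-\varepsilon_{n+1}}$ (if $N=2n+1$), and, for $k\le n$, $$\partial_{k'}x^\nu=[\nu_{k'}]_q\,q^{\nu_k+\nu_{k'+1}+\cdots+\nu_N}x^{\nu-\varepsilon_{k'}}+\sum_{j=k+1}^n[\nu_j]_q[\nu_{j'}]_q(q-q^{-1})q^{\rho_k-\rho_j}q^{d_{kj}}x^{\nu+\varepsilon_k-\varepsilon_j-\varepsilon_{j'}}+[\nu_{n+1}-1][\nu_{n+1}]\tfrac{q-q^{-1}}{1+q}q^{\rho_k+2}q^{e_k}x^{\nu+\varepsilon_k-2\varepsilon_{n+1}},$$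 with $d_{kj}=\nu_k+\cdots+\nu_{j-1}+\nu_{(j-1)'}+\cdots+\nu_{N}$, $e_k=\nu_k+\cdots+\nu_N-2\nu_{n+1}$, the last summand being omitted for $N=2n$. Let $\mathcal H_m=\{p\in\mathcal A_m:\Delta_qp=0\}$, and let $\mathsf H_m:\mathcal A_m=\mathcal H_m\oplus Q\mathcal A_{m-2}\to\mathcal H_m$ be the projector (with $\mathcal A_{m-2}=0$ for $m<2$). **Zonal polynomials.** The algebra $U_q(\mathrm{so}_N)$ acts on $\mathcal A$ by $\hat K_ix^\nu=q^{\nu_i-\nu_{i'}}x^\nu$ ($i\le n$), and, for $k<n$, $$E_kx^\nu=[\nu_{k+1}]_q\,q^{\nu_k-\nu_{k+1}+1}x^{\nu+\varepsilon_k-\varepsilon_{k+1}}-[\nu_{k'}]_q\,q^{\nu_k-\nu_{k+1}-\nu_{k'}+\nu_{(k+1)'}+1}x^{\nu+\varepsilon_{(k+1)'}-\varepsilon_{k'}},$$ $$F_kx^\nu=[\nu_k]_q\,q^{-\nu_k+\nu_{k+1}-\nu_{(k+1)'}+\nu_{k'}+1}x^{\nu-\varepsilon_k+\varepsilon_{k+1}}-[\nu_{(k+1)'}]_q\,q^{-\nu_{(k+1)'}+\nu_{k'}+1}x^{\nu-\varepsilon_{(k+1)'}+\varepsilon_{k'}};$$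 for $N=2n+1$, $$E_nx^\nu=[\nu_{n+1}]\,q^{\nu_n-\nu_{n+1}+3/2}x^{\nu+\varepsilon_n-\varepsilon_{n+1}}-[\nu_{n+2}]_q\,q^{\nu_n-\nu_{n+2}+1}x^{\nu+\varepsilon_{n+1}-\varepsilon_{n+2}},$$ $$F_nx^\nu=[\nu_n]_q\,q^{-\nu_n+\nu_{n+2}+1/2}x^{\nu-\varepsilon_n+\varepsilon_{n+1}}-[\nu_{n+1}]\,q^{-\nu_{n+1}+\nu_{n+2}+1}x^{\nu-\varepsilon_{n+1}+\varepsilon_{n+2}};$$ for $N=2n$, $$E_nx^\nu=[\nu_{n+1}]_q\,q^{\nu_{n-1}-\nu_{n+1}+1}x^{\nu+\varepsilon_{n-1}-\varepsilon_{n+1}}-[\nu_{n+2}]_q\,q^{\nu_{n-1}+\nu_n-\nu_{n+1}-\nu_{n+2}+1}x^{\nu+\varepsilon_n-\varepsilon_{n+2}},$$ $$F_nx^\nu=[\nu_{n-1}]_q\,q^{-\nu_{n-1}-\nu_n+\nu_{n+1}+\nu_{n+2}+1}x^{\nu-\varepsilon_{n-1}+\varepsilon_{n+1}}-[\nu_n]_q\,q^{-\nu_n+\nu_{n+2}+1}x^{\nu-\varepsilon_n+\varepsilon_{n+2}}.$$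 The subalgebra $U_q(\mathrm{so}_{N-2})$ is generated by $\hat K_i^{\pm1},E_i,F_i$, $2\le i\le n$, if $N\ge5$, and by $\hat K_2^{\pm1}$ if $N=4$. A polynomial $p\in\mathcal H_m$ is called zonal if it is $U_q(\mathrm{so}_{N-2})$-invariant, that is, $\hat K_ip=p$ and (if $N\ge 5$) $E_ip=F_ip=0$ for $2\le i\le n$. **Scalar product.** Let $\tau:\mathcal A\to\mathcal A/(Q-1)$ be the canonical map onto the algebra of functions on the quantum sphere, and let $h$ be the linear functional on $\mathcal A/(Q-1)$ with $h(\tau x^\nu)=0$ unless $\nu_i=\nu_{i'}$ for all $i\le n$ and (for $N=2n+1$) $\nu_{n+1}=2r$ is even, in which case $$h(\tau x^\nu)=\frac{(q^{-2};q^{-2})_{\nu_1}\cdots(q^{-2};q^{-2})_{\nu_n}(q^{-1};q^{-2})_r(1+q)^r}{q^{\rho_1\nu_1+\cdots+\rho_n\nu_n+r}(1+q^{N-2})^{\nu_1+\cdots+\nu_n+r}(q^{-N};q^{-2})_{\nu_1+\cdots+\nu_n+r}}$$ ($r=0$ for $N=2n$). Let $\sigma$ be an involutive automorphism of the field $\mathbb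 C$ with $\sigma(q)=q$, and $\sigma(q^{1/2})=q^{1/2}$ if $N$ is odd (for instance complex conjugation when $q$ is real, positive if $N$ is odd; or the identity), and let $*$ be the $\sigma$-semilinear anti-automorphism of $\mathcal A$ with $x_i^*=q^{\rho_{i'}}x_{i'}$. Put $\langle p_1,p_2\rangle=h(\tau(p_1^*)\,\tau(p_2))$. **Theorem 1.** Let $m\ge0$ and, for $m_1+m_1'=m$, let $\varphi^m_{m_1m_1'}=\mathsf H_m(x_1^{m_1}x_{1'}^{m_1'})$. Then: 1. Each $\varphi^m_{m_1m_1'}$ is zonal, and $$\varphi^m_{m_1m_1'}=\sum_{k=0}^{\min(m_1,m_1')}C^k_{m_1m_1'}Q^kx_1^{m_1-k}x_{1'}^{m_1'-k},\qquad C^k_{m_1m_1'}=\frac{(q^{-2m_1};q^2)_k(q^{-2m_1'};q^2)_k}{(q^2;q^2)_k(q^{-N-2m+4};q^2)_k}\,\frac{q^{(-n+2+\epsilon)k}}{(1+q^{N-2})^k},$$ where $\epsilon=1$ for $N=2n$ and $\epsilon=\frac12$ for $N=2n+1$. 2. $\langle\varphi^m_{m_1m_1'},\varphi^m_{l_1l_1'}\rangle=0$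 whenever $m_1+m_1'=l_1+l_1'=m$ and $(m_1,m_1')\neq(l_1,l_1')$, for every such $\sigma$. 3. The $m+1$ polynomials $\varphi^m_{m_1m_1'}$, $m_1+m_1'=m$, are linearly independent and span the space of all zonal polynomials in $\mathcal H_m$. -/

import Mathlib

noncomputable section

namespace QE

/-! The quantum Euclidean space.  Throughout, `N` is the number of coordinates, `n = ⌊N/2⌋`,
indices run through `1, …, N` and `i' = N + 1 - i`.  The parameter `s : ℂ` is a fixed square root of
`q`, so that `q = s ^ 2` and `q ^ (a / 2) = s ^ a` for an integer `a`.  (For even `N` only even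
powers of `s` occur.) -/

/-- `q ^ a`, for an integer `a`. -/
def qp (s : ℂ) (a : ℤ) : ℂ := (s ^ 2) ^ a

/-- `q ^ (a / 2)`, for an integer `a`. -/
def qh (s : ℂ) (a : ℤ) : ℂ := s ^ a

/-- `[a] = (1 - q^a) / (1 - q)`. -/
def qnum (s : ℂ) (a : ℤ) : ℂ := (1 - qp s a) / (1 - qp s 1)

/-- `[a]_q = (q^a - q^(-a)) / (q - q^(-1))`. -/
def qsym (s : ℂ) (a : ℤ) : ℂ := (qp s a - qp s (-a)) / (qp s 1 - qp s (-1))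

/-- `(a; b)_k = (1 - a) (1 - a b) ⋯ (1 - a b^(k-1))`. -/
def poch (a b : ℂ) (k : ℕ) : ℂ := ∏ j ∈ Finset.range k, (1 - a * b ^ j)

/-- `n`, the integral part of `N / 2`. -/
def rk (N : ℕ) : ℕ := N / 2

/-- `i' = N + 1 - i`. -/
def pr (N i : ℕ) : ℕ := N + 1 - i

/-- `2 ρ_i`: here `ρ_i = N/2 - i` for `i ≤ n`, `ρ_i = 0` for `i = i'`, and `ρ_{i'} = -ρ_i`. -/
def rho2 (N i : ℕ) : ℤ :=
  if i ≤ rk N then (N : ℤ) - 2 * i else if i = pr N i then 0 else -((N : ℤ) - 2 * (pr N i : ℕ))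

/-- The generator `x_i` of the free algebra on `x_1, …, x_N` (and `0` if `i ∉ {1, …, N}`). -/
def freeX (N i : ℕ) : FreeAlgebra ℂ (Set.Icc 1 N) :=
  open Classical in if h : i ∈ Set.Icc 1 N then FreeAlgebra.ι ℂ ⟨i, h⟩ else 0

/-- The defining relations of the algebra of polynomials on the quantum Euclidean space. -/
inductive Rel (N : ℕ) (s : ℂ) :
    FreeAlgebra ℂ (Set.Icc 1 N) → FreeAlgebra ℂ (Set.Icc 1 N) → Prop
  | qcomm (i j : ℕ) (hi : 1 ≤ i) (hij : i < j) (hj : j ≤ N) (h : i ≠ pr N j) :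
      Rel N s (freeX N i * freeX N j) (qp s 1 • (freeX N j * freeX N i))
  | pair (i : ℕ) (hi : 1 ≤ i) (hin : i < rk N) :
      Rel N s (freeX N (pr N i) * freeX N i - freeX N i * freeX N (pr N i))
        (((qp s 1 - qp s (-1)) / (qh s (rho2 N i - 2) + qh s (-rho2 N i + 2))) •
          ∑ j ∈ Finset.Icc (i + 1) (pr N (i + 1)),
            qh s (rho2 N (pr N j)) • (freeX N j * freeX N (pr N j)))
  | midOdd (h : Odd N) :
      Rel N s (freeX N (pr N (rk N)) * freeX N (rk N) - freeX N (rk N) * freeX N (pr N (rk N)))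
        ((qh s 1 - qh s (-1)) • freeX N (rk N + 1) ^ 2)
  | midEven (h : Even N) :
      Rel N s (freeX N (pr N (rk N)) * freeX N (rk N)) (freeX N (rk N) * freeX N (pr N (rk N)))

/-- The algebra `𝒜 = ℂ_q[x_1, …, x_N]`. -/
abbrev A (N : ℕ) (s : ℂ) : Type := RingQuot (Rel N s)

variable (N : ℕ) (s : ℂ)

/-- The quantum Cartesian coordinate `x_i ∈ 𝒜`, `i = 1, …, N`. -/
def X (i : ℕ) : A N s := RingQuot.mkAlgHom ℂ (Rel N s) (freeX N i)

/-- The monomial `x^ν = x_1^{ν_1} x_2^{ν_2} ⋯ x_N^{ν_N}`; only `ν_1, …, ν_N` matter. -/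
def mono (ν : ℕ → ℕ) : A N s := ((List.range N).map fun i => X N s (i + 1) ^ ν (i + 1)).prod

/-- The linear map on `𝒜` that takes the values `f ν` on the monomials `x^ν`
(these form a basis of `𝒜`, so there is exactly one as soon as `f ν` depends on
`ν_1, …, ν_N` only). -/
def linExt {M : Type} [AddCommGroup M] [Module ℂ M] (f : (ℕ → ℕ) → M) : A N s →ₗ[ℂ] M :=
  Classical.epsilon fun T : A N s →ₗ[ℂ] M => ∀ ν : ℕ → ℕ, T (mono N s ν) = f ν

/-- The multi-index `ε_i`. -/
def e (i : ℕ) : ℕ → ℕ := Pi.single i 1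

/-- `ν_a + ν_{a+1} + ⋯ + ν_b` (zero if `b < a`). -/
def S (ν : ℕ → ℕ) (a b : ℕ) : ℤ := ∑ i ∈ Finset.Icc a b, (ν i : ℤ)

/-! ### The action of `U_q(so_N)`

A monomial whose multi-index would have a negative entry always has coefficient zero. -/

/-- The action of `K̂_i`, `i = 1, …, n`. -/
def Khat (i : ℕ) : A N s →ₗ[ℂ] A N s :=
  linExt N s fun ν => qp s ((ν i : ℤ) - ν (pr N i)) • mono N s ν

/-- The action of `E_k`, `k = 1, …, n`. -/
def E (k : ℕ) : A N s →ₗ[ℂ] A N s :=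
  linExt N s fun ν =>
    let v : ℕ → ℤ := fun i => (ν i : ℤ)
    let n := rk N
    if k < n then
      (qsym s (v (k + 1)) * qp s (v k - v (k + 1) + 1)) • mono N s (ν + e k - e (k + 1))
        - (qsym s (v (pr N k)) * qp s (v k - v (k + 1) - v (pr N k) + v (pr N (k + 1)) + 1)) •
          mono N s (ν + e (pr N (k + 1)) - e (pr N k))
    else if Odd N then
      (qnum s (v (n + 1)) * qh s (2 * (v n - v (n + 1)) + 3)) • mono N s (ν + e n - e (n + 1))
        - (qsym s (v (n + 2)) * qp s (v n - v (n + 2) + 1)) • mono N s (ν + e (n + 1) - e (n + 2))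
    else
      (qsym s (v (n + 1)) * qp s (v (n - 1) - v (n + 1) + 1)) •
          mono N s (ν + e (n - 1) - e (n + 1))
        - (qsym s (v (n + 2)) * qp s (v (n - 1) + v n - v (n + 1) - v (n + 2) + 1)) •
          mono N s (ν + e n - e (n + 2))

/-- The action of `F_k`, `k = 1, …, n`. -/
def F (k : ℕ) : A N s →ₗ[ℂ] A N s :=
  linExt N s fun ν =>
    let v : ℕ → ℤ := fun i => (ν i : ℤ)
    let n := rk N
    if k < n then
      (qsym s (v k) * qp s (-v k + v (k + 1) - v (pr N (k + 1)) + v (pr N k) + 1)) •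
          mono N s (ν + e (k + 1) - e k)
        - (qsym s (v (pr N (k + 1))) * qp s (-v (pr N (k + 1)) + v (pr N k) + 1)) •
          mono N s (ν + e (pr N k) - e (pr N (k + 1)))
    else if Odd N then
      (qsym s (v n) * qh s (2 * (-v n + v (n + 2)) + 1)) • mono N s (ν + e (n + 1) - e n)
        - (qnum s (v (n + 1)) * qp s (-v (n + 1) + v (n + 2) + 1)) •
          mono N s (ν + e (n + 2) - e (n + 1))
    else
      (qsym s (v (n - 1)) * qp s (-v (n - 1) - v n + v (n + 1) + v (n + 2) + 1)) •
          mono N s (ν + e (n + 1) - e (n - 1))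
        - (qsym s (v n) * qp s (-v n + v (n + 2) + 1)) • mono N s (ν + e (n + 2) - e n)

/-- Invariance under the subalgebra `U_q(so_{N-2})`, `N ≥ 4`.  It is generated by its Cartan part
`K̂_i^{±1}`, `2 ≤ i ≤ n`, and, if `N ≥ 5`, by the root vectors `E_i, F_i`, `2 ≤ i ≤ n`; `so_2` has
no root vectors.  An element `p` is invariant (that is, `X ▹ p = ε(X) p` for all `X`, where `ε` is
the counit) if and only if it is so for these generators, and `ε(K̂_i) = 1`,
`ε(E_i) = ε(F_i) = 0`. -/
def IsInvariant (p : A N s) : Prop :=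
  ∀ i : ℕ, 2 ≤ i → i ≤ rk N → Khat N s i p = p ∧ (5 ≤ N → E N s i p = 0 ∧ F N s i p = 0)

/-! ### Differential operators, `q`-Laplace operator, harmonic polynomials -/

/-- The differential operator `∂_i`, `i = 1, …, N`. -/
def D (i : ℕ) : A N s →ₗ[ℂ] A N s :=
  linExt N s fun ν =>
    let v : ℕ → ℤ := fun j => (ν j : ℤ)
    let n := rk N
    if i ≤ n then (qsym s (v i) * qp s (S ν (i + 1) N)) • mono N s (ν - e i)
    else if i = pr N i then (qnum s (v i) * qp s (S ν (i + 1) N)) • mono N s (ν - e i)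
    else
      -- here `i = k'` with `k ≤ n`
      let k := pr N i
      (qsym s (v i) * qp s (v k + S ν (i + 1) N)) • mono N s (ν - e i)
        + ∑ j ∈ Finset.Icc (k + 1) n,
            (qsym s (v j) * qsym s (v (pr N j)) * (qp s 1 - qp s (-1)) *
              qh s (rho2 N k - rho2 N j) * qp s (S ν k (j - 1) + S ν (pr N (j - 1)) N)) •
              mono N s (ν + e k - e j - e (pr N j))
        + (if Odd N then
            (qnum s (v (n + 1) - 1) * qnum s (v (n + 1)) *
              ((qp s 1 - qp s (-1)) / (1 + qp s 1)) * qh s (rho2 N k + 4) *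
              qp s (S ν k N - 2 * v (n + 1))) •
              mono N s (ν + e k - e (n + 1) - e (n + 1))
          else 0)

/-- The `q`-Laplace operator `Δ_q = ∑_i q^{ρ_i} ∂_i ∂_{i'}`. -/
def Lap : A N s →ₗ[ℂ] A N s :=
  ∑ i ∈ Finset.Icc 1 N, qh s (rho2 N i) • (D N s i ∘ₗ D N s (pr N i))

/-- The squared `q`-radius `Q = ∑_i q^{ρ_{i'}} x_i x_{i'}`. -/
def Q : A N s := ∑ i ∈ Finset.Icc 1 N, qh s (rho2 N (pr N i)) • (X N s i * X N s (pr N i))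

/-- The space `𝒜_m` of homogeneous polynomials of degree `m`. -/
def homog (m : ℕ) : Submodule ℂ (A N s) :=
  Submodule.span ℂ {p | ∃ ν : ℕ → ℕ, (∑ i ∈ Finset.Icc 1 N, ν i) = m ∧ p = mono N s ν}

/-- The space `ℋ_m` of homogeneous `q`-harmonic polynomials of degree `m`. -/
def harm (m : ℕ) : Submodule ℂ (A N s) := homog N s m ⊓ LinearMap.ker (Lap N s)

/-- The projector `𝖧_m : 𝒜_m = ℋ_m ⊕ Q 𝒜_{m-2} → ℋ_m` (where `𝒜_{m-2} = 0` if `m < 2`), extended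
by zero to the other homogeneous components of `𝒜 = ⨁_k 𝒜_k`; these conditions determine it. -/
def harmProj (m : ℕ) : A N s →ₗ[ℂ] A N s :=
  Classical.epsilon fun P : A N s →ₗ[ℂ] A N s =>
    (∀ p ∈ harm N s m, P p = p) ∧
    (∀ k : ℕ, k + 2 = m → ∀ r ∈ homog N s k, P (Q N s * r) = 0) ∧
    (∀ k : ℕ, k ≠ m → ∀ r ∈ homog N s k, P r = 0)

/-! ### The quantum sphere and the scalar product -/

/-- The relation `Q = 1`. -/
inductive SphereRel : A N s → A N s → Prop
  | mk : SphereRel (Q N s) 1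

/-- The algebra of functions on the quantum sphere: the quotient of `𝒜` by the two-sided ideal
generated by `Q - 1`. -/
abbrev Sphere : Type := RingQuot (SphereRel N s)

/-- The restriction `τ` of polynomials to the quantum sphere. -/
def τ : A N s →ₐ[ℂ] Sphere N s := RingQuot.mkAlgHom ℂ (SphereRel N s)

/-- The value of the invariant functional on `τ x^ν`. -/
def haarValue (ν : ℕ → ℕ) : ℂ :=
  let n := rk N
  let m := if Odd N then ν (n + 1) / 2 else 0
  open Classical in
  if (∀ i ∈ Finset.Icc 1 n, ν i = ν (pr N i)) ∧ (Odd N → Even (ν (n + 1))) then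
    ((∏ i ∈ Finset.Icc 1 n, poch (qp s (-2)) (qp s (-2)) (ν i)) *
        poch (qp s (-1)) (qp s (-2)) m * (1 + qp s 1) ^ m) /
      (qh s ((∑ i ∈ Finset.Icc 1 n, rho2 N i * (ν i : ℤ)) + 2 * m) *
        (1 + qp s ((N : ℤ) - 2)) ^ ((∑ i ∈ Finset.Icc 1 n, ν i) + m) *
        poch (qp s (-(N : ℤ))) (qp s (-2)) ((∑ i ∈ Finset.Icc 1 n, ν i) + m))
  else 0

/-- The invariant functional on the quantum sphere: the linear functional with the values
`haarValue` on the elements `τ x^ν` (which span). -/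
def haar : Sphere N s →ₗ[ℂ] ℂ :=
  Classical.epsilon fun h : Sphere N s →ₗ[ℂ] ℂ =>
    ∀ ν : ℕ → ℕ, h (τ N s (mono N s ν)) = haarValue N s ν

/-- The `*`-operation: the anti-automorphism of the ring `𝒜` that restricts to `σ` on the scalars
and satisfies `x_i^* = q^{ρ_{i'}} x_{i'}`.  Here `σ` is an involutive automorphism of `ℂ` that fixes
the structure constants of `𝒜`: complex conjugation if `q` is real (`q > 0` if `N` is odd), or
the identity, for any `q`, if one wants a complex-linear anti-automorphism. -/
def starMap (σ : ℂ →+* ℂ) : A N s →+ A N s :=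
  Classical.epsilon fun T : A N s →+ A N s =>
    (∀ c : ℂ, T (algebraMap ℂ (A N s) c) = algebraMap ℂ (A N s) (σ c)) ∧
    (∀ a b : A N s, T (a * b) = T b * T a) ∧
    (∀ i : ℕ, 1 ≤ i → i ≤ N → T (X N s i) = qh s (rho2 N (pr N i)) • X N s (pr N i))

/-- The scalar product `⟨p₁, p₂⟩ = h((τ p₁)^* (τ p₂))`. -/
def scal (σ : ℂ →+* ℂ) (p₁ p₂ : A N s) : ℂ :=
  haar N s (τ N s (starMap N s σ p₁) * τ N s p₂)

/-! ### Zonal polynomials -/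

/-- Zonal polynomials of degree `m` with respect to `U_q(so_{N-2})`. -/
def IsZonal (m : ℕ) (p : A N s) : Prop := p ∈ harm N s m ∧ IsInvariant N s p

/-- `φ^m_{a b} = 𝖧_m (x_1^a x_{1'}^b)`, where `m = a + b`. -/
def phi (a b : ℕ) : A N s := harmProj N s (a + b) (X N s 1 ^ a * X N s (pr N 1) ^ b)

/-- `2 ε`, where `ε = 1` for `N = 2n` and `ε = 1/2` for `N = 2n + 1`. -/
def eps2 : ℤ := if Odd N then 1 else 2

/-- The coefficient `C^k_{a b}` of the explicit form, where `m = a + b`. -/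
def coeffC (a b k : ℕ) : ℂ :=
  (poch (qp s (-2 * (a : ℤ))) (qp s 2) k * poch (qp s (-2 * (b : ℤ))) (qp s 2) k) /
      (poch (qp s 2) (qp s 2) k * poch (qp s (-(N : ℤ) - 2 * ((a : ℤ) + b) + 4)) (qp s 2) k) *
    (qh s ((-2 * (rk N : ℤ) + 4 + eps2 N) * k) / (1 + qp s ((N : ℤ) - 2)) ^ k)

end QE

end

/-! # Zonal polynomials on the quantum Euclidean space

*The algebra.* Sorted from the inside to the outside, the generators are a middle one (for odd `N`)
and the pairs `x_i, x_{i'}`, and the relations say that each new pair `q`-commutes with everything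
inside, while `x_{i'} x_i - x_i x_{i'}` is `q - q⁻¹` times the radius of the generators inside
(`PairRels`, `X_rels`). This makes the radius central. It also makes the algebra an iterated
extension, for which a faithful model can be written down pair by pair (`exists_model`); so the
monomials form a basis (`exists_linear`), and `linExt` has the prescribed values.

*The operators.* In terms of divided powers `y v = x^v / ∏ [v_i]!`, with `y v = 0` as soon as an entry
of `v` is negative, all operators are sums of weighted shifts, with formulas that hold for all integral
`v`. The Laplace operator and the multiplication by the radius become sums of shifts by
`∓(ε_j + ε_{j'})` (`Generic.Lap_y'`, `Generic.rad_y'`); in the first case, the many terms of the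
derivatives telescope. A comparison of coefficients shows that `Q` commutes with `K̂_i`, `E_i` and
`F_i`, and that `Δ_q Q - q² Q Δ_q` is a scalar on each homogeneous component (`Generic.Lap_rad`). Hence
`Δ_q Q^k p = q^{2k} Q^k Δ_q p + c_k Q^{k-1} p` with an explicit scalar `c_k`, which is not zero since
`q` is not a root of unity (`Generic.Lap_Q_pow`, `Generic.lapScalar_ne`). It follows that
`ℋ_m ∩ Q 𝒜_{m-2} = 0`, so that the projector exists (`Generic.harmProj_spec`).

*The explicit form.* As `Δ_q x_1^a x_{1'}^b` is a multiple of `x_1^{a-1} x_{1'}^{b-1}`, harmonicity of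
`∑ C^k Q^k x_1^{a-k} x_{1'}^{b-k}` is a two-term recursion for `C^k`, which the given coefficients solve
(`Generic.coeffC_rec`). So this sum is the projection of `x_1^a x_{1'}^b` (`Generic.phi_eq`), and it is
invariant because `Q`, `x_1` and `x_{1'}` are.

*Orthogonality.* The values of `h` are compatible with `Q = 1` (`Generic.haar_telescope`), so `h` exists;
it vanishes on eigenvectors of the automorphism `K̂_1` of nonzero weight, `*` inverts weights, and `φ_{a b}`
has the weight `a - b` (`Generic.scal_phi_eq_zero`).

*Independence.* The weights of the `φ_{a b}` of degree `m` are different, and none of them is zero: on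
the cone `Q = 0`, which has a representation with invertible `x_1`, `x_{1'}`, the polynomial `φ_{a b}`
becomes `x_1^a x_{1'}^b` (`Generic.exists_cone_rep`, `Generic.phi_ne_zero`).

*Completeness.* For an invariant, `K̂_i p = p` and `E_i p = 0`, `i ≥ 2`, express all coefficients by those
at the monomials `x_1^a x_2^K x_{2'}^K x_{1'}^b` (`Generic.eq_zero_of_core`). Comparison with
`Q^K x_1^a x_{1'}^b` shows that all invariants are combinations of the latter (`Generic.mem_invSpan`).
Modulo `Q 𝒜_{m-2}` only `K = 0` remains, where `x_1^a x_{1'}^b` can be replaced by `φ_{a b}`; so a zonal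
polynomial differs from a combination of the `φ_{a b}` by a harmonic multiple of `Q`, which is zero. -/

noncomputable section
namespace QE

/-! ### The relations in terms of pairs of generators -/

section Monomials

variable {R : Type*} [Ring R]

/-- The ordered monomials `u_{t-1}^{α_{t-1}} ⋯ u_0^{α_0} z^r w_0^{β_0} ⋯ w_{t-1}^{β_{t-1}}`. -/
def pairMono (z : R) (u w : ℕ → R) (α β : ℕ → ℕ) (r : ℕ) : ℕ → R
  | 0 => z ^ r
  | t + 1 => u t ^ α t * pairMono z u w α β r t * w t ^ β t

/-- The degree of `pairMono`. -/
def pairDeg (α β : ℕ → ℕ) (r : ℕ) : ℕ → ℕ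
  | 0 => r
  | t + 1 => α t + pairDeg α β r t + β t

theorem pairMono_congr {z : R} {u w : ℕ → R} {α β α' β' : ℕ → ℕ} (r : ℕ) {t : ℕ}
    (h : ∀ i < t, α i = α' i ∧ β i = β' i) :
    pairMono z u w α β r t = pairMono z u w α' β' r t := by
  induction t with
  | zero => rfl
  | succ t ih =>
    rw [pairMono, pairMono, ih fun i hi => h i (by omega), (h t (by omega)).1, (h t (by omega)).2]

end Monomials

section Pairs

variable {R : Type*} [Ring R] [Algebra ℂ R]

/-- The partial radii: `radius q κ z u w 0 = κ z²`, and each new pair `(u_t, w_t)` of generators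
changes the radius `Z` into `u_t w_t + q Z`. -/
def radius (q κ : ℂ) (z : R) (u w : ℕ → R) : ℕ → R
  | 0 => κ • (z * z)
  | t + 1 => u t * w t + q • radius q κ z u w t

/-- The relations of the quantum Euclidean space, sorted from the inside to the outside: `z` is the
middle generator (zero if there is none) and `(u_i, w_i)`, `i < t`, are the pairs
`(x_{n-i}, x_{(n-i)'})`. -/
structure PairRels (q κ : ℂ) (z : R) (u w : ℕ → R) (t : ℕ) : Prop where
  uu : ∀ i j, i < j → j < t → u j * u i = q • (u i * u j)
  ww : ∀ i j, i < j → j < t → w i * w j = q • (w j * w i)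
  uw : ∀ i j, i < t → j < t → i ≠ j → u i * w j = q • (w j * u i)
  uz : ∀ i, i < t → u i * z = q • (z * u i)
  zw : ∀ i, i < t → z * w i = q • (w i * z)
  wu : ∀ i, i < t → w i * u i = u i * w i + (q - q⁻¹) • radius q κ z u w i

variable {q κ : ℂ} {z : R} {u w : ℕ → R} {T : ℕ}

theorem mul_comm_q_pow {c : ℂ} {a b : R} (h : a * b = c • (b * a)) (k : ℕ) :
    a * b ^ k = c ^ k • (b ^ k * a) := by
  induction k with
  | zero => simp
  | succ k ih =>
    rw [pow_succ, ← mul_assoc, ih, smul_mul_assoc, mul_assoc, h, mul_smul_comm, smul_smul,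
      mul_assoc, pow_succ]

theorem mul_inv_comm {c : ℂ} (hc : c ≠ 0) {a b : R} (h : a * b = c • (b * a)) :
    b * a = c⁻¹ • (a * b) := by
  rw [h, smul_smul, inv_mul_cancel₀ hc, one_smul]

theorem mul_mul_comm_q {c d : ℂ} {a b b' : R} (h : a * b = c • (b * a))
    (h' : a * b' = d • (b' * a)) : a * (b * b') = (c * d) • (b * b' * a) := by
  rw [← mul_assoc, h, smul_mul_assoc, mul_assoc, h', mul_smul_comm, smul_smul, mul_assoc]

theorem mul_mul_comm_q' {c d : ℂ} {a b b' : R} (h : b * a = c • (a * b))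
    (h' : b' * a = d • (a * b')) : b * b' * a = (c * d) • (a * (b * b')) := by
  rw [mul_assoc, h', mul_smul_comm, ← mul_assoc, h, smul_mul_assoc, smul_smul, mul_assoc, mul_comm]

theorem PairRels.u_radius (h : PairRels q κ z u w T) {t j : ℕ} (ht : t ≤ j) (hj : j < T) :
    u j * radius q κ z u w t = q ^ 2 • (radius q κ z u w t * u j) := by
  induction t with
  | zero =>
    rw [radius, mul_smul_comm, mul_mul_comm_q (h.uz j hj) (h.uz j hj), smul_comm, smul_mul_assoc,
      pow_two]
  | succ t ih =>
    rw [radius, mul_add, mul_smul_comm, ih (by omega),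
      mul_mul_comm_q (h.uu t j (by omega) hj) (h.uw j t hj (by omega) (by omega)), add_mul,
      smul_mul_assoc, smul_add, pow_two, smul_comm]

theorem PairRels.radius_w (h : PairRels q κ z u w T) {t j : ℕ} (ht : t ≤ j) (hj : j < T) :
    radius q κ z u w t * w j = q ^ 2 • (w j * radius q κ z u w t) := by
  induction t with
  | zero =>
    rw [radius, smul_mul_assoc, mul_mul_comm_q' (h.zw j hj) (h.zw j hj), smul_comm, mul_smul_comm,
      pow_two]
  | succ t ih =>
    rw [radius, add_mul, smul_mul_assoc, ih (by omega),
      mul_mul_comm_q' (h.uw t j (by omega) hj (by omega)) (h.ww t j (by omega) hj), mul_add,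
      mul_smul_comm, smul_add, pow_two, smul_comm]

theorem commute_mul_of_q {c : ℂ} (hc : c ≠ 0) {a b b' : R} (h : b * a = c • (a * b))
    (h' : a * b' = c • (b' * a)) : b * b' * a = a * (b * b') := by
  rw [mul_mul_comm_q' h (mul_inv_comm hc h'), mul_inv_cancel₀ hc, one_smul]

theorem PairRels.radius_z (hq : q ≠ 0) (h : PairRels q κ z u w T) {t : ℕ} (ht : t ≤ T) :
    radius q κ z u w t * z = z * radius q κ z u w t := by
  induction t with
  | zero => simp [radius, mul_assoc]
  | succ t ih =>
    rw [radius, add_mul, mul_add, smul_mul_assoc, ih (by omega), mul_smul_comm,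
      commute_mul_of_q hq (h.uz t (by omega)) (h.zw t (by omega))]

theorem PairRels.radius_u (hq : q ≠ 0) (h : PairRels q κ z u w T) {t i : ℕ} (ht : t ≤ T)
    (hi : i < t) : radius q κ z u w t * u i = u i * radius q κ z u w t := by
  induction t with
  | zero => omega
  | succ t ih =>
    rw [radius, add_mul, mul_add, smul_mul_assoc, mul_smul_comm]
    rcases Nat.lt_succ_iff_lt_or_eq.1 hi with hi | rfl
    · rw [ih (by omega) hi,
        commute_mul_of_q hq (h.uu i t hi (by omega)) (h.uw i t (by omega) (by omega) (by omega))]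
    · rw [mul_inv_comm (pow_ne_zero 2 hq) (h.u_radius le_rfl (by omega)), mul_assoc,
        h.wu i (by omega), mul_add, mul_smul_comm, smul_smul, add_assoc, ← add_smul]
      congr 3
      field_simp
      ring

theorem PairRels.radius_w' (hq : q ≠ 0) (h : PairRels q κ z u w T) {t i : ℕ} (ht : t ≤ T)
    (hi : i < t) : radius q κ z u w t * w i = w i * radius q κ z u w t := by
  induction t with
  | zero => omega
  | succ t ih =>
    rw [radius, add_mul, mul_add, smul_mul_assoc, mul_smul_comm]
    rcases Nat.lt_succ_iff_lt_or_eq.1 hi with hi | rfl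
    · rw [ih (by omega) hi]
      congr 1
      exact commute_mul_of_q hq (h.uw t i (by omega) (by omega) (by omega)) (h.ww i t hi (by omega))
    · rw [mul_inv_comm (pow_ne_zero 2 hq) (h.radius_w le_rfl (by omega)), ← mul_assoc,
        h.wu i (by omega), add_mul, smul_mul_assoc, h.radius_w le_rfl (by omega)]
      simp only [smul_smul, add_assoc, ← add_smul]
      congr 3
      field_simp
      ring

theorem PairRels.w_pairMono (hq : q ≠ 0) (h : PairRels q κ z u w T) (α β : ℕ → ℕ) (r : ℕ)
    {t j : ℕ} (ht : t ≤ j) (hj : j < T) :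
    w j * pairMono z u w α β r t =
      (q⁻¹) ^ pairDeg α β r t • (pairMono z u w α β r t * w j) := by
  induction t with
  | zero => exact mul_comm_q_pow (mul_inv_comm hq (h.zw j hj)) r
  | succ t ih =>
    rw [pairMono, pairDeg, pow_add, pow_add]
    exact mul_mul_comm_q (mul_mul_comm_q
      (mul_comm_q_pow (mul_inv_comm hq (h.uw t j (by omega) hj (by omega))) _) (ih (by omega)))
      (mul_comm_q_pow (mul_inv_comm hq (h.ww t j (by omega) hj)) _)

/-- The coefficient in `w_t u_t^a = u_t^a w_t + (q - q⁻¹) geom q a u_t^{a-1} Z_t`. -/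
def geom (q : ℂ) (a : ℕ) : ℂ := ∑ i ∈ Finset.range a, (q ^ 2)⁻¹ ^ i

theorem PairRels.w_u_pow (hq : q ≠ 0) (h : PairRels q κ z u w T) {t : ℕ} (ht : t < T) (a : ℕ) :
    w t * u t ^ (a + 1) = u t ^ (a + 1) * w t +
      ((q - q⁻¹) * geom q (a + 1)) • (u t ^ a * radius q κ z u w t) := by
  have hZ : radius q κ z u w t * u t = (q ^ 2)⁻¹ • (u t * radius q κ z u w t) :=
    mul_inv_comm (pow_ne_zero 2 hq) (h.u_radius le_rfl ht)
  induction a with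
  | zero => simp [geom, h.wu t ht]
  | succ a ih =>
    rw [pow_succ, ← mul_assoc, ih, add_mul, mul_assoc (u t ^ (a + 1)), h.wu t ht, smul_mul_assoc,
      mul_assoc (u t ^ a), hZ, mul_add, mul_smul_comm, mul_smul_comm, smul_smul, ← mul_assoc,
      ← mul_assoc, ← pow_succ, ← pow_succ, add_assoc, ← add_smul]
    congr 2
    have : geom q (a + 1 + 1) = 1 + (q ^ 2)⁻¹ * geom q (a + 1) := by
      rw [geom, Finset.sum_range_succ', geom, Finset.mul_sum, add_comm]
      simp [pow_succ']
    rw [this]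
    ring

/-- The span of the ordered monomials. -/
def pairSpan (z : R) (u w : ℕ → R) (t : ℕ) : Submodule ℂ R :=
  Submodule.span ℂ {p | ∃ α β r, p = pairMono z u w α β r t}

theorem pairSpan_succ (t a b : ℕ) {p : R} (hp : p ∈ pairSpan z u w t) :
    u t ^ a * p * w t ^ b ∈ pairSpan z u w (t + 1) := by
  induction hp using Submodule.span_induction with
  | mem x hx =>
    obtain ⟨α, β, r, rfl⟩ := hx
    refine Submodule.subset_span ⟨Function.update α t a, Function.update β t b, r, ?_⟩
    have e : pairMono z u w (Function.update α t a) (Function.update β t b) r t =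
        pairMono z u w α β r t := pairMono_congr r fun i hi => by
      rw [Function.update_of_ne hi.ne, Function.update_of_ne hi.ne]; exact ⟨rfl, rfl⟩
    rw [pairMono, Function.update_self, Function.update_self, e]
  | zero => simp
  | add x y _ _ hx hy => rw [mul_add, add_mul]; exact add_mem hx hy
  | smul c x _ hx => rw [mul_smul_comm, smul_mul_assoc]; exact Submodule.smul_mem _ _ hx

/-- The span of the ordered monomials is closed under left multiplication by the generators. -/
theorem PairRels.mul_mem_pairSpan (hq : q ≠ 0) (h : PairRels q κ z u w T) {t : ℕ} (ht : t ≤ T)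
    {p : R} (hp : p ∈ pairSpan z u w t) :
    z * p ∈ pairSpan z u w t ∧
      ∀ i < t, u i * p ∈ pairSpan z u w t ∧ w i * p ∈ pairSpan z u w t := by
  induction t generalizing p with
  | zero =>
    refine ⟨?_, fun i hi => by omega⟩
    induction hp using Submodule.span_induction with
    | mem x hx =>
      obtain ⟨α, β, r, rfl⟩ := hx
      exact Submodule.subset_span ⟨α, β, r + 1, by simp [pairMono, pow_succ']⟩
    | zero => simp
    | add x y _ _ hx hy => rw [mul_add]; exact add_mem hx hy
    | smul c x _ hx => rw [mul_smul_comm]; exact Submodule.smul_mem _ _ hx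
  | succ t ih =>
    have hrad : ∀ j ≤ t, ∀ p ∈ pairSpan z u w t,
        radius q κ z u w j * p ∈ pairSpan z u w t := by
      intro j hj
      induction j with
      | zero =>
        intro p hp
        rw [radius, smul_mul_assoc, mul_assoc]
        exact Submodule.smul_mem _ _ (ih (by omega) (ih (by omega) hp).1).1
      | succ j ihj =>
        intro p hp
        rw [radius, add_mul, smul_mul_assoc, mul_assoc]
        exact add_mem ((ih (by omega) ((ih (by omega) hp).2 j (by omega)).2).2 j (by omega)).1
          (Submodule.smul_mem _ _ (ihj (by omega) p hp))
    have key : ∀ (c : ℂ) (y : R), y * u t = c • (u t * y) →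
        (∀ p ∈ pairSpan z u w t, y * p ∈ pairSpan z u w t) →
        ∀ a b, ∀ p ∈ pairSpan z u w t, y * (u t ^ a * p * w t ^ b) ∈ pairSpan z u w (t + 1) := by
      intro c y hy hyp a b p hp
      have : y * (u t ^ a * p * w t ^ b) = c ^ a • (u t ^ a * (y * p) * w t ^ b) := by
        rw [mul_assoc, ← mul_assoc, mul_comm_q_pow hy, smul_mul_assoc]
        simp only [mul_assoc]
      rw [this]
      exact Submodule.smul_mem _ _ (pairSpan_succ t a b (hyp p hp))
    induction hp using Submodule.span_induction with
    | mem x hx =>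
      obtain ⟨α, β, r, rfl⟩ := hx
      have hmem : pairMono z u w α β r t ∈ pairSpan z u w t :=
        Submodule.subset_span ⟨α, β, r, rfl⟩
      rw [pairMono]
      refine ⟨key q⁻¹ z (mul_inv_comm hq (h.uz t (by omega)))
        (fun p hp => (ih (by omega) hp).1) _ _ _ hmem, fun i hi => ?_⟩
      rcases Nat.lt_succ_iff_lt_or_eq.1 hi with hi | rfl
      · exact ⟨key q⁻¹ (u i) (mul_inv_comm hq (h.uu i t hi (by omega)))
          (fun p hp => ((ih (by omega) hp).2 i hi).1) _ _ _ hmem,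
          key q⁻¹ (w i) (mul_inv_comm hq (h.uw t i (by omega) (by omega) (by omega)))
          (fun p hp => ((ih (by omega) hp).2 i hi).2) _ _ _ hmem⟩
      · constructor
        · rw [← mul_assoc, ← mul_assoc, ← pow_succ']
          exact pairSpan_succ i _ _ hmem
        · have h1 : ∀ a, u i ^ a * w i * (pairMono z u w α β r i * w i ^ β i) ∈
              pairSpan z u w (i + 1) := by
            intro a
            rw [mul_assoc, ← mul_assoc (w i), h.w_pairMono hq α β r le_rfl (by omega),
              smul_mul_assoc, mul_assoc, ← pow_succ', mul_smul_comm, ← mul_assoc]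
            exact Submodule.smul_mem _ _ (pairSpan_succ i _ _ hmem)
          cases α i with
          | zero => simpa [mul_assoc] using h1 0
          | succ a =>
            rw [mul_assoc, ← mul_assoc (w i), h.w_u_pow hq (by omega), add_mul, smul_mul_assoc,
              mul_assoc (u i ^ a), ← mul_assoc (radius _ _ _ _ _ _), ← mul_assoc (u i ^ a)]
            exact add_mem (h1 _) (Submodule.smul_mem _ _ (pairSpan_succ i _ _
              (hrad i le_rfl _ hmem)))
    | zero => simp
    | add x y _ _ hx hy =>
      simp only [mul_add]
      exact ⟨add_mem hx.1 hy.1, fun i hi => ⟨add_mem (hx.2 i hi).1 (hy.2 i hi).1,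
        add_mem (hx.2 i hi).2 (hy.2 i hi).2⟩⟩
    | smul c x _ hx =>
      simp only [mul_smul_comm]
      exact ⟨Submodule.smul_mem _ _ hx.1, fun i hi => ⟨Submodule.smul_mem _ _ (hx.2 i hi).1,
        Submodule.smul_mem _ _ (hx.2 i hi).2⟩⟩

/-- Multiplication by the radius is given by a simple formula on ordered monomials, because the
radius is central and can be inserted in the middle. -/
theorem PairRels.radius_pairMono (hq : q ≠ 0) (h : PairRels q κ z u w T) (α β : ℕ → ℕ) (r : ℕ)
    {t : ℕ} (ht : t ≤ T) :
    radius q κ z u w t * pairMono z u w α β r t =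
      ∑ i ∈ Finset.range t, (q ^ (t - 1 - i) * (q⁻¹) ^ pairDeg α β r i) •
        pairMono z u w (α + Pi.single i 1) (β + Pi.single i 1) r t
      + (q ^ t * κ) • pairMono z u w α β (r + 2) t := by
  induction t with
  | zero => simp [radius, pairMono, pow_succ', mul_assoc]
  | succ t ih =>
    have h1 : radius q κ z u w (t + 1) * u t ^ α t = u t ^ α t * radius q κ z u w (t + 1) :=
      ((show Commute (radius q κ z u w (t + 1)) (u t) from
        h.radius_u hq ht (by omega)).pow_right _).eq
    have h2 : u t * w t * pairMono z u w α β r t = (q⁻¹) ^ pairDeg α β r t •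
        (u t * pairMono z u w α β r t * w t) := by
      rw [mul_assoc, h.w_pairMono hq α β r le_rfl (by omega), mul_smul_comm, mul_assoc]
    rw [pairMono, ← mul_assoc, ← mul_assoc, h1, mul_assoc (u t ^ α t), radius, add_mul, h2,
      smul_mul_assoc, ih (by omega), Finset.sum_range_succ]
    have h3 : pairMono z u w (α + Pi.single t 1) (β + Pi.single t 1) r (t + 1) =
        u t ^ (α t + 1) * pairMono z u w α β r t * w t ^ (β t + 1) := by
      rw [pairMono, pairMono_congr r (α' := α) (β' := β)]
      · simp
      · intro i hi
        simp [hi.ne]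
    rw [h3]
    simp only [smul_add, Finset.smul_sum, mul_add, Finset.mul_sum, mul_smul_comm, smul_mul_assoc,
      add_mul, Finset.sum_mul, smul_smul]
    rw [add_comm (_ • _) (_ + _), add_right_comm]
    congr 1
    · congr 1
      · refine Finset.sum_congr rfl fun i hi => ?_
        have hi := Finset.mem_range.1 hi
        rw [pairMono]
        have e1 : t + 1 - 1 - i = t - 1 - i + 1 := by omega
        simp only [Pi.add_apply, Pi.single_eq_of_ne hi.ne', add_zero]
        rw [e1, pow_succ]
        congr 1
        ring
      · simp [pow_succ, mul_assoc, pow_succ' (w t)]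
    · rw [pairMono, pow_succ', mul_assoc q]

end Pairs

/-! ### A faithful model of the relations -/

section Model

variable {V : Type} [AddCommGroup V] [Module ℂ V]

/-- The operator `f ↦ u f` on the formal expansions `∑ u^a f(a, b) w^b`. -/
def modelU : Module.End ℂ (ℕ → ℕ → V) where
  toFun f a b := Nat.casesOn a 0 fun a => f a b
  map_add' f g := by ext a b; cases a <;> simp
  map_smul' c f := by ext a b; cases a <;> simp

/-- The operator `f ↦ y f` on the formal expansions `∑ u^a f(a, b) w^b`, where `u y = q y u`. -/
def modelY (q : ℂ) (y : Module.End ℂ V) : Module.End ℂ (ℕ → ℕ → V) where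
  toFun f a b := (q⁻¹) ^ a • y (f a b)
  map_add' f g := by ext a b; simp
  map_smul' c f := by ext a b; simp [smul_comm c]

/-- The operator `f ↦ w f` on the formal expansions `∑ u^a f(a, b) w^b`, where
`w u = u w + (q - q⁻¹) Z`, `u Z = q² Z u` and `w p = (G p) w` for the coefficients `p`. -/
def modelW (q : ℂ) (G Z : Module.End ℂ V) : Module.End ℂ (ℕ → ℕ → V) where
  toFun f a b := (Nat.casesOn b 0 fun b => G (f a b)) +
    ((q - q⁻¹) * geom q (a + 1)) • Z (f (a + 1) b)
  map_add' f g := by ext a b; cases b <;> simp; abel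
  map_smul' c f := by ext a b; cases b <;> simp [smul_comm c]

/-- The operator `f ↦ G f` on the formal expansions `∑ u^a f(a, b) w^b`, where `G` multiplies
by `q⁻¹` to the power of the degree. -/
def modelG (q : ℂ) (G : Module.End ℂ V) : Module.End ℂ (ℕ → ℕ → V) where
  toFun f a b := (q⁻¹) ^ (a + b) • G (f a b)
  map_add' f g := by ext a b; simp
  map_smul' c f := by ext a b; simp [smul_comm c]

@[simp] theorem modelU_zero (f : ℕ → ℕ → V) (b : ℕ) : modelU f 0 b = 0 := rfl
@[simp] theorem modelU_succ (f : ℕ → ℕ → V) (a b : ℕ) : modelU f (a + 1) b = f a b := rfl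
@[simp] theorem modelY_apply (q : ℂ) (y : Module.End ℂ V) (f : ℕ → ℕ → V) (a b : ℕ) :
    modelY q y f a b = (q⁻¹) ^ a • y (f a b) := rfl
@[simp] theorem modelW_zero (q : ℂ) (G Z : Module.End ℂ V) (f : ℕ → ℕ → V) (a : ℕ) :
    modelW q G Z f a 0 = ((q - q⁻¹) * geom q (a + 1)) • Z (f (a + 1) 0) := zero_add _
@[simp] theorem modelW_succ (q : ℂ) (G Z : Module.End ℂ V) (f : ℕ → ℕ → V) (a b : ℕ) :
    modelW q G Z f a (b + 1) =
      G (f a b) + ((q - q⁻¹) * geom q (a + 1)) • Z (f (a + 1) (b + 1)) := rfl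
@[simp] theorem modelG_apply (q : ℂ) (G : Module.End ℂ V) (f : ℕ → ℕ → V) (a b : ℕ) :
    modelG q G f a b = (q⁻¹) ^ (a + b) • G (f a b) := rfl

theorem geom_succ (q : ℂ) (a : ℕ) : geom q (a + 1) = geom q a + (q ^ 2)⁻¹ ^ a :=
  Finset.sum_range_succ _ _

@[simp] theorem geom_zero (q : ℂ) : geom q 0 = 0 := rfl

theorem radius_model {q κ : ℂ} {z : Module.End ℂ V} {u w : ℕ → Module.End ℂ V}
    {u' w' : ℕ → Module.End ℂ (ℕ → ℕ → V)} {t : ℕ} (hu : ∀ i < t, u' i = modelY q (u i))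
    (hw : ∀ i < t, w' i = modelY q (w i)) (f : ℕ → ℕ → V) (a b : ℕ) :
    radius q κ (modelY q z) u' w' t f a b = (q ^ 2)⁻¹ ^ a • radius q κ z u w t (f a b) := by
  induction t with
  | zero =>
    simp only [radius, LinearMap.smul_apply, Module.End.mul_apply, Pi.smul_apply, modelY_apply,
      map_smul, smul_smul]
    congr 1
    ring
  | succ t ih =>
    simp only [radius, LinearMap.smul_apply, Module.End.mul_apply, Pi.smul_apply, modelY_apply,
      map_smul, LinearMap.add_apply, Pi.add_apply, hu t (by omega), hw t (by omega), smul_add,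
      ih (fun i hi => hu i (by omega)) (fun i hi => hw i (by omega)), smul_smul]
    congr 2 <;> ring

theorem modelY_pow (q : ℂ) (y : Module.End ℂ V) (k : ℕ) (f : ℕ → ℕ → V) (a b : ℕ) :
    (modelY q y ^ k) f a b = ((q⁻¹) ^ a) ^ k • (y ^ k) (f a b) := by
  induction k with
  | zero => simp
  | succ k ih => simp [pow_succ', ih, smul_smul]

theorem modelU_pow (k : ℕ) (f : ℕ → ℕ → V) (a b : ℕ) :
    (modelU ^ k) f a b = if k ≤ a then f (a - k) b else 0 := by
  induction k generalizing a with
  | zero => simp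
  | succ k ih => cases a <;> simp [pow_succ', ih]

theorem pairMono_model {q : ℂ} {z : Module.End ℂ V} {u w : ℕ → Module.End ℂ V}
    {u' w' : ℕ → Module.End ℂ (ℕ → ℕ → V)} {t : ℕ} (hu : ∀ i < t, u' i = modelY q (u i))
    (hw : ∀ i < t, w' i = modelY q (w i)) (α β : ℕ → ℕ) (r : ℕ) (f : ℕ → ℕ → V) (a b : ℕ) :
    pairMono (modelY q z) u' w' α β r t f a b =
      ((q⁻¹) ^ a) ^ pairDeg α β r t • pairMono z u w α β r t (f a b) := by
  induction t generalizing f a b with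
  | zero => exact modelY_pow q z r f a b
  | succ t ih =>
    have ih' := ih (fun i hi => hu i (by omega)) (fun i hi => hw i (by omega))
    simp only [pairMono, pairDeg, Module.End.mul_apply, hu t (by omega), hw t (by omega),
      modelY_pow, ih', map_smul, smul_smul, pow_add, mul_assoc]

theorem modelW_pow (q : ℂ) {G Z : Module.End ℂ V} {v : V} (hv : G v = v) (k : ℕ) :
    (modelW q G Z ^ k) (fun a b => if a = 0 ∧ b = 0 then v else 0) =
      fun a b => if a = 0 ∧ b = k then v else 0 := by
  induction k with
  | zero => simp
  | succ k ih =>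
    rw [pow_succ', Module.End.mul_apply, ih]
    ext a b
    rcases b with _ | b
    · simp
    · simp only [modelW_succ, Nat.add_right_cancel_iff, Nat.add_eq_zero_iff, one_ne_zero, and_false,
        false_and, if_false, map_zero, smul_zero, add_zero]
      split_ifs <;> simp [hv]

variable {V₀ : Type} [AddCommGroup V₀] [Module ℂ V₀]

/-- Starting from a model for the middle generator, models of the relations can be built pair by
pair; in these the ordered monomials, applied to a suitable vector `v`, are independent. -/
theorem exists_model {q κ : ℂ} (hq : q ≠ 0) (z₀ G₀ : Module.End ℂ V₀) (v₀ : V₀)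
    (hG : G₀ * z₀ = q⁻¹ • (z₀ * G₀)) (hv : G₀ v₀ = v₀) (t : ℕ) :
    ∃ (V : Type) (_ : AddCommGroup V) (_ : Module ℂ V) (z : Module.End ℂ V)
      (u w : ℕ → Module.End ℂ V) (G : Module.End ℂ V) (v : V)
      (ev : (ℕ → ℕ) → (ℕ → ℕ) → V →ₗ[ℂ] V₀),
      PairRels q κ z u w t ∧ (z₀ = 0 → z = 0) ∧ G * z = q⁻¹ • (z * G) ∧
      (∀ i < t, G * u i = q⁻¹ • (u i * G) ∧ G * w i = q⁻¹ • (w i * G)) ∧ G v = v ∧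
      ∀ (α β : ℕ → ℕ) (r : ℕ) (α' β' : ℕ → ℕ), ev α' β' (pairMono z u w α β r t v) =
        open Classical in if ∀ i < t, α i = α' i ∧ β i = β' i then (z₀ ^ r) v₀ else 0 := by
  induction t with
  | zero =>
    refine ⟨V₀, _, _, z₀, 0, 0, G₀, v₀, fun _ _ => LinearMap.id, ⟨?_, ?_, ?_, ?_, ?_, ?_⟩, id, hG,
      ?_, hv, ?_⟩ <;> simp [pairMono]
  | succ t ih =>
    obtain ⟨V, _, _, z, u, w, G, v, ev, h, hz, hGz, hGuw, hGv, hev⟩ := ih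
    have hZ : ∀ x, G (radius q κ z u w t x) = (q ^ 2)⁻¹ • radius q κ z u w t (G x) := by
      have : ∀ j ≤ t, G * radius q κ z u w j = (q ^ 2)⁻¹ • (radius q κ z u w j * G) := by
        intro j hj
        induction j with
        | zero =>
          rw [radius, mul_smul_comm, mul_mul_comm_q hGz hGz, smul_comm, smul_mul_assoc]
          congr 1
          ring
        | succ j ihj =>
          rw [radius, mul_add, mul_smul_comm, ihj (by omega),
            mul_mul_comm_q (hGuw j (by omega)).1 (hGuw j (by omega)).2, add_mul, smul_add,
            smul_comm q, smul_mul_assoc]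
          congr 2
          ring
      exact fun x => LinearMap.congr_fun (this t le_rfl) x
    let Z := radius q κ z u w t
    let u' : ℕ → Module.End ℂ (ℕ → ℕ → V) := fun i => if i = t then modelU else modelY q (u i)
    let w' : ℕ → Module.End ℂ (ℕ → ℕ → V) := fun i => if i = t then modelW q G Z else modelY q (w i)
    have hut : u' t = modelU := if_pos rfl
    have hwt : w' t = modelW q G Z := if_pos rfl
    have hui : ∀ i < t, u' i = modelY q (u i) := fun i hi => if_neg hi.ne
    have hwi : ∀ i < t, w' i = modelY q (w i) := fun i hi => if_neg hi.ne
    have hYY : ∀ {c : ℂ} {y y' : Module.End ℂ V}, y * y' = c • (y' * y) →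
        modelY q y * modelY q y' = c • (modelY q y' * modelY q y) := by
      intro c y y' hy
      ext f a b
      have := LinearMap.congr_fun hy (f a b)
      simp only [Module.End.mul_apply, LinearMap.smul_apply] at this
      simp [this, smul_smul]
      congr 1
      ring
    have hGY : ∀ {y : Module.End ℂ V}, G * y = q⁻¹ • (y * G) →
        modelG q G * modelY q y = q⁻¹ • (modelY q y * modelG q G) := by
      intro y hy
      ext f a b
      have := LinearMap.congr_fun hy (f a b)
      simp only [Module.End.mul_apply, LinearMap.smul_apply] at this
      simp only [Module.End.mul_apply, LinearMap.smul_apply, modelG_apply, modelY_apply,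
        Pi.smul_apply, map_smul, this, smul_smul]
      congr 1
      ring
    have hUY : ∀ y : Module.End ℂ V, modelU * modelY q y = q • (modelY q y * modelU) := by
      intro y
      ext f a b
      cases a with
      | zero => simp
      | succ a => simp [smul_smul, pow_succ, mul_comm, hq]
    have hYW : ∀ y : Module.End ℂ V, G * y = q⁻¹ • (y * G) → y * Z = Z * y →
        modelY q y * modelW q G Z = q • (modelW q G Z * modelY q y) := by
      intro y hy hyZ
      ext f a b
      have h1 := LinearMap.congr_fun hyZ (f (a + 1) b)
      simp only [Module.End.mul_apply] at h1
      cases b with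
      | zero =>
        simp only [Module.End.mul_apply, LinearMap.smul_apply, modelY_apply, modelW_zero,
          Pi.smul_apply, map_smul, h1, smul_smul]
        congr 1
        rw [pow_succ]
        field_simp
      | succ b =>
        have h2 := LinearMap.congr_fun hy (f a b)
        simp only [Module.End.mul_apply, LinearMap.smul_apply] at h2
        simp only [Module.End.mul_apply, LinearMap.smul_apply, modelY_apply, modelW_succ,
          Pi.smul_apply, map_smul, map_add, h1, h2, smul_smul, smul_add]
        rw [pow_succ]
        congr 2 <;> field_simp
    have hrad : ∀ j ≤ t, ∀ f a b, radius q κ (modelY q z) u' w' j f a b =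
        (q ^ 2)⁻¹ ^ a • radius q κ z u w j (f a b) := fun j hj f a b =>
      radius_model (fun i hi => hui i (by omega)) (fun i hi => hwi i (by omega)) f a b
    have hrels : PairRels q κ (modelY q z) u' w' (t + 1) := by
      refine ⟨?_, ?_, ?_, ?_, ?_, ?_⟩
      · intro i j hij hj
        rw [hui i (by omega)]
        rcases Nat.lt_succ_iff_lt_or_eq.1 hj with hj | rfl
        · rw [hui j hj]; exact hYY (h.uu i j hij hj)
        · rw [hut]; exact hUY _
      · intro i j hij hj
        rw [hwi i (by omega)]
        rcases Nat.lt_succ_iff_lt_or_eq.1 hj with hj | rfl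
        · rw [hwi j hj]; exact hYY (h.ww i j hij hj)
        · rw [hwt]; exact hYW _ (hGuw i hij).2 (h.radius_w' hq le_rfl hij).symm
      · intro i j hi hj hij
        rcases Nat.lt_succ_iff_lt_or_eq.1 hi with hi | rfl
        · rw [hui i hi]
          rcases Nat.lt_succ_iff_lt_or_eq.1 hj with hj | rfl
          · rw [hwi j hj]; exact hYY (h.uw i j hi hj hij)
          · rw [hwt]; exact hYW _ (hGuw i hi).1 (h.radius_u hq le_rfl hi).symm
        · rw [hut, hwi j (by omega)]; exact hUY _
      · intro i hi
        rcases Nat.lt_succ_iff_lt_or_eq.1 hi with hi | rfl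
        · rw [hui i hi]; exact hYY (h.uz i hi)
        · rw [hut]; exact hUY _
      · intro i hi
        rcases Nat.lt_succ_iff_lt_or_eq.1 hi with hi | rfl
        · rw [hwi i hi]; exact hYY (h.zw i hi)
        · rw [hwt]; exact hYW _ hGz (h.radius_z hq le_rfl).symm
      · intro i hi
        rcases Nat.lt_succ_iff_lt_or_eq.1 hi with hi | rfl
        · rw [hui i hi, hwi i hi]
          ext f a b
          have h1 := LinearMap.congr_fun (h.wu i hi) (f a b)
          simp only [Module.End.mul_apply, LinearMap.smul_apply, LinearMap.add_apply] at h1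
          simp only [Module.End.mul_apply, LinearMap.smul_apply, LinearMap.add_apply, Pi.add_apply,
            Pi.smul_apply, modelY_apply, map_smul, h1, hrad i hi.le, smul_add, smul_smul]
          congr 2
          ring
        · rw [hut, hwt]
          ext f a b
          simp only [Module.End.mul_apply, LinearMap.smul_apply, LinearMap.add_apply, Pi.add_apply,
            Pi.smul_apply, hrad i le_rfl]
          rcases a with _ | a <;> rcases b with _ | b <;>
            simp [geom_succ, mul_add, add_smul, smul_smul, Z, add_assoc]
    let v' : ℕ → ℕ → V := fun a b => if a = 0 ∧ b = 0 then v else 0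
    refine ⟨ℕ → ℕ → V, inferInstance, inferInstance, modelY q z, u', w', modelG q G, v',
      fun α β => ev α β ∘ₗ LinearMap.proj (β t) ∘ₗ LinearMap.proj (α t), hrels, ?_, ?_, ?_, ?_, ?_⟩
    · intro h0
      ext f a b
      simp [hz h0]
    · exact hGY hGz
    · intro i hi
      rcases Nat.lt_succ_iff_lt_or_eq.1 hi with hi | rfl
      · rw [hui i hi, hwi i hi]; exact ⟨hGY (hGuw i hi).1, hGY (hGuw i hi).2⟩
      · rw [hut, hwt]
        constructor
        · ext f a b
          cases a with
          | zero => simp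
          | succ a =>
            simp only [Module.End.mul_apply, LinearMap.smul_apply, modelG_apply, modelU_succ,
              Pi.smul_apply, smul_smul]
            congr 1
            ring
        · ext f a b
          cases b with
          | zero =>
            simp only [Module.End.mul_apply, LinearMap.smul_apply, modelG_apply, modelW_zero,
              Pi.smul_apply, smul_smul, map_smul, hZ, Z]
            congr 1
            ring
          | succ b =>
            simp only [Module.End.mul_apply, LinearMap.smul_apply, modelG_apply, modelW_succ,
              Pi.smul_apply, smul_smul, map_smul, map_add, smul_add, hZ, Z]
            congr 2 <;> ring
    · ext a b
      by_cases hab : a = 0 ∧ b = 0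
      · simp [v', hab, hGv]
      · simp [v', hab]
    · intro α β r α' β'
      have e : ∀ a b, pairMono (modelY q z) u' w' α β r (t + 1) v' a b =
          if a = α t ∧ b = β t then pairMono z u w α β r t v else 0 := by
        intro a b
        rw [pairMono, Module.End.mul_apply, Module.End.mul_apply, hut, hwt, modelU_pow,
          modelW_pow q hGv, pairMono_model hui hwi]
        by_cases h1 : a = α t
        · by_cases h2 : b = β t <;> simp [h1, h2]
        · have : ¬ (α t ≤ a ∧ a - α t = 0) := by omega
          by_cases h3 : α t ≤ a
          · simp [h1, show a - α t ≠ 0 by omega]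
          · simp [h1, h3]
      simp only [LinearMap.comp_apply, LinearMap.proj_apply, e]
      by_cases h1 : α' t = α t ∧ β' t = β t
      · rw [if_pos h1, hev]
        refine if_congr ?_ rfl rfl
        refine ⟨fun H i hi => ?_, fun H i hi => H i (by omega)⟩
        rcases Nat.lt_succ_iff_lt_or_eq.1 hi with hi | rfl
        · exact H i hi
        · exact ⟨h1.1.symm, h1.2.symm⟩
      · rw [if_neg h1, map_zero, if_neg]
        exact fun H => h1 ⟨(H t (by omega)).1.symm, (H t (by omega)).2.symm⟩

end Model

/-! ### Powers of the parameter -/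

section Scalars

variable {s : ℂ}

theorem qp_eq_qh (s : ℂ) (a : ℤ) : qp s a = qh s (2 * a) := by
  rw [qp, qh, zpow_mul]; norm_cast

theorem qp_add (hs : s ≠ 0) (a b : ℤ) : qp s (a + b) = qp s a * qp s b :=
  zpow_add₀ (pow_ne_zero 2 hs) a b

theorem qp_neg (s : ℂ) (a : ℤ) : qp s (-a) = (qp s a)⁻¹ := zpow_neg _ _

theorem qp_sub (hs : s ≠ 0) (a b : ℤ) : qp s (a - b) = qp s a / qp s b :=
  zpow_sub₀ (pow_ne_zero 2 hs) a b

@[simp] theorem qp_zero (s : ℂ) : qp s 0 = 1 := zpow_zero _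

theorem qp_one (s : ℂ) : qp s 1 = s ^ 2 := zpow_one _

theorem qp_ne (hs : s ≠ 0) (a : ℤ) : qp s a ≠ 0 := zpow_ne_zero _ (pow_ne_zero 2 hs)

theorem qp_natCast (s : ℂ) (k : ℕ) : qp s k = (s ^ 2) ^ k := zpow_natCast _ _

theorem qh_add (hs : s ≠ 0) (a b : ℤ) : qh s (a + b) = qh s a * qh s b := zpow_add₀ hs a b

theorem qh_neg (s : ℂ) (a : ℤ) : qh s (-a) = (qh s a)⁻¹ := zpow_neg _ _

theorem qh_sub (hs : s ≠ 0) (a b : ℤ) : qh s (a - b) = qh s a / qh s b := zpow_sub₀ hs a b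

@[simp] theorem qh_zero (s : ℂ) : qh s 0 = 1 := zpow_zero _

theorem qh_one (s : ℂ) : qh s 1 = s := zpow_one _

theorem qh_ne (hs : s ≠ 0) (a : ℤ) : qh s a ≠ 0 := zpow_ne_zero _ hs

theorem qp_ne_one (hroot : ∀ k : ℕ, 0 < k → (s ^ 2) ^ k ≠ 1) {a : ℤ} (ha : a ≠ 0) :
    qp s a ≠ 1 := by
  rcases Int.natAbs_eq a with h | h
  · rw [h, qp_natCast]
    exact hroot _ (by omega)
  · rw [h, qp_neg, qp_natCast, ne_eq, inv_eq_one]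
    exact hroot _ (by omega)

/-- Different powers of `q` are different numbers, as `q` is not a root of unity. -/
theorem sq_inj (hs : s ≠ 0) (hroot : ∀ k : ℕ, 0 < k → (s ^ 2) ^ k ≠ 1) {a b : ℤ}
    (h : qp s a = qp s b) : a = b := by
  by_contra hab
  refine qp_ne_one hroot (sub_ne_zero.2 hab) ?_
  rw [qp_sub hs, h, div_self (qp_ne hs b)]

theorem qh_add_qh_neg_ne (hs : s ≠ 0) (hroot : ∀ k : ℕ, 0 < k → (s ^ 2) ^ k ≠ 1) (a : ℤ) :
    qh s a + qh s (-a) ≠ 0 := by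
  intro h
  have h1 : qp s a = -1 := by
    have : qp s a = qh s a * qh s a := by rw [qp_eq_qh, two_mul, qh_add hs]
    rw [this]
    have h2 : qh s a * qh s (-a) = 1 := by rw [← qh_add hs]; simp
    linear_combination qh s a * h - h2
  have h2 : qp s (2 * a) = 1 := by rw [two_mul, qp_add hs, h1]; norm_num
  by_cases ha : a = 0
  · subst ha; norm_num at h1
  · exact qp_ne_one hroot (by omega) h2

theorem one_add_qp_ne (hs : s ≠ 0) (hroot : ∀ k : ℕ, 0 < k → (s ^ 2) ^ k ≠ 1) (a : ℤ) :
    1 + qp s a ≠ 0 := by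
  intro h
  have h1 : qp s a = -1 := by linear_combination h
  have h2 : qp s (2 * a) = 1 := by rw [two_mul, qp_add hs, h1]; norm_num
  by_cases ha : a = 0
  · subst ha; norm_num at h
  · exact qp_ne_one hroot (by omega) h2

theorem q_sub_ne (hs : s ≠ 0) (hroot : ∀ k : ℕ, 0 < k → (s ^ 2) ^ k ≠ 1) :
    s ^ 2 - (s ^ 2)⁻¹ ≠ 0 := by
  intro h
  have h1 : qp s 2 = 1 := by
    have : (s ^ 2) * (s ^ 2)⁻¹ = 1 := mul_inv_cancel₀ (pow_ne_zero 2 hs)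
    rw [show (2 : ℤ) = ((2 : ℕ) : ℤ) by rfl, qp_natCast]
    linear_combination s ^ 2 * h + this
  exact qp_ne_one hroot (by norm_num) h1

theorem one_sub_q_ne (hroot : ∀ k : ℕ, 0 < k → (s ^ 2) ^ k ≠ 1) : 1 - s ^ 2 ≠ 0 := by
  intro h
  exact hroot 1 one_pos (by linear_combination -h)

theorem qsym_ne (hs : s ≠ 0) (hroot : ∀ k : ℕ, 0 < k → (s ^ 2) ^ k ≠ 1) {a : ℤ} (ha : a ≠ 0) :
    qsym s a ≠ 0 := by
  rw [qsym, qp_one, qp_neg s 1, qp_one]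
  refine div_ne_zero (fun h => ha ?_) (q_sub_ne hs hroot)
  have := sq_inj hs hroot (sub_eq_zero.1 h)
  omega

theorem qnum_ne (hroot : ∀ k : ℕ, 0 < k → (s ^ 2) ^ k ≠ 1) {a : ℤ} (ha : a ≠ 0) :
    qnum s a ≠ 0 := by
  rw [qnum, qp_one]
  exact div_ne_zero (sub_ne_zero.2 (qp_ne_one hroot ha).symm) (one_sub_q_ne hroot)

@[simp] theorem qsym_zero (s : ℂ) : qsym s 0 = 0 := by simp [qsym]
@[simp] theorem qnum_zero (s : ℂ) : qnum s 0 = 0 := by simp [qnum]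

end Scalars

/-! ### Generators, relations and the basis of monomials -/

/-- The coefficient of `x_{n+1}²` in the innermost radius: `(q^{1/2} + q^{-1/2})⁻¹` for odd `N`, and
zero for even `N`. -/
def kap (N : ℕ) (s : ℂ) : ℂ := if Odd N then (s + s⁻¹)⁻¹ else 0

/-- The middle one of the generators `x_1, …, x_N`, or zero if `N` is even. -/
def mid {R : Type*} [Zero R] (N : ℕ) (x : ℕ → R) : R := if Odd N then x (rk N + 1) else 0

/-- The number of middle generators. -/
def odd01 (N : ℕ) : ℕ := N % 2

theorem rk_spec (N : ℕ) : 2 * rk N + odd01 N = N := Nat.div_add_mod N 2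

theorem odd01_cases (N : ℕ) : (Odd N ∧ odd01 N = 1) ∨ (¬ Odd N ∧ odd01 N = 0) := by
  rw [Nat.odd_iff, odd01]; omega

theorem pr_eq {N i : ℕ} : pr N i = N + 1 - i := rfl

theorem rho2_low {N t : ℕ} (ht : t < rk N) : rho2 N (rk N - t) = 2 * t + odd01 N := by
  have := rk_spec N
  rw [rho2, if_pos (Nat.sub_le _ _)]
  omega

theorem rho2_high {N t : ℕ} (ht : t < rk N) : rho2 N (pr N (rk N - t)) = -(2 * t + odd01 N) := by
  have := rk_spec N
  rw [rho2, if_neg (by rw [pr]; omega), if_neg (by rw [pr, pr]; omega)]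
  rw [pr_eq, pr_eq]
  omega

theorem rho2_mid {N : ℕ} (h : Odd N) : rho2 N (rk N + 1) = 0 := by
  have := rk_spec N
  have := odd01_cases N
  have h1 : odd01 N = 1 := by tauto
  rw [rho2, if_neg (by omega), if_pos (by rw [pr]; omega)]

theorem pr_pr {N i : ℕ} (hi : 1 ≤ i) (hi' : i ≤ N) : pr N (pr N i) = i := by
  rw [pr, pr]; omega

theorem idx_cases {N i : ℕ} (hi : 1 ≤ i) (hi' : i ≤ N) :
    (∃ a < rk N, i = rk N - a) ∨ (Odd N ∧ i = rk N + 1) ∨ ∃ a < rk N, i = pr N (rk N - a) := by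
  have := rk_spec N
  rcases odd01_cases N with ⟨ho, h1⟩ | ⟨ho, h1⟩
  · by_cases h : i ≤ rk N
    · exact Or.inl ⟨rk N - i, by omega, by omega⟩
    · by_cases h' : i = rk N + 1
      · exact Or.inr (Or.inl ⟨ho, h'⟩)
      · exact Or.inr (Or.inr ⟨rk N - (N + 1 - i), by omega, by rw [pr]; omega⟩)
  · by_cases h : i ≤ rk N
    · exact Or.inl ⟨rk N - i, by omega, by omega⟩
    · exact Or.inr (Or.inr ⟨rk N - (N + 1 - i), by omega, by rw [pr]; omega⟩)

/-- `q^{ρ} + q^{-ρ}`, where `ρ = ρ_i` for the outermost pair among `t` pairs of generators. -/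
def dd (N : ℕ) (s : ℂ) (t : ℕ) : ℂ :=
  qh s (2 * t - 2 + odd01 N) + qh s (-(2 * t - 2 + odd01 N))

theorem dd_ne (N : ℕ) {s : ℂ} (hs : s ≠ 0) (hroot : ∀ k : ℕ, 0 < k → (s ^ 2) ^ k ≠ 1) (t : ℕ) :
    dd N s t ≠ 0 := qh_add_qh_neg_ne hs hroot _

section Lift

variable {R : Type*} [Ring R] [Algebra ℂ R] {N : ℕ} {s : ℂ}

/-- The family `x_1, …, x_N` satisfies the relations in the form of `PairRels`, for the inner
`t` pairs of generators. -/
def XRels (N : ℕ) (s : ℂ) (x : ℕ → R) (t : ℕ) : Prop :=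
  PairRels (s ^ 2) (kap N s) (mid N x) (fun i => x (rk N - i)) (fun i => x (pr N (rk N - i))) t

/-- The radius formed from the inner `t` pairs of the family `x_1, …, x_N`. -/
def xRadius (N : ℕ) (s : ℂ) (x : ℕ → R) (t : ℕ) : R :=
  radius (s ^ 2) (kap N s) (mid N x) (fun i => x (rk N - i)) (fun i => x (pr N (rk N - i))) t

theorem xRadius_zero_odd (x : ℕ → R) (h : Odd N) :
    xRadius N s x 0 = (s + s⁻¹)⁻¹ • (x (rk N + 1) * x (rk N + 1)) := by
  simp [xRadius, radius, kap, mid, h]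

theorem xRadius_zero_even (x : ℕ → R) (h : ¬ Odd N) : xRadius N s x 0 = 0 := by
  simp [xRadius, radius, kap, h]

theorem xRadius_succ (x : ℕ → R) (t : ℕ) : xRadius N s x (t + 1) =
    x (rk N - t) * x (pr N (rk N - t)) + s ^ 2 • xRadius N s x t := rfl

/-- The symmetric quadratic expression `∑ q^{ρ_{j'}} x_j x_{j'}` is a multiple of the radius. -/
theorem sum_quadratic (hs : s ≠ 0) (hroot : ∀ k : ℕ, 0 < k → (s ^ 2) ^ k ≠ 1) (x : ℕ → R) {t : ℕ}
    (ht : t ≤ rk N)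
    (h : ∀ i < t, x (pr N (rk N - i)) * x (rk N - i) = x (rk N - i) * x (pr N (rk N - i)) +
      (s ^ 2 - (s ^ 2)⁻¹) • xRadius N s x i) :
    ∑ j ∈ Finset.Icc (rk N + 1 - t) (pr N (rk N + 1 - t)),
      qh s (rho2 N (pr N j)) • (x j * x (pr N j)) = dd N s t • xRadius N s x t := by
  have hN := rk_spec N
  induction t with
  | zero =>
    rcases odd01_cases N with ⟨ho, h1⟩ | ⟨ho, h1⟩
    · have e : Finset.Icc (rk N + 1 - 0) (pr N (rk N + 1 - 0)) = {rk N + 1} := by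
        rw [show pr N (rk N + 1 - 0) = rk N + 1 by rw [pr]; omega]; simp
      have e2 : pr N (rk N + 1) = rk N + 1 := by rw [pr]; omega
      rw [e, Finset.sum_singleton, e2, rho2_mid ho, xRadius_zero_odd x ho, smul_smul, dd, h1]
      have h2 := qh_add_qh_neg_ne hs hroot 1
      rw [qh_neg, qh_one] at h2
      norm_num [qh_neg, qh_one]
      rw [add_comm s⁻¹ s, mul_inv_cancel₀ h2, one_smul]
    · rw [Finset.Icc_eq_empty (by rw [pr]; omega), xRadius_zero_even x ho]
      simp
  | succ t ih =>
    have e : Finset.Icc (rk N + 1 - (t + 1)) (pr N (rk N + 1 - (t + 1))) =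
        insert (rk N - t) (insert (pr N (rk N - t))
          (Finset.Icc (rk N + 1 - t) (pr N (rk N + 1 - t)))) := by
      ext j
      simp only [Finset.mem_Icc, Finset.mem_insert, pr]
      omega
    rw [e, Finset.sum_insert, Finset.sum_insert,
      ih (by omega) fun i hi => h i (by omega), pr_pr (by omega) (by omega), h t (by omega),
      rho2_low (by omega), rho2_high (by omega), xRadius_succ]
    · have e1 : dd N s (t + 1) = qh s (2 * t + odd01 N) + qh s (-(2 * t + odd01 N)) := by
        rw [dd]; push_cast; ring_nf
      have e2 : dd N s t = qh s (2 * t + odd01 N) * (s ^ 2)⁻¹ +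
          qh s (-(2 * t + odd01 N)) * s ^ 2 := by
        have : (s ^ 2) = qh s 2 := by rw [qh]; norm_cast
        rw [dd, this, ← qh_neg, ← qh_add hs, ← qh_add hs]
        ring_nf
      rw [e1, e2]
      module
    all_goals
      simp only [Finset.mem_insert, Finset.mem_Icc, pr]
      omega

/-- The coefficient in the relation between `x_i` and `x_{i'}`, where `i = n - t`. -/
theorem pair_coeff {t : ℕ} (ht : t < rk N) :
    (qp s 1 - qp s (-1)) / (qh s (rho2 N (rk N - t) - 2) + qh s (-rho2 N (rk N - t) + 2)) =
      (s ^ 2 - (s ^ 2)⁻¹) / dd N s t := by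
  rw [rho2_low ht, qp_neg, qp_one, dd]
  congr 3 <;> ring

theorem mid_coeff (hs : s ≠ 0) (hroot : ∀ k : ℕ, 0 < k → (s ^ 2) ^ k ≠ 1) :
    qh s 1 - qh s (-1) = (s ^ 2 - (s ^ 2)⁻¹) * (s + s⁻¹)⁻¹ := by
  have h2 := qh_add_qh_neg_ne hs hroot 1
  rw [qh_neg, qh_one] at h2 ⊢
  rw [eq_mul_inv_iff_mul_eq₀ h2]
  ring_nf

theorem X_relation {a b : FreeAlgebra ℂ (Set.Icc 1 N)} (h : Rel N s a b) :
    RingQuot.mkAlgHom ℂ (Rel N s) a = RingQuot.mkAlgHom ℂ (Rel N s) b :=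
  RingQuot.mkAlgHom_rel ℂ h

theorem X_qcomm {i j : ℕ} (hi : 1 ≤ i) (hij : i < j) (hj : j ≤ N) (h : i ≠ pr N j) :
    X N s i * X N s j = s ^ 2 • (X N s j * X N s i) := by
  simpa [X, qp_one] using X_relation (Rel.qcomm (s := s) i j hi hij hj h)

/-- The relations of `𝒜`, in the form of `PairRels`: by `sum_quadratic`, the right hand side of the
relation between `x_i` and `x_{i'}` is a multiple of the radius of the inner generators. -/
theorem X_rels (hs : s ≠ 0) (hroot : ∀ k : ℕ, 0 < k → (s ^ 2) ^ k ≠ 1) :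
    XRels N s (X N s) (rk N) := by
  have hN := rk_spec N
  have hwu : ∀ i < rk N, X N s (pr N (rk N - i)) * X N s (rk N - i) =
      X N s (rk N - i) * X N s (pr N (rk N - i)) +
      (s ^ 2 - (s ^ 2)⁻¹) • xRadius N s (X N s) i := by
    intro i
    induction i using Nat.strong_induction_on with
    | _ i ih =>
      intro hi
      rw [← sub_eq_iff_eq_add']
      rcases Nat.eq_zero_or_pos i with rfl | hpos
      · rcases odd01_cases N with ⟨ho, h1⟩ | ⟨ho, h1⟩
        · have := X_relation (Rel.midOdd (s := s) ho)
          rw [mid_coeff hs hroot] at this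
          simpa [X, xRadius_zero_odd _ ho, pow_two, smul_smul, ← mul_smul] using this
        · have := X_relation (Rel.midEven (s := s) (Nat.not_odd_iff_even.1 ho))
          simpa [X, xRadius_zero_even _ ho, sub_eq_zero] using this
      · have := X_relation (Rel.pair (N := N) (s := s) (rk N - i) (by omega) (by omega))
        rw [pair_coeff hi] at this
        simp only [map_sub, map_mul, map_smul, map_sum] at this
        have h2 := sum_quadratic (N := N) hs hroot (X N s) hi.le fun j hj => ih j hj (hj.trans hi)
        rw [show rk N + 1 - i = rk N - i + 1 by omega] at h2
        simp only [X] at h2 ⊢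
        rw [this, h2, smul_smul, div_mul_cancel₀ _ (dd_ne N hs hroot i)]
  refine ⟨?_, ?_, ?_, ?_, ?_, hwu⟩
  · intro i j hij hj
    exact X_qcomm (by omega) (by omega) (by omega) (by rw [pr]; omega)
  · intro i j hij hj
    exact X_qcomm (by rw [pr]; omega) (by rw [pr, pr]; omega) (by rw [pr]; omega)
      (by rw [pr, pr, pr]; omega)
  · intro i j hi hj hij
    exact X_qcomm (by omega) (by rw [pr]; omega) (by rw [pr]; omega) (by rw [pr, pr]; omega)
  · intro i hi
    rw [mid]
    split_ifs with ho
    · have : odd01 N = 1 := by have := odd01_cases N; tauto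
      exact X_qcomm (by omega) (by omega) (by omega) (by rw [pr]; omega)
    · simp
  · intro i hi
    rw [mid]
    split_ifs with ho
    · have : odd01 N = 1 := by have := odd01_cases N; tauto
      exact X_qcomm (by omega) (by rw [pr]; omega) (by rw [pr]; omega) (by rw [pr, pr]; omega)
    · simp

/-- The radius `Q = ∑ q^{ρ_{i'}} x_i x_{i'}` is a multiple of the radius of `PairRels`. -/
theorem Q_eq (hs : s ≠ 0) (hroot : ∀ k : ℕ, 0 < k → (s ^ 2) ^ k ≠ 1) :
    Q N s = dd N s (rk N) • xRadius N s (X N s) (rk N) := by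
  have hN := rk_spec N
  rw [← sum_quadratic hs hroot (X N s) le_rfl fun i hi => (X_rels hs hroot).wu i hi, Q]
  congr 2
  · omega
  · rw [pr]; omega

/-- The universal property of `𝒜`, for the relations in the form of `PairRels`. -/
theorem exists_lift (hs : s ≠ 0) (hroot : ∀ k : ℕ, 0 < k → (s ^ 2) ^ k ≠ 1) (hr : 1 ≤ rk N)
    (x : ℕ → R) (h : XRels N s x (rk N)) :
    ∃ f : A N s →ₐ[ℂ] R, ∀ i, 1 ≤ i → i ≤ N → f (X N s i) = x i := by
  have hN := rk_spec N
  let f₀ : FreeAlgebra ℂ (Set.Icc 1 N) →ₐ[ℂ] R := FreeAlgebra.lift ℂ fun i => x i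
  have hf₀ : ∀ i, 1 ≤ i → i ≤ N → f₀ (freeX N i) = x i := by
    intro i hi hi'
    rw [freeX, dif_pos ⟨hi, hi'⟩]
    exact FreeAlgebra.lift_ι_apply _ _
  have hwu := h.wu
  have hmid : Odd N → mid N x = x (rk N + 1) := fun ho => if_pos ho
  have hrel : ∀ ⦃a b⦄, Rel N s a b → f₀ a = f₀ b := by
    rintro _ _ (⟨i, j, hi, hij, hj, hne⟩ | ⟨i, hi, hin⟩ | ho | he)
    · rw [map_mul, map_smul, map_mul, hf₀ i hi (by omega), hf₀ j (by omega) hj, qp_one]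
      rcases idx_cases hi (by omega : i ≤ N) with ⟨a, ha, rfl⟩ | ⟨ho, rfl⟩ | ⟨a, ha, rfl⟩
      · rcases idx_cases (by omega : 1 ≤ j) hj with ⟨b, hb, rfl⟩ | ⟨ho, rfl⟩ | ⟨b, hb, rfl⟩
        · exact h.uu b a (by omega) ha
        · have := h.uz a ha
          rwa [hmid ho] at this
        · exact h.uw a b ha hb (by rintro rfl; exact hne (pr_pr (by omega) (by omega)).symm)
      · rcases idx_cases (by omega : 1 ≤ j) hj with ⟨b, hb, rfl⟩ | ⟨ho, rfl⟩ | ⟨b, hb, rfl⟩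
        · omega
        · omega
        · have := h.zw b hb
          rwa [hmid ho] at this
      · have ha' : pr N (rk N - a) = N + 1 - (rk N - a) := rfl
        rcases idx_cases (by omega : 1 ≤ j) hj with ⟨b, hb, rfl⟩ | ⟨ho, rfl⟩ | ⟨b, hb, rfl⟩
        · omega
        · omega
        · have hb' : pr N (rk N - b) = N + 1 - (rk N - b) := rfl
          exact h.ww a b (by omega) hb
    · obtain ⟨t, rfl⟩ : ∃ t, i = rk N - t := ⟨rk N - i, by omega⟩
      have ht : t < rk N := by omega
      rw [pair_coeff ht, map_sub, map_mul, map_mul, map_smul, map_sum,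
        hf₀ (rk N - t) (by omega) (by omega),
        hf₀ (pr N (rk N - t)) (by rw [pr]; omega) (by rw [pr]; omega)]
      have h2 := sum_quadratic hs hroot x ht.le fun i hi => hwu i (by omega)
      rw [show rk N + 1 - t = rk N - t + 1 by omega] at h2
      have h3 : ∀ j ∈ Finset.Icc (rk N - t + 1) (pr N (rk N - t + 1)),
          f₀ (qh s (rho2 N (pr N j)) • (freeX N j * freeX N (pr N j))) =
            qh s (rho2 N (pr N j)) • (x j * x (pr N j)) := by
        intro j hj
        rw [Finset.mem_Icc, pr] at hj
        rw [map_smul, map_mul, hf₀ j (by omega) (by omega),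
          hf₀ _ (by rw [pr]; omega) (by rw [pr]; omega)]
      rw [Finset.sum_congr rfl h3, h2, smul_smul, div_mul_cancel₀ _ (dd_ne N hs hroot t)]
      exact sub_eq_iff_eq_add'.2 (hwu t ht)
    · have h1 : odd01 N = 1 := by have := odd01_cases N; tauto
      rw [mid_coeff hs hroot, map_sub, map_mul, map_mul, map_smul, map_pow]
      rw [hf₀ (rk N) (by omega) (by omega),
        hf₀ (pr N (rk N)) (by rw [pr]; omega) (by rw [pr]; omega),
        hf₀ (rk N + 1) (by omega) (by omega), sub_eq_iff_eq_add', mul_smul, pow_two (x _),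
        ← xRadius_zero_odd x ho]
      exact hwu 0 (by omega)
    · have ho : ¬ Odd N := Nat.not_odd_iff_even.2 he
      have h1 : odd01 N = 0 := by have := odd01_cases N; tauto
      rw [map_mul, map_mul, hf₀ (rk N) (by omega) (by omega),
        hf₀ (pr N (rk N)) (by rw [pr]; omega) (by rw [pr]; omega)]
      have h2 := hwu 0 (by omega)
      have h3 : xRadius N s x 0 = 0 := xRadius_zero_even x ho
      rw [xRadius] at h3
      rw [h3] at h2
      simpa using h2
  exact ⟨RingQuot.liftAlgHom ℂ ⟨f₀, hrel⟩, fun i hi hi' => by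
    rw [X, RingQuot.liftAlgHom_mkAlgHom_apply, hf₀ i hi hi']⟩

end Lift

section Basis

variable {N : ℕ} {s : ℂ}

/-- The exponents of the generators `x_{n-i}` in `x^ν`. -/
def lowExp (N : ℕ) (ν : ℕ → ℕ) : ℕ → ℕ := fun i => ν (rk N - i)

/-- The exponents of the generators `x_{(n-i)'}` in `x^ν`. -/
def highExp (N : ℕ) (ν : ℕ → ℕ) : ℕ → ℕ := fun i => ν (pr N (rk N - i))

/-- The exponent of the middle generator in `x^ν`; it is zero if there is none. -/
def midExp (N : ℕ) (ν : ℕ → ℕ) : ℕ := if Odd N then ν (rk N + 1) else 0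

theorem prod_eq_pairMono {R : Type*} [Ring R] (x : ℕ → R) (ν : ℕ → ℕ) {t : ℕ} (ht : t ≤ rk N) :
    ((List.range' (rk N + 1 - t) (2 * t + odd01 N)).map fun i => x i ^ ν i).prod =
      pairMono (mid N x) (fun i => x (rk N - i)) (fun i => x (pr N (rk N - i)))
        (lowExp N ν) (highExp N ν) (midExp N ν) t := by
  have hN := rk_spec N
  induction t with
  | zero =>
    rcases odd01_cases N with ⟨ho, h1⟩ | ⟨ho, h1⟩ <;>
      simp [h1, pairMono, mid, midExp, ho]
  | succ t ih =>
    rw [show 2 * (t + 1) + odd01 N = (2 * t + odd01 N + 1) + 1 by ring, List.range'_succ,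
      show rk N + 1 - (t + 1) + 1 = rk N + 1 - t by omega, List.range'_concat, List.map_cons,
      List.map_append, List.prod_cons, List.prod_append, ih (by omega), pairMono,
      show rk N + 1 - (t + 1) = rk N - t by omega,
      show rk N + 1 - t + 1 * (2 * t + odd01 N) = pr N (rk N - t) by rw [pr]; omega]
    simp [lowExp, highExp, mul_assoc]

/-- The monomials `x^ν` are the ordered monomials of `PairRels`. -/
theorem mono_eq_pairMono (ν : ℕ → ℕ) : mono N s ν =
    pairMono (mid N (X N s)) (fun i => X N s (rk N - i)) (fun i => X N s (pr N (rk N - i)))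
        (lowExp N ν) (highExp N ν) (midExp N ν) (rk N) := by
  rw [← prod_eq_pairMono (X N s) ν le_rfl, mono, rk_spec, List.range'_eq_map_range, List.map_map]
  congr 2
  ext i
  simp [add_comm]

theorem mono_congr {ν ν' : ℕ → ℕ} (h : ∀ i ∈ Finset.Icc 1 N, ν i = ν' i) :
    mono N s ν = mono N s ν' := by
  rw [mono, mono]
  congr 1
  refine List.map_congr_left fun i hi => ?_
  rw [h (i + 1) (by simpa using List.mem_range.1 hi)]

theorem mono_zero : mono N s 0 = 1 := by
  rw [mono]
  simp

/-- The linear span of the monomials is closed under left multiplication by the generators. -/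
theorem X_mul_mem_span (hs : s ≠ 0) (hroot : ∀ k : ℕ, 0 < k → (s ^ 2) ^ k ≠ 1) {i : ℕ}
    (hi : 1 ≤ i) (hi' : i ≤ N) {p : A N s} (hp : p ∈ Submodule.span ℂ (Set.range (mono N s))) :
    X N s i * p ∈ Submodule.span ℂ (Set.range (mono N s)) := by
  have hN := rk_spec N
  have e : Submodule.span ℂ (Set.range (mono N s)) = pairSpan (mid N (X N s))
      (fun i => X N s (rk N - i)) (fun i => X N s (pr N (rk N - i))) (rk N) := by
    refine le_antisymm (Submodule.span_le.2 ?_) (Submodule.span_le.2 ?_)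
    · rintro _ ⟨ν, rfl⟩
      exact Submodule.subset_span ⟨_, _, _, mono_eq_pairMono ν⟩
    · rintro _ ⟨α, β, r, rfl⟩
      by_cases h : ¬ Odd N ∧ r ≠ 0
      · have h0 : ∀ t, pairMono (mid N (X N s)) (fun i => X N s (rk N - i))
            (fun i => X N s (pr N (rk N - i))) α β r t = 0 := by
          intro t
          induction t with
          | zero => simp [pairMono, mid, h]
          | succ t ih => simp [pairMono, ih]
        rw [h0]
        exact Submodule.zero_mem _
      · refine Submodule.subset_span ⟨fun i => if i ≤ rk N then α (rk N - i) else
          if Odd N ∧ i = rk N + 1 then r else β (rk N - pr N i), ?_⟩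
        rw [mono_eq_pairMono]
        have hr : midExp N (fun i => if i ≤ rk N then α (rk N - i) else
            if Odd N ∧ i = rk N + 1 then r else β (rk N - pr N i)) = r := by
          rw [midExp]
          by_cases ho : Odd N
          · simp [ho]
          · rw [if_neg ho]
            by_contra h'
            exact h ⟨ho, fun h => h' h.symm⟩
        rw [hr]
        refine pairMono_congr _ fun i hi => ⟨?_, ?_⟩
        · simp only [lowExp]
          rw [if_pos (by omega)]
          congr 1
          omega
        · simp only [highExp]
          have h2 : pr N (rk N - i) = N + 1 - (rk N - i) := rfl
          have h3 : ¬ (Odd N ∧ pr N (rk N - i) = rk N + 1) := by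
            have := odd01_cases N
            rintro ⟨ho, h4⟩
            have : odd01 N = 1 := by tauto
            omega
          rw [if_neg (by omega), if_neg h3, pr_pr (by omega) (by omega)]
          congr 1
          omega
  rw [e] at hp ⊢
  have key := (X_rels hs hroot).mul_mem_pairSpan (pow_ne_zero 2 hs) le_rfl hp
  rcases idx_cases hi hi' with ⟨a, ha, rfl⟩ | ⟨ho, rfl⟩ | ⟨a, ha, rfl⟩
  · exact (key.2 a ha).1
  · have hm : mid N (X N s) = X N s (rk N + 1) := if_pos ho
    rw [← hm]
    exact key.1
  · exact (key.2 a ha).2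

theorem algebra_induction {P : A N s → Prop} (h₀ : ∀ c : ℂ, P (algebraMap ℂ _ c))
    (hX : ∀ i, 1 ≤ i → i ≤ N → P (X N s i)) (hmul : ∀ a b, P a → P b → P (a * b))
    (hadd : ∀ a b, P a → P b → P (a + b)) (a : A N s) : P a := by
  obtain ⟨a, rfl⟩ := RingQuot.mkAlgHom_surjective ℂ (Rel N s) a
  induction a using FreeAlgebra.induction with
  | grade0 r => simpa using h₀ r
  | grade1 i =>
    have := hX i.1 i.2.1 i.2.2
    rwa [X, freeX, dif_pos i.2] at this
  | mul a b ha hb => rw [map_mul]; exact hmul _ _ ha hb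
  | add a b ha hb => rw [map_add]; exact hadd _ _ ha hb

theorem span_mono (hs : s ≠ 0) (hroot : ∀ k : ℕ, 0 < k → (s ^ 2) ^ k ≠ 1) :
    Submodule.span ℂ (Set.range (mono N s)) = ⊤ := by
  rw [eq_top_iff]
  intro a _
  have : ∀ p ∈ Submodule.span ℂ (Set.range (mono N s)),
      a * p ∈ Submodule.span ℂ (Set.range (mono N s)) := by
    induction a using algebra_induction with
    | h₀ c =>
      intro p hp
      rw [← Algebra.smul_def]
      exact Submodule.smul_mem _ _ hp
    | hX i hi hi' => exact fun p hp => X_mul_mem_span hs hroot hi hi' hp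
    | hmul a b ha hb =>
      intro p hp
      rw [mul_assoc]
      exact ha trivial _ (hb trivial p hp)
    | hadd a b ha hb =>
      intro p hp
      rw [add_mul]
      exact add_mem (ha trivial p hp) (hb trivial p hp)
  simpa using this 1 (Submodule.subset_span ⟨0, mono_zero⟩)

/-- Linear maps that agree on all monomials are equal. -/
theorem ext_mono (hs : s ≠ 0) (hroot : ∀ k : ℕ, 0 < k → (s ^ 2) ^ k ≠ 1) {M : Type*}
    [AddCommGroup M] [Module ℂ M] {f g : A N s →ₗ[ℂ] M}
    (h : ∀ ν, f (mono N s ν) = g (mono N s ν)) : f = g :=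
  LinearMap.ext_on (span_mono hs hroot) (by rintro _ ⟨ν, rfl⟩; exact h ν)

theorem mapPairMono {R R' : Type*} [Ring R] [Ring R'] (f : R →+* R') (z : R) (u w : ℕ → R)
    (α β : ℕ → ℕ) (r t : ℕ) : f (pairMono z u w α β r t) =
      pairMono (f z) (fun i => f (u i)) (fun i => f (w i)) α β r t := by
  induction t with
  | zero => simp [pairMono]
  | succ t ih => simp [pairMono, ih]

theorem pairMono_congr_gen {R : Type*} [Ring R] {z : R} {u w u' w' : ℕ → R} (α β : ℕ → ℕ)
    (r : ℕ) {t : ℕ} (h : ∀ i < t, u i = u' i ∧ w i = w' i) :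
    pairMono z u w α β r t = pairMono z u' w' α β r t := by
  induction t with
  | zero => rfl
  | succ t ih =>
    rw [pairMono, pairMono, ih fun i hi => h i (by omega), (h t (by omega)).1, (h t (by omega)).2]

theorem radius_congr {R : Type*} [Ring R] [Algebra ℂ R] {q κ : ℂ} {z : R} {u w u' w' : ℕ → R}
    {t : ℕ} (h : ∀ i < t, u i = u' i ∧ w i = w' i) :
    radius q κ z u w t = radius q κ z u' w' t := by
  induction t with
  | zero => rfl
  | succ t ih =>
    rw [radius, radius, ih fun i hi => h i (by omega), (h t (by omega)).1, (h t (by omega)).2]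

theorem PairRels.congr {R : Type*} [Ring R] [Algebra ℂ R] {q κ : ℂ} {z : R} {u w u' w' : ℕ → R}
    {t : ℕ} (hr : PairRels q κ z u w t) (h : ∀ i < t, u i = u' i ∧ w i = w' i) :
    PairRels q κ z u' w' t := by
  refine ⟨?_, ?_, ?_, ?_, ?_, ?_⟩
  · intro i j hij hj
    rw [← (h i (by omega)).1, ← (h j hj).1]; exact hr.uu i j hij hj
  · intro i j hij hj
    rw [← (h i (by omega)).2, ← (h j hj).2]; exact hr.ww i j hij hj
  · intro i j hi hj hij
    rw [← (h i hi).1, ← (h j hj).2]; exact hr.uw i j hi hj hij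
  · intro i hi
    rw [← (h i hi).1]; exact hr.uz i hi
  · intro i hi
    rw [← (h i hi).2]; exact hr.zw i hi
  · intro i hi
    rw [← (h i hi).1, ← (h i hi).2, ← radius_congr fun j hj => h j (by omega)]; exact hr.wu i hi

/-- The shift operator, as a model for one generator. -/
def shift : Module.End ℂ (ℕ → ℂ) where
  toFun f a := Nat.casesOn a 0 fun a => f a
  map_add' f g := by ext a; cases a <;> simp
  map_smul' c f := by ext a; cases a <;> simp

theorem shift_pow (r : ℕ) : (shift ^ r) (Pi.single 0 1) = Pi.single r 1 := by
  induction r with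
  | zero => simp
  | succ r ih =>
    rw [pow_succ', Module.End.mul_apply, ih]
    ext a
    cases a with
    | zero => simp [shift]
    | succ a => simp [shift, Pi.single_apply]

/-- The coefficient functionals of the monomials. They come from the representation of `𝒜` on the model
of `exists_model`, applied to a cyclic vector. -/
theorem exists_coeff (hs : s ≠ 0) (hroot : ∀ k : ℕ, 0 < k → (s ^ 2) ^ k ≠ 1) (hr : 1 ≤ rk N)
    (μ : ℕ → ℕ) : ∃ c : A N s →ₗ[ℂ] ℂ, ∀ ν, c (mono N s ν) =
      open Classical in if ∀ i ∈ Finset.Icc 1 N, ν i = μ i then 1 else 0 := by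
  classical
  have hN := rk_spec N
  have hq : s ^ 2 ≠ 0 := pow_ne_zero 2 hs
  -- the model of the middle generator: a shift operator if `N` is odd, zero if `N` is even
  obtain ⟨V₀, _, _, z₀, G₀, v₀, ev₀, hG, hv, hz, hev₀⟩ : ∃ (V₀ : Type) (_ : AddCommGroup V₀)
      (_ : Module ℂ V₀) (z₀ G₀ : Module.End ℂ V₀) (v₀ : V₀) (ev₀ : V₀ →ₗ[ℂ] ℂ),
      G₀ * z₀ = (s ^ 2)⁻¹ • (z₀ * G₀) ∧ G₀ v₀ = v₀ ∧ (¬ Odd N → z₀ = 0) ∧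
      ∀ ν : ℕ → ℕ, ev₀ ((z₀ ^ midExp N ν) v₀) =
        if midExp N ν = midExp N μ then 1 else 0 := by
    by_cases ho : Odd N
    · refine ⟨ℕ → ℂ, _, _, shift,
        { toFun := fun f a => ((s ^ 2)⁻¹) ^ a * f a
          map_add' := fun f g => by ext a; simp [mul_add]
          map_smul' := fun c f => by ext a; simp; ring }, Pi.single 0 1,
        LinearMap.proj (midExp N μ), ?_, ?_, fun h => absurd ho h, ?_⟩
      · ext f a
        cases a with
        | zero => simp [shift]
        | succ a => simp [shift, pow_succ]; ring
      · ext a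
        by_cases h : a = 0 <;> simp [h]
      · intro ν
        rw [shift_pow, LinearMap.proj_apply, Pi.single_apply]
        exact if_congr eq_comm rfl rfl
    · refine ⟨ℂ, _, _, 0, 1, 1, LinearMap.id, by simp, by simp, fun _ => rfl, ?_⟩
      intro ν
      simp [midExp, ho]
  obtain ⟨V, _, _, z, u, w, G, v, ev, h, hz0, -, -, -, hev⟩ :=
    exists_model (κ := kap N s) hq z₀ G₀ v₀ hG hv (rk N)
  have hz' : ¬ Odd N → z = 0 := fun ho => hz0 (hz ho)
  let x : ℕ → Module.End ℂ V := fun i => if i ≤ rk N then u (rk N - i) else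
    if Odd N ∧ i = rk N + 1 then z else w (rk N - pr N i)
  have hxu : ∀ i < rk N, u i = x (rk N - i) ∧ w i = x (pr N (rk N - i)) := by
    intro i hi
    have h2 : pr N (rk N - i) = N + 1 - (rk N - i) := rfl
    have h3 : ¬ (Odd N ∧ pr N (rk N - i) = rk N + 1) := by
      have := odd01_cases N
      rintro ⟨ho, h4⟩
      have : odd01 N = 1 := by tauto
      omega
    simp only [x]
    rw [if_pos (by omega), if_neg (by omega), if_neg h3, pr_pr (by omega) (by omega)]
    constructor <;> congr 1 <;> omega
  have hxz : mid N x = z := by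
    rw [mid]
    split_ifs with ho
    · simp [x, ho]
    · exact (hz' ho).symm
  have hx : XRels N s x (rk N) := by
    rw [XRels, hxz]
    exact h.congr hxu
  obtain ⟨f, hf⟩ := exists_lift hs hroot hr x hx
  refine ⟨ev₀ ∘ₗ ev (lowExp N μ) (highExp N μ) ∘ₗ LinearMap.applyₗ v ∘ₗ f.toLinearMap,
    fun ν => ?_⟩
  have hfu : ∀ i < rk N, f (X N s (rk N - i)) = u i ∧ f (X N s (pr N (rk N - i))) = w i := by
    intro i hi
    rw [hf _ (by omega) (by omega), hf _ (by rw [pr]; omega) (by rw [pr]; omega), (hxu i hi).1,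
      (hxu i hi).2]
    exact ⟨rfl, rfl⟩
  have hfz : f (mid N (X N s)) = z := by
    rw [← hxz, mid, mid]
    split_ifs with ho
    · have : odd01 N = 1 := by have := odd01_cases N; tauto
      exact hf _ (by omega) (by omega)
    · exact map_zero f
  have hfm : f (mono N s ν) = pairMono z u w (lowExp N ν) (highExp N ν) (midExp N ν) (rk N) := by
    rw [mono_eq_pairMono]
    have := mapPairMono (f : A N s →+* Module.End ℂ V) (mid N (X N s)) (fun i => X N s (rk N - i))
      (fun i => X N s (pr N (rk N - i))) (lowExp N ν) (highExp N ν) (midExp N ν) (rk N)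
    simp only [RingHom.coe_coe, hfz] at this
    rw [this]
    exact pairMono_congr_gen _ _ _ hfu
  simp only [LinearMap.comp_apply, AlgHom.toLinearMap_apply, hfm, LinearMap.applyₗ_apply_apply,
    hev]
  have key : (∀ i ∈ Finset.Icc 1 N, ν i = μ i) ↔ (∀ i < rk N, lowExp N ν i = lowExp N μ i ∧
      highExp N ν i = highExp N μ i) ∧ midExp N ν = midExp N μ := by
    constructor
    · intro H
      refine ⟨fun i hi => ⟨H _ ?_, H _ ?_⟩, ?_⟩
      · rw [Finset.mem_Icc]; omega
      · rw [Finset.mem_Icc, pr]; omega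
      · rw [midExp, midExp]
        split_ifs with ho
        · have : odd01 N = 1 := by have := odd01_cases N; tauto
          exact H _ (by rw [Finset.mem_Icc]; omega)
        · rfl
    · rintro ⟨H, Hm⟩ i hi
      rw [Finset.mem_Icc] at hi
      rcases idx_cases hi.1 hi.2 with ⟨a, ha, rfl⟩ | ⟨ho, rfl⟩ | ⟨a, ha, rfl⟩
      · exact (H a ha).1
      · rwa [midExp, midExp, if_pos ho, if_pos ho] at Hm
      · exact (H a ha).2
  by_cases h1 : ∀ i < rk N, lowExp N ν i = lowExp N μ i ∧ highExp N ν i = highExp N μ i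
  · rw [if_pos h1, hev₀]
    by_cases h2 : midExp N ν = midExp N μ
    · rw [if_pos h2, if_pos (key.2 ⟨h1, h2⟩)]
    · rw [if_neg h2, if_neg fun h => h2 (key.1 h).2]
  · rw [if_neg h1, map_zero, if_neg (by rw [key]; tauto)]

/-- The monomials form a basis of `𝒜`: linear maps can be prescribed on them. The multi-indices that
vanish outside of `{1, …, N}` label the basis. -/
theorem exists_linear (hs : s ≠ 0) (hroot : ∀ k : ℕ, 0 < k → (s ^ 2) ^ k ≠ 1) (hr : 1 ≤ rk N)
    {M : Type} [AddCommGroup M] [Module ℂ M] {f : (ℕ → ℕ) → M}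
    (hf : ∀ ν ν' : ℕ → ℕ, (∀ i ∈ Finset.Icc 1 N, ν i = ν' i) → f ν = f ν') :
    ∃ T : A N s →ₗ[ℂ] M, ∀ ν, T (mono N s ν) = f ν := by
  classical
  choose c hc using fun μ => exists_coeff (N := N) hs hroot hr μ
  let ι := {ν : ℕ → ℕ // ∀ i, i ∉ Finset.Icc 1 N → ν i = 0}
  have hι : ∀ ν : ℕ → ℕ, ∃ μ : ι, ∀ i ∈ Finset.Icc 1 N, ν i = μ.1 i := fun ν =>
    ⟨⟨fun i => if i ∈ Finset.Icc 1 N then ν i else 0, fun i hi => if_neg hi⟩,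
      fun i hi => (if_pos hi).symm⟩
  have hli : LinearIndependent ℂ fun ν : ι => mono N s ν.1 := by
    refine LinearIndependent.of_pairwise_dual_eq_zero_one _ (fun μ : ι => c μ.1) ?_ ?_
    · intro μ ν hne
      simp only [hc]
      refine if_neg fun h => hne (Subtype.ext (funext fun i => ?_))
      by_cases hi : i ∈ Finset.Icc 1 N
      · exact (h i hi).symm
      · rw [μ.2 i hi, ν.2 i hi]
    · intro μ
      simp [hc]
  have hsp : ⊤ ≤ Submodule.span ℂ (Set.range fun ν : ι => mono N s ν.1) := by
    rw [← span_mono hs hroot]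
    refine Submodule.span_mono ?_
    rintro _ ⟨ν, rfl⟩
    obtain ⟨μ, hμ⟩ := hι ν
    exact ⟨μ, (mono_congr hμ).symm⟩
  let b := Module.Basis.mk hli hsp
  refine ⟨b.constr ℂ fun ν : ι => f ν.1, fun ν => ?_⟩
  obtain ⟨μ, hμ⟩ := hι ν
  rw [mono_congr hμ, hf _ _ hμ, ← b.constr_basis ℂ (fun ν : ι => f ν.1) μ, Module.Basis.mk_apply]

theorem linExt_mono (hs : s ≠ 0) (hroot : ∀ k : ℕ, 0 < k → (s ^ 2) ^ k ≠ 1) (hr : 1 ≤ rk N)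
    {M : Type} [AddCommGroup M] [Module ℂ M] {f : (ℕ → ℕ) → M}
    (hf : ∀ ν ν' : ℕ → ℕ, (∀ i ∈ Finset.Icc 1 N, ν i = ν' i) → f ν = f ν') (ν : ℕ → ℕ) :
    linExt N s f (mono N s ν) = f ν :=
  Classical.epsilon_spec (exists_linear hs hroot hr hf) ν

end Basis

/-! ### Divided powers -/

/-- The standing assumptions: `N ≥ 4`, and `q = s²` is neither zero nor a root of unity. -/
structure Generic (N : ℕ) (s : ℂ) : Prop where
  four_le : 4 ≤ N
  ne_zero : s ≠ 0
  root : ∀ k : ℕ, 0 < k → (s ^ 2) ^ k ≠ 1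

theorem Generic.two_le {N : ℕ} {s : ℂ} (h : Generic N s) : 2 ≤ rk N := by
  have := h.four_le
  have := rk_spec N
  have := odd01_cases N
  omega

theorem Generic.linExt_mono {N : ℕ} {s : ℂ} (h : Generic N s) {M : Type} [AddCommGroup M]
    [Module ℂ M] {f : (ℕ → ℕ) → M}
    (hf : ∀ ν ν' : ℕ → ℕ, (∀ i, 1 ≤ i → i ≤ N → ν i = ν' i) → f ν = f ν') (ν : ℕ → ℕ) :
    linExt N s f (mono N s ν) = f ν :=
  QE.linExt_mono h.ne_zero h.root (by have := h.two_le; omega)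
    (fun ν ν' h => hf ν ν' fun i hi hi' => h i (Finset.mem_Icc.2 ⟨hi, hi'⟩)) ν

theorem Generic.ext_mono {N : ℕ} {s : ℂ} (h : Generic N s) {M : Type*}
    [AddCommGroup M] [Module ℂ M] {f g : A N s →ₗ[ℂ] M}
    (hfg : ∀ ν, f (mono N s ν) = g (mono N s ν)) : f = g :=
  QE.ext_mono h.ne_zero h.root hfg

theorem mono_congr' {N : ℕ} {s : ℂ} {ν ν' : ℕ → ℕ} (h : ∀ i, 1 ≤ i → i ≤ N → ν i = ν' i) :
    mono N s ν = mono N s ν' :=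
  mono_congr fun i hi => h i (Finset.mem_Icc.1 hi).1 (Finset.mem_Icc.1 hi).2

variable {N : ℕ} {s : ℂ}

/-- The `q`-number that belongs to the exponent of `x_i`: `[a]` for the middle generator, and
`[a]_q` for the others. -/
def br (N : ℕ) (s : ℂ) (i : ℕ) (a : ℤ) : ℂ := if i = pr N i then qnum s a else qsym s a

@[simp] theorem br_zero (i : ℕ) : br N s i 0 = 0 := by
  rw [br]; split_ifs <;> simp

theorem Generic.br_ne (h : Generic N s) (i : ℕ) {a : ℤ} (ha : a ≠ 0) : br N s i a ≠ 0 := by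
  rw [br]
  split_ifs
  · exact qnum_ne h.root ha
  · exact qsym_ne h.ne_zero h.root ha

/-- The `q`-factorials that belong to the exponent of `x_i`. -/
def fac (N : ℕ) (s : ℂ) (i k : ℕ) : ℂ := ∏ j ∈ Finset.range k, br N s i (j + 1)

/-- The product of the `q`-factorials of the exponents of `x^ν`. -/
def wt (N : ℕ) (s : ℂ) (ν : ℕ → ℕ) : ℂ := ∏ i ∈ Finset.Icc 1 N, fac N s i (ν i)

theorem Generic.fac_ne (h : Generic N s) (i k : ℕ) : fac N s i k ≠ 0 :=
  Finset.prod_ne_zero_iff.2 fun _ _ => h.br_ne _ (by omega)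

theorem Generic.wt_ne (h : Generic N s) (ν : ℕ → ℕ) : wt N s ν ≠ 0 :=
  Finset.prod_ne_zero_iff.2 fun _ _ => h.fac_ne _ _

theorem wt_add_e {i : ℕ} (hi : 1 ≤ i) (hi' : i ≤ N) (ν : ℕ → ℕ) :
    wt N s (ν + e i) = wt N s ν * br N s i (ν i + 1) := by
  have hmem : i ∈ Finset.Icc 1 N := Finset.mem_Icc.2 ⟨hi, hi'⟩
  rw [wt, wt, ← Finset.mul_prod_erase _ _ hmem, ← Finset.mul_prod_erase _ _ hmem]
  have : ∏ x ∈ (Finset.Icc 1 N).erase i, fac N s x ((ν + e i) x) =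
      ∏ x ∈ (Finset.Icc 1 N).erase i, fac N s x (ν x) := by
    refine Finset.prod_congr rfl fun x hx => ?_
    rw [Pi.add_apply, e, Pi.single_eq_of_ne (Finset.ne_of_mem_erase hx), add_zero]
  rw [this, Pi.add_apply, e, Pi.single_eq_same, fac, Finset.prod_range_succ, ← fac]
  ring

/-- The integral multi-index of a multi-index. -/
def up (ν : ℕ → ℕ) : ℕ → ℤ := fun i => ν i

@[simp] theorem up_apply (ν : ℕ → ℕ) (i : ℕ) : up ν i = ν i := rfl

/-- The multi-index `ε_i`, with integral entries. -/
def ez (i : ℕ) : ℕ → ℤ := Pi.single i 1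

@[simp] theorem ez_same (i : ℕ) : ez i i = 1 := Pi.single_eq_same _ _

theorem ez_of_ne {i j : ℕ} (h : j ≠ i) : ez i j = 0 := Pi.single_eq_of_ne h _

theorem ez_nonneg (i j : ℕ) : 0 ≤ ez i j := by
  by_cases h : j = i
  · subst h; simp
  · rw [ez_of_ne h]

theorem up_add (ν μ : ℕ → ℕ) : up (ν + μ) = up ν + up μ := by ext i; simp

theorem up_e (i : ℕ) : up (e i) = ez i := by
  ext j
  by_cases h : j = i
  · subst h; simp [e]
  · rw [ez_of_ne h]; simp [e, h]

/-- The divided powers `y^v = x^v / ∏ [v_i]!`, with `y^v = 0` if `v` has a negative entry. In terms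
of these, the formulas for all operators hold for multi-indices with arbitrary integral entries. -/
def y (N : ℕ) (s : ℂ) (v : ℕ → ℤ) : A N s :=
  open Classical in if ∀ i, 0 ≤ v i then
    (wt N s fun i => (v i).toNat)⁻¹ • mono N s fun i => (v i).toNat else 0

theorem y_neg {v : ℕ → ℤ} {i : ℕ} (hi : v i < 0) : y N s v = 0 :=
  if_neg fun h => absurd (h i) (by omega)

theorem y_up (ν : ℕ → ℕ) : y N s (up ν) = (wt N s ν)⁻¹ • mono N s ν := by
  rw [y, if_pos (fun i => by simp)]
  simp

theorem Generic.mono_eq_y (h : Generic N s) (ν : ℕ → ℕ) :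
    mono N s ν = wt N s ν • y N s (up ν) := by
  rw [y_up, smul_smul, mul_inv_cancel₀ (h.wt_ne ν), one_smul]

theorem exists_up {v : ℕ → ℤ} (h : ∀ i, 0 ≤ v i) : ∃ ν, v = up ν :=
  ⟨fun i => (v i).toNat, by ext i; simp [h i]⟩

theorem exists_add_e {ν : ℕ → ℕ} {j : ℕ} (h : ν j ≠ 0) : ∃ ν₀, ν = ν₀ + e j := by
  refine ⟨ν - e j, ?_⟩
  ext i
  by_cases hi : i = j
  · subst hi
    simp only [Pi.add_apply, Pi.sub_apply, e, Pi.single_eq_same]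
    omega
  · simp [e, hi]

theorem e_of_ne {i j : ℕ} (h : j ≠ i) : e i j = 0 := Pi.single_eq_of_ne h _

theorem Generic.raise_mono (h : Generic N s) {k : ℕ} (hk : 1 ≤ k) (hk' : k ≤ N) (ν : ℕ → ℕ) :
    mono N s (ν + e k) = (wt N s ν * br N s k (ν k + 1)) • y N s (up ν + ez k) := by
  rw [h.mono_eq_y, wt_add_e hk hk', up_add, up_e]

theorem Generic.raise_raise_mono (h : Generic N s) {j k : ℕ} (hk : 1 ≤ k) (hk' : k ≤ N)
    (hj : 1 ≤ j) (hj' : j ≤ N) (ν : ℕ → ℕ) : mono N s (ν + e j + e k) =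
      (wt N s ν * (br N s j (ν j + 1) * br N s k (ν k + ez j k + 1))) •
        y N s (up ν + ez j + ez k) := by
  rw [h.mono_eq_y, wt_add_e hk hk', wt_add_e hj hj', up_add, up_e, up_add, up_e]
  congr 1
  have : (((ν + e j) k : ℕ) : ℤ) = ν k + ez j k := by
    rw [← up_e]; simp
  rw [this]
  ring

/-- A lowering of an exponent that is zero causes no problem: both sides vanish then, the left one
because of its coefficient, the right one by `y_neg`. -/
theorem Generic.lower_mono (h : Generic N s) {j : ℕ} (hj : 1 ≤ j) (hj' : j ≤ N) (ν : ℕ → ℕ) :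
    br N s j (ν j) • mono N s (ν - e j) = wt N s ν • y N s (up ν - ez j) := by
  by_cases h0 : ν j = 0
  · rw [y_neg (i := j) (by simp [h0]), h0]
    simp
  · obtain ⟨ν, rfl⟩ := exists_add_e h0
    have e1 : ν + e j - e j = ν := by ext i; simp
    rw [e1, up_add, up_e, add_sub_cancel_right, wt_add_e hj hj', h.mono_eq_y, smul_smul]
    congr 1
    simp [e, mul_comm]

theorem Generic.raise_lower_mono (h : Generic N s) {j k : ℕ} (hk : 1 ≤ k) (hk' : k ≤ N)
    (hj : 1 ≤ j) (hj' : j ≤ N) (hjk : j ≠ k) (ν : ℕ → ℕ) :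
    br N s j (ν j) • mono N s (ν + e k - e j) =
      (wt N s ν * br N s k (ν k + 1)) • y N s (up ν + ez k - ez j) := by
  by_cases h0 : ν j = 0
  · rw [y_neg (i := j) (by simp [h0, ez_of_ne hjk]), h0]
    simp
  · obtain ⟨ν, rfl⟩ := exists_add_e h0
    have e1 : ν + e j + e k - e j = ν + e k := by ext i; simp; omega
    have e2 : up (ν + e j) + ez k - ez j = up ν + ez k := by
      rw [up_add, up_e]; abel
    rw [e1, h.raise_mono hk hk', e2, wt_add_e hj hj', smul_smul]
    congr 1
    simp [e_of_ne hjk.symm]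
    simp [e]
    ring

theorem Generic.raise_lower_lower_mono (h : Generic N s) {i j k : ℕ} (hk : 1 ≤ k) (hk' : k ≤ N)
    (hj : 1 ≤ j) (hj' : j ≤ N) (hi : 1 ≤ i) (hi' : i ≤ N) (hjk : j ≠ k) (hik : i ≠ k)
    (ν : ℕ → ℕ) :
    (br N s j (ν j) * br N s i (ν i - ez j i)) • mono N s (ν + e k - e j - e i) =
      (wt N s ν * br N s k (ν k + 1)) • y N s (up ν + ez k - ez j - ez i) := by
  by_cases h0 : ν j = 0
  · rw [y_neg (i := j) (by have := ez_nonneg i j; simp [h0, ez_of_ne hjk]; omega), h0]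
    simp
  · obtain ⟨ν, rfl⟩ := exists_add_e h0
    have e1 : ν + e j + e k - e j - e i = ν + e k - e i := by ext i; simp; omega
    have e2 : up (ν + e j) + ez k - ez j - ez i = up ν + ez k - ez i := by
      rw [up_add, up_e]; abel
    have e3 : (((ν + e j) i : ℕ) : ℤ) - ez j i = ν i := by
      rw [← up_e]; simp
    rw [e1, mul_smul, e2, e3, h.raise_lower_mono hk hk' hi hi' hik, wt_add_e hj hj', smul_smul]
    congr 1
    simp [e_of_ne hjk.symm]
    simp [e]
    ring

/-- An operator with two terms of the shape of those of `E_k` and `F_k`, in divided powers. -/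
theorem Generic.two_term_y (h : Generic N s) {T : A N s →ₗ[ℂ] A N s} {a a' : (ℕ → ℤ) → ℂ}
    {k j k' j' : ℕ} (hk : 1 ≤ k) (hkN : k ≤ N) (hj : 1 ≤ j) (hjN : j ≤ N) (hjk : j ≠ k)
    (hk' : 1 ≤ k') (hkN' : k' ≤ N) (hj' : 1 ≤ j') (hjN' : j' ≤ N) (hjk' : j' ≠ k')
    (hT : ∀ ν, T (mono N s ν) = (br N s j (ν j) * a (up ν)) • mono N s (ν + e k - e j) -
      (br N s j' (ν j') * a' (up ν)) • mono N s (ν + e k' - e j')) (v : ℕ → ℤ) :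
    T (y N s v) = (br N s k (v k + 1) * a v) • y N s (v + ez k - ez j) -
      (br N s k' (v k' + 1) * a' v) • y N s (v + ez k' - ez j') := by
  by_cases hv : ∀ i, 0 ≤ v i
  · obtain ⟨ν, rfl⟩ := exists_up hv
    rw [y_up, map_smul, hT, mul_comm (br N s j _), mul_smul, h.raise_lower_mono hk hkN hj hjN hjk,
      mul_comm (br N s j' _), mul_smul (a' _), h.raise_lower_mono hk' hkN' hj' hjN' hjk', smul_sub]
    have := h.wt_ne ν
    simp only [smul_smul, up_apply]
    congr 2 <;> field_simp
  · push Not at hv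
    obtain ⟨i, hi⟩ := hv
    have key : ∀ k j, (br N s k (v k + 1)) • y N s (v + ez k - ez j) = 0 := by
      intro k j
      by_cases h1 : i = k ∧ v k = -1
      · rw [h1.2]; simp
      · rw [y_neg (i := i), smul_zero]
        have := ez_nonneg j i
        by_cases hik : i = k
        · subst hik
          simp
          omega
        · simp [ez_of_ne hik]
          omega
    rw [y_neg hi, map_zero, mul_comm, mul_smul, key, mul_comm, mul_smul, key]
    simp

/-- `v_a + ⋯ + v_b` for integral multi-indices. -/
def SZ (v : ℕ → ℤ) (a b : ℕ) : ℤ := ∑ i ∈ Finset.Icc a b, v i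

theorem S_eq (ν : ℕ → ℕ) (a b : ℕ) : S ν a b = SZ (up ν) a b := rfl

theorem SZ_add (v w : ℕ → ℤ) (a b : ℕ) : SZ (v + w) a b = SZ v a b + SZ w a b :=
  Finset.sum_add_distrib

theorem SZ_sub (v w : ℕ → ℤ) (a b : ℕ) : SZ (v - w) a b = SZ v a b - SZ w a b :=
  Finset.sum_sub_distrib _ _

theorem SZ_ez (i a b : ℕ) : SZ (ez i) a b = if a ≤ i ∧ i ≤ b then 1 else 0 := by
  simp [SZ, ez, Pi.single_apply]

theorem SZ_first {v : ℕ → ℤ} {a b : ℕ} (h : a ≤ b) : SZ v a b = v a + SZ v (a + 1) b := by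
  have : Finset.Icc a b = insert a (Finset.Icc (a + 1) b) := by
    ext i; simp only [Finset.mem_Icc, Finset.mem_insert]; omega
  rw [SZ, this, Finset.sum_insert (by simp), SZ]

theorem SZ_last {v : ℕ → ℤ} {a b : ℕ} (h : a ≤ b + 1) :
    SZ v a (b + 1) = SZ v a b + v (b + 1) := by
  rw [SZ, Finset.sum_Icc_succ_top h, SZ]

theorem SZ_append {v : ℕ → ℤ} {a b c : ℕ} (h : a ≤ b + 1) (h' : b ≤ c) :
    SZ v a b + SZ v (b + 1) c = SZ v a c := by
  induction c, h' using Nat.le_induction with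
  | base => simp [SZ]
  | succ c hc ih =>
    rw [SZ_last (by omega), SZ_last (by omega), ← ih]
    ring

theorem SZ_empty {v : ℕ → ℤ} {a b : ℕ} (h : b < a) : SZ v a b = 0 := by
  rw [SZ, Finset.Icc_eq_empty (by omega), Finset.sum_empty]

/-- Sums over all indices, sorted into pairs `i, i'` and the middle index. -/
theorem sum_pairs {M : Type*} [AddCommMonoid M] (g : ℕ → M) :
    ∑ i ∈ Finset.Icc 1 N, g i = ∑ k ∈ Finset.Icc 1 (rk N), (g k + g (pr N k)) +
      if Odd N then g (rk N + 1) else 0 := by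
  have hN := rk_spec N
  have h1 : ∑ k ∈ Finset.Icc 1 (rk N), g (pr N k) = ∑ k ∈ Finset.Icc (pr N (rk N)) N, g k := by
    refine Finset.sum_bij (fun k _ => pr N k) ?_ ?_ ?_ ?_
    · intro k hk
      simp only [Finset.mem_Icc, pr] at hk ⊢
      omega
    · intro k hk l hl h
      simp only [Finset.mem_Icc, pr] at hk hl h
      omega
    · intro k hk
      simp only [Finset.mem_Icc, pr] at hk
      exact ⟨pr N k, by simp only [Finset.mem_Icc, pr]; omega, pr_pr (by omega) (by omega)⟩
    · intro k hk
      rfl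
  rw [Finset.sum_add_distrib, h1]
  rcases odd01_cases N with ⟨ho, h2⟩ | ⟨ho, h2⟩
  · have e1 : Finset.Icc 1 N = insert (rk N + 1)
        ((Finset.Icc 1 (rk N)).disjUnion (Finset.Icc (pr N (rk N)) N) (by
          rw [Finset.disjoint_left]; intro k hk; simp only [Finset.mem_Icc,
            pr] at hk ⊢; omega)) := by
      ext k
      simp only [Finset.mem_Icc, Finset.mem_insert, Finset.mem_disjUnion, pr]
      omega
    rw [e1, Finset.sum_insert (by simp only [Finset.mem_Icc, Finset.mem_disjUnion, pr]; omega),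
      Finset.sum_disjUnion, if_pos ho, add_comm]
  · have e1 : Finset.Icc 1 N =
        ((Finset.Icc 1 (rk N)).disjUnion (Finset.Icc (pr N (rk N)) N) (by
          rw [Finset.disjoint_left]; intro k hk; simp only [Finset.mem_Icc,
            pr] at hk ⊢; omega)) := by
      ext k
      simp only [Finset.mem_Icc, Finset.mem_disjUnion, pr]
      omega
    rw [e1, Finset.sum_disjUnion, if_neg ho, add_zero]

/-! ### The operators in terms of divided powers -/

theorem br_sym {i : ℕ} (h : i ≠ pr N i) (a : ℤ) : br N s i a = qsym s a := if_neg h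

theorem br_mid (ho : Odd N) (a : ℤ) : br N s (rk N + 1) a = qnum s a := by
  have := rk_spec N
  have : odd01 N = 1 := by have := odd01_cases N; tauto
  exact if_pos (by rw [pr]; omega)

theorem Generic.Khat_mono (h : Generic N s) {i : ℕ} (hi : 1 ≤ i) (hi' : i ≤ N) (ν : ℕ → ℕ) :
    Khat N s i (mono N s ν) = qp s ((ν i : ℤ) - ν (pr N i)) • mono N s ν := by
  refine h.linExt_mono (fun ν ν' hν => ?_) ν
  rw [hν i hi hi', hν (pr N i) (by rw [pr]; omega) (by rw [pr]; omega), mono_congr' hν]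

theorem Generic.Khat_y (h : Generic N s) {i : ℕ} (hi : 1 ≤ i) (hi' : i ≤ N) (v : ℕ → ℤ) :
    Khat N s i (y N s v) = qp s (v i - v (pr N i)) • y N s v := by
  by_cases hv : ∀ i, 0 ≤ v i
  · obtain ⟨ν, rfl⟩ := exists_up hv
    rw [y_up, map_smul, h.Khat_mono hi hi', smul_comm]
    rfl
  · push Not at hv
    obtain ⟨i, hi⟩ := hv
    rw [y_neg hi, map_zero, smul_zero]

theorem mono_shift_congr {ν ν' δ δ' : ℕ → ℕ} (h : ∀ i, 1 ≤ i → i ≤ N → ν i = ν' i) :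
    mono N s (ν + δ - δ') = mono N s (ν' + δ - δ') :=
  mono_congr' fun i hi hi' => by simp [h i hi hi']

/-- The operators `E_k`, `k < n`, in divided powers. -/
theorem Generic.E_y (h : Generic N s) {k : ℕ} (hk : 1 ≤ k) (hk' : k < rk N) (v : ℕ → ℤ) :
    E N s k (y N s v) =
      (br N s k (v k + 1) * qp s (v k - v (k + 1) + 1)) • y N s (v + ez k - ez (k + 1)) -
      (br N s (pr N (k + 1)) (v (pr N (k + 1)) + 1) *
        qp s (v k - v (k + 1) - v (pr N k) + v (pr N (k + 1)) + 1)) •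
        y N s (v + ez (pr N (k + 1)) - ez (pr N k)) := by
  have hN := rk_spec N
  have e1 : pr N k = N + 1 - k := rfl
  have e2 : pr N (k + 1) = N + 1 - (k + 1) := rfl
  refine h.two_term_y (a := fun v => qp s (v k - v (k + 1) + 1))
    (a' := fun v => qp s (v k - v (k + 1) - v (pr N k) + v (pr N (k + 1)) + 1))
    (by omega) (by omega) (by omega) (by omega) (by omega) (by omega) (by omega) (by omega)
    (by omega) (by omega) (fun ν => ?_) v
  rw [br_sym (by simp only [pr]; omega), br_sym (by simp only [pr]; omega)]
  unfold E
  refine (h.linExt_mono ?_ ν).trans ?_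
  swap
  · exact if_pos hk'
  · intro ν ν' hν
    simp only
    rw [if_pos hk', if_pos hk', hν k (by omega) (by omega), hν (k + 1) (by omega) (by omega),
      hν (pr N k) (by omega) (by omega), hν (pr N (k + 1)) (by omega) (by omega),
      mono_shift_congr hν, mono_shift_congr hν]

/-- The operators `F_k`, `k < n`, in divided powers. -/
theorem Generic.F_y (h : Generic N s) {k : ℕ} (hk : 1 ≤ k) (hk' : k < rk N) (v : ℕ → ℤ) :
    F N s k (y N s v) =
      (br N s (k + 1) (v (k + 1) + 1) *
        qp s (-v k + v (k + 1) - v (pr N (k + 1)) + v (pr N k) + 1)) •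
        y N s (v + ez (k + 1) - ez k) -
      (br N s (pr N k) (v (pr N k) + 1) * qp s (-v (pr N (k + 1)) + v (pr N k) + 1)) •
        y N s (v + ez (pr N k) - ez (pr N (k + 1))) := by
  have hN := rk_spec N
  have e1 : pr N k = N + 1 - k := rfl
  have e2 : pr N (k + 1) = N + 1 - (k + 1) := rfl
  refine h.two_term_y (a := fun v => qp s (-v k + v (k + 1) - v (pr N (k + 1)) + v (pr N k) + 1))
    (a' := fun v => qp s (-v (pr N (k + 1)) + v (pr N k) + 1))
    (by omega) (by omega) (by omega) (by omega) (by omega) (by omega) (by omega) (by omega)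
    (by omega) (by omega) (fun ν => ?_) v
  rw [br_sym (by simp only [pr]; omega), br_sym (by simp only [pr]; omega)]
  unfold F
  refine (h.linExt_mono ?_ ν).trans ?_
  swap
  · exact if_pos hk'
  · intro ν ν' hν
    simp only
    rw [if_pos hk', if_pos hk', hν k (by omega) (by omega), hν (k + 1) (by omega) (by omega),
      hν (pr N k) (by omega) (by omega), hν (pr N (k + 1)) (by omega) (by omega),
      mono_shift_congr hν, mono_shift_congr hν]

/-- The operator `E_n` for odd `N`, in divided powers. -/
theorem Generic.E_y_odd (h : Generic N s) (ho : Odd N) (v : ℕ → ℤ) :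
    E N s (rk N) (y N s v) =
      (br N s (rk N) (v (rk N) + 1) * qh s (2 * (v (rk N) - v (rk N + 1)) + 3)) •
        y N s (v + ez (rk N) - ez (rk N + 1)) -
      (br N s (rk N + 1) (v (rk N + 1) + 1) * qp s (v (rk N) - v (rk N + 2) + 1)) •
        y N s (v + ez (rk N + 1) - ez (rk N + 2)) := by
  have hN := rk_spec N
  have h2 := h.two_le
  have h1 : odd01 N = 1 := by have := odd01_cases N; tauto
  refine h.two_term_y (a := fun v => qh s (2 * (v (rk N) - v (rk N + 1)) + 3))
    (a' := fun v => qp s (v (rk N) - v (rk N + 2) + 1))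
    (by omega) (by omega) (by omega) (by omega) (by omega) (by omega) (by omega) (by omega)
    (by omega) (by omega) (fun ν => ?_) v
  rw [br_mid ho, br_sym (by simp only [pr]; omega)]
  unfold E
  refine (h.linExt_mono ?_ ν).trans ?_
  swap
  · exact (if_neg (lt_irrefl _)).trans (if_pos ho)
  · intro ν ν' hν
    simp only
    rw [if_neg (lt_irrefl _), if_neg (lt_irrefl _), if_pos ho, if_pos ho,
      hν (rk N) (by omega) (by omega), hν (rk N + 1) (by omega) (by omega),
      hν (rk N + 2) (by omega) (by omega),
      mono_shift_congr hν, mono_shift_congr hν]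

/-- The operator `F_n` for odd `N`, in divided powers. -/
theorem Generic.F_y_odd (h : Generic N s) (ho : Odd N) (v : ℕ → ℤ) :
    F N s (rk N) (y N s v) =
      (br N s (rk N + 1) (v (rk N + 1) + 1) * qh s (2 * (-v (rk N) + v (rk N + 2)) + 1)) •
        y N s (v + ez (rk N + 1) - ez (rk N)) -
      (br N s (rk N + 2) (v (rk N + 2) + 1) * qp s (-v (rk N + 1) + v (rk N + 2) + 1)) •
        y N s (v + ez (rk N + 2) - ez (rk N + 1)) := by
  have hN := rk_spec N
  have h2 := h.two_le
  have h1 : odd01 N = 1 := by have := odd01_cases N; tauto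
  refine h.two_term_y (a := fun v => qh s (2 * (-v (rk N) + v (rk N + 2)) + 1))
    (a' := fun v => qp s (-v (rk N + 1) + v (rk N + 2) + 1))
    (by omega) (by omega) (by omega) (by omega) (by omega) (by omega) (by omega) (by omega)
    (by omega) (by omega) (fun ν => ?_) v
  rw [br_mid ho, br_sym (by simp only [pr]; omega)]
  unfold F
  refine (h.linExt_mono ?_ ν).trans ?_
  swap
  · exact (if_neg (lt_irrefl _)).trans (if_pos ho)
  · intro ν ν' hν
    simp only
    rw [if_neg (lt_irrefl _), if_neg (lt_irrefl _), if_pos ho, if_pos ho,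
      hν (rk N) (by omega) (by omega), hν (rk N + 1) (by omega) (by omega),
      hν (rk N + 2) (by omega) (by omega),
      mono_shift_congr hν, mono_shift_congr hν]

/-- The operator `E_n` for even `N`, in divided powers. -/
theorem Generic.E_y_even (h : Generic N s) (ho : ¬ Odd N) (v : ℕ → ℤ) :
    E N s (rk N) (y N s v) =
      (br N s (rk N - 1) (v (rk N - 1) + 1) * qp s (v (rk N - 1) - v (rk N + 1) + 1)) •
        y N s (v + ez (rk N - 1) - ez (rk N + 1)) -
      (br N s (rk N) (v (rk N) + 1) *
        qp s (v (rk N - 1) + v (rk N) - v (rk N + 1) - v (rk N + 2) + 1)) •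
        y N s (v + ez (rk N) - ez (rk N + 2)) := by
  have hN := rk_spec N
  have h2 := h.two_le
  have h1 : odd01 N = 0 := by have := odd01_cases N; tauto
  refine h.two_term_y (a := fun v => qp s (v (rk N - 1) - v (rk N + 1) + 1))
    (a' := fun v => qp s (v (rk N - 1) + v (rk N) - v (rk N + 1) - v (rk N + 2) + 1))
    (by omega) (by omega) (by omega) (by omega) (by omega) (by omega) (by omega) (by omega)
    (by omega) (by omega) (fun ν => ?_) v
  rw [br_sym (by simp only [pr]; omega), br_sym (by simp only [pr]; omega)]
  unfold E
  refine (h.linExt_mono ?_ ν).trans ?_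
  swap
  · exact (if_neg (lt_irrefl _)).trans (if_neg ho)
  · intro ν ν' hν
    simp only
    rw [if_neg (lt_irrefl _), if_neg (lt_irrefl _), if_neg ho, if_neg ho,
      hν (rk N) (by omega) (by omega), hν (rk N + 1) (by omega) (by omega),
      hν (rk N + 2) (by omega) (by omega), hν (rk N - 1) (by omega) (by omega),
      mono_shift_congr hν, mono_shift_congr hν]

/-- The operator `F_n` for even `N`, in divided powers. -/
theorem Generic.F_y_even (h : Generic N s) (ho : ¬ Odd N) (v : ℕ → ℤ) :
    F N s (rk N) (y N s v) =
      (br N s (rk N + 1) (v (rk N + 1) + 1) *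
        qp s (-v (rk N - 1) - v (rk N) + v (rk N + 1) + v (rk N + 2) + 1)) •
        y N s (v + ez (rk N + 1) - ez (rk N - 1)) -
      (br N s (rk N + 2) (v (rk N + 2) + 1) * qp s (-v (rk N) + v (rk N + 2) + 1)) •
        y N s (v + ez (rk N + 2) - ez (rk N)) := by
  have hN := rk_spec N
  have h2 := h.two_le
  have h1 : odd01 N = 0 := by have := odd01_cases N; tauto
  refine h.two_term_y
    (a := fun v => qp s (-v (rk N - 1) - v (rk N) + v (rk N + 1) + v (rk N + 2) + 1))
    (a' := fun v => qp s (-v (rk N) + v (rk N + 2) + 1))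
    (by omega) (by omega) (by omega) (by omega) (by omega) (by omega) (by omega) (by omega)
    (by omega) (by omega) (fun ν => ?_) v
  rw [br_sym (by simp only [pr]; omega), br_sym (by simp only [pr]; omega)]
  unfold F
  refine (h.linExt_mono ?_ ν).trans ?_
  swap
  · exact (if_neg (lt_irrefl _)).trans (if_neg ho)
  · intro ν ν' hν
    simp only
    rw [if_neg (lt_irrefl _), if_neg (lt_irrefl _), if_neg ho, if_neg ho,
      hν (rk N) (by omega) (by omega), hν (rk N + 1) (by omega) (by omega),
      hν (rk N + 2) (by omega) (by omega), hν (rk N - 1) (by omega) (by omega),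
      mono_shift_congr hν, mono_shift_congr hν]

theorem S_congr {ν ν' : ℕ → ℕ} (h : ∀ i, 1 ≤ i → i ≤ N → ν i = ν' i) {a b : ℕ} (ha : 1 ≤ a)
    (hb : b ≤ N) : S ν a b = S ν' a b :=
  Finset.sum_congr rfl fun i hi => by
    rw [Finset.mem_Icc] at hi
    rw [h i (by omega) (by omega)]

/-- The derivatives `∂_k`, `k ≤ n`, and the middle one, in divided powers. -/
theorem Generic.D_y_low (h : Generic N s) {k : ℕ} (hk : 1 ≤ k) (hkN : k ≤ N)
    (hk' : k ≤ rk N ∨ k = pr N k) (v : ℕ → ℤ) :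
    D N s k (y N s v) = qp s (SZ v (k + 1) N) • y N s (v - ez k) := by
  have hN := rk_spec N
  have hT : ∀ ν, D N s k (mono N s ν) =
      (br N s k (ν k) * qp s (S ν (k + 1) N)) • mono N s (ν - e k) := by
    intro ν
    unfold D
    refine (h.linExt_mono ?_ ν).trans ?_
    swap
    · by_cases h1 : k ≤ rk N
      · simp only [br_sym (show k ≠ pr N k by rw [pr]; omega)]
        exact if_pos h1
      · have h2 : k = pr N k := by tauto
        rw [br, if_pos h2]
        exact (if_neg h1).trans (if_pos h2)
    · intro ν ν' hν
      have e1 : mono N s (ν - e k) = mono N s (ν' - e k) :=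
        mono_congr' fun i hi hi' => by simp [hν i hi hi']
      by_cases h1 : k ≤ rk N
      · simp only [if_pos h1]
        rw [hν k hk hkN, S_congr hν (by omega) le_rfl, e1]
      · have h2 : k = pr N k := by tauto
        simp only [if_neg h1, if_pos h2]
        rw [hν k hk hkN, S_congr hν (by omega) le_rfl, e1]
  by_cases hv : ∀ i, 0 ≤ v i
  · obtain ⟨ν, rfl⟩ := exists_up hv
    rw [y_up, map_smul, hT, mul_comm, mul_smul, h.lower_mono hk hkN, smul_comm, smul_smul (_⁻¹),
      inv_mul_cancel₀ (h.wt_ne ν), one_smul, S_eq]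
  · push Not at hv
    obtain ⟨i, hi⟩ := hv
    have := ez_nonneg k i
    rw [y_neg hi, map_zero, y_neg (i := i) (by simp; omega), smul_zero]

/-- The derivatives `∂_{k'}`, `k ≤ n`, in divided powers. -/
theorem Generic.D_y_high (h : Generic N s) {k : ℕ} (hk : 1 ≤ k) (hk' : k ≤ rk N) (v : ℕ → ℤ) :
    D N s (pr N k) (y N s v) = qp s (v k + SZ v (pr N k + 1) N) • y N s (v - ez (pr N k)) +
      ∑ j ∈ Finset.Icc (k + 1) (rk N),
        ((qp s 1 - qp s (-1)) * qh s (rho2 N k - rho2 N j) *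
          qp s (SZ v k (j - 1) + SZ v (pr N (j - 1)) N) * br N s k (v k + 1)) •
          y N s (v + ez k - ez j - ez (pr N j)) +
      if Odd N then (((qp s 1 - qp s (-1)) / (1 + qp s 1)) * qh s (rho2 N k + 4) *
        qp s (SZ v k N - 2 * v (rk N + 1)) * br N s k (v k + 1)) •
          y N s (v + ez k - ez (rk N + 1) - ez (rk N + 1)) else 0 := by
  have hN := rk_spec N
  have hodd := odd01_cases N
  have e0 : pr N k = N + 1 - k := rfl
  have ekk : pr N (pr N k) = k := pr_pr (by omega) (by omega)
  have c1 : ¬ pr N k ≤ rk N := by omega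
  have c2 : ¬ pr N k = pr N (pr N k) := by rw [ekk]; omega
  have c3 : ¬ pr N k = k := by omega
  have hT : ∀ ν, D N s (pr N k) (mono N s ν) =
      (br N s (pr N k) (ν (pr N k)) * qp s (ν k + S ν (pr N k + 1) N)) •
        mono N s (ν - e (pr N k)) +
      ∑ j ∈ Finset.Icc (k + 1) (rk N),
        (br N s j (ν j) * br N s (pr N j) (ν (pr N j) - ez j (pr N j)) *
          ((qp s 1 - qp s (-1)) * qh s (rho2 N k - rho2 N j) *
          qp s (S ν k (j - 1) + S ν (pr N (j - 1)) N))) •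
          mono N s (ν + e k - e j - e (pr N j)) +
      if Odd N then (br N s (rk N + 1) (ν (rk N + 1)) *
          br N s (rk N + 1) (ν (rk N + 1) - ez (rk N + 1) (rk N + 1)) *
          (((qp s 1 - qp s (-1)) / (1 + qp s 1)) * qh s (rho2 N k + 4) *
          qp s (S ν k N - 2 * ν (rk N + 1)))) •
          mono N s (ν + e k - e (rk N + 1) - e (rk N + 1)) else 0 := by
    intro ν
    unfold D
    refine (h.linExt_mono ?_ ν).trans ?_
    swap
    · refine (if_neg c1).trans ((if_neg c2).trans ?_)
      rw [ekk]
      dsimp only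
      refine congrArg₂ _ (congrArg₂ _ ?_ ?_) ?_
      · rw [br_sym c2]
      · refine Finset.sum_congr rfl fun j hj => ?_
        rw [Finset.mem_Icc] at hj
        rw [br_sym (by simp only [pr]; omega), br_sym (by simp only [pr]; omega),
          ez_of_ne (by rw [pr]; omega), sub_zero]
        congr 1
        ring
      · by_cases ho : Odd N
        · simp only [if_pos ho, br_mid ho, ez_same]
          congr 1
          ring
        · simp only [if_neg ho]
    · intro ν ν' hν
      have e1 : ∀ i, mono N s (ν - e i) = mono N s (ν' - e i) :=
        fun j => mono_congr' fun i hi hi' => by simp [hν i hi hi']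
      have e2 : ∀ i j, mono N s (ν + e k - e i - e j) = mono N s (ν' + e k - e i - e j) :=
        fun i j => mono_congr' fun i hi hi' => by simp [hν i hi hi']
      simp only [if_neg c1, ekk, if_neg c3]
      rw [hν k (by omega) (by omega), hν (pr N k) (by omega) (by omega),
        S_congr hν (by omega) le_rfl, e1]
      refine congrArg₂ _ (congrArg₂ _ rfl ?_) ?_
      · refine Finset.sum_congr rfl fun j hj => ?_
        rw [Finset.mem_Icc] at hj
        rw [hν j (by omega) (by omega), hν (pr N j) (by rw [pr]; omega) (by rw [pr]; omega), e2,
          S_congr hν hk (show j - 1 ≤ N by omega),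
          S_congr hν (show 1 ≤ pr N (j - 1) by rw [pr]; omega) le_rfl]
      · by_cases ho : Odd N
        · simp only [if_pos ho]
          have : odd01 N = 1 := by tauto
          rw [hν (rk N + 1) (by omega) (by omega), e2, S_congr hν hk le_rfl]
        · simp only [if_neg ho]
  by_cases hv : ∀ i, 0 ≤ v i
  · obtain ⟨ν, rfl⟩ := exists_up hv
    have hw := h.wt_ne ν
    rw [y_up, map_smul, hT, smul_add, smul_add, Finset.smul_sum]
    congr 1
    · congr 1
      · rw [mul_comm (br _ _ _ _), mul_smul, h.lower_mono (by omega) (by omega), smul_comm,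
          smul_smul (_⁻¹), inv_mul_cancel₀ hw, one_smul, S_eq, up_apply]
      · refine Finset.sum_congr rfl fun j hj => ?_
        rw [Finset.mem_Icc] at hj
        rw [mul_comm (br _ _ _ _ * _), mul_smul, h.raise_lower_lower_mono (by omega) (by omega)
          (by omega) (by omega) (by rw [pr]; omega) (by rw [pr]; omega) (by omega)
          (by rw [pr]; omega), S_eq, S_eq, smul_smul, smul_smul, up_apply]
        congr 1
        field_simp
    · by_cases ho : Odd N
      · have : odd01 N = 1 := by tauto
        simp only [if_pos ho]
        rw [mul_comm (br _ _ _ _ * _), mul_smul, h.raise_lower_lower_mono (by omega) (by omega)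
          (by omega) (by omega) (by omega) (by omega) (by omega) (by omega), S_eq, smul_smul,
          smul_smul, up_apply, up_apply]
        congr 1
        field_simp
      · simp only [if_neg ho, smul_zero]
  · push Not at hv
    obtain ⟨i, hi⟩ := hv
    have key : ∀ j l, (br N s k (v k + 1)) • y N s (v + ez k - ez j - ez l) = 0 := by
      intro j l
      by_cases h1 : i = k ∧ v k = -1
      · rw [h1.2]; simp
      · rw [y_neg (i := i), smul_zero]
        have := ez_nonneg j i
        have := ez_nonneg l i
        by_cases hik : i = k
        · subst hik
          simp
          omega
        · simp [ez_of_ne hik]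
          omega
    have := ez_nonneg (pr N k) i
    rw [y_neg hi, map_zero, y_neg (i := i) (v := v - ez (pr N k)) (by simp; omega)]
    simp only [mul_smul, key, smul_zero, Finset.sum_const_zero, ite_self, add_zero]

/-! ### The radius and the Laplace operator in terms of divided powers -/

/-- The radius of `PairRels`, for the whole algebra `𝒜`. -/
def rad (N : ℕ) (s : ℂ) : A N s := xRadius N s (X N s) (rk N)

theorem Generic.Q_eq (h : Generic N s) : Q N s = dd N s (rk N) • rad N s :=
  QE.Q_eq h.ne_zero h.root

theorem pairDeg_eq (ν : ℕ → ℕ) {t : ℕ} (ht : t ≤ rk N) :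
    (pairDeg (lowExp N ν) (highExp N ν) (midExp N ν) t : ℤ) =
      SZ (up ν) (rk N + 1 - t) (N - rk N + t) := by
  have hN := rk_spec N
  induction t with
  | zero =>
    rcases odd01_cases N with ⟨ho, h1⟩ | ⟨ho, h1⟩
    · have e : N - rk N + 0 = rk N + 1 := by omega
      simp [pairDeg, midExp, ho, e, SZ]
    · rw [SZ_empty (by omega)]
      simp [pairDeg, midExp, ho]
  | succ t ih =>
    rw [SZ_first (by omega), ← add_assoc (N - rk N), SZ_last (by omega),
      show rk N + 1 - (t + 1) + 1 = rk N + 1 - t by omega, ← ih (by omega), pairDeg,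
      show rk N + 1 - (t + 1) = rk N - t by omega]
    push_cast
    have e2 : N - rk N + t + 1 = pr N (rk N - t) := by rw [pr]; omega
    rw [e2, lowExp, highExp, up_apply, up_apply]
    ring

/-- Multiplication by the radius in the basis of monomials; see `PairRels.radius_pairMono`. -/
theorem Generic.rad_mono (h : Generic N s) (ν : ℕ → ℕ) : rad N s * mono N s ν =
    ∑ j ∈ Finset.Icc 1 (rk N), qp s ((j : ℤ) - 1 - SZ (up ν) (j + 1) (pr N j - 1)) •
      mono N s (ν + e j + e (pr N j)) +
    if Odd N then (qp s (rk N) * kap N s) • mono N s (ν + e (rk N + 1) + e (rk N + 1)) else 0 := by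
  have hN := rk_spec N
  have h2 := h.two_le
  have hq : s ^ 2 ≠ 0 := pow_ne_zero 2 h.ne_zero
  have hodd := odd01_cases N
  have main := (X_rels (N := N) h.ne_zero h.root).radius_pairMono hq (lowExp N ν) (highExp N ν)
    (midExp N ν) le_rfl
  rw [← mono_eq_pairMono] at main
  rw [rad, xRadius, main]
  congr 1
  · refine Finset.sum_bij (fun i _ => rk N - i) ?_ ?_ ?_ ?_
    · intro i hi
      rw [Finset.mem_range] at hi
      rw [Finset.mem_Icc]
      omega
    · intro i hi j hj hij
      rw [Finset.mem_range] at hi hj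
      omega
    · intro j hj
      rw [Finset.mem_Icc] at hj
      exact ⟨rk N - j, by rw [Finset.mem_range]; omega, by omega⟩
    · intro i hi
      rw [Finset.mem_range] at hi
      have e1 : mono N s (ν + e (rk N - i) + e (pr N (rk N - i))) =
          pairMono (mid N (X N s)) (fun i => X N s (rk N - i)) (fun i => X N s (pr N (rk N - i)))
            (lowExp N ν + Pi.single i 1) (highExp N ν + Pi.single i 1) (midExp N ν) (rk N) := by
        rw [mono_eq_pairMono]
        have hm : midExp N (ν + e (rk N - i) + e (pr N (rk N - i))) = midExp N ν := by
          rw [midExp, midExp]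
          split_ifs with ho
          · have : odd01 N = 1 := by tauto
            rw [Pi.add_apply, Pi.add_apply, e_of_ne (by omega), e_of_ne (by rw [pr]; omega)]
            rfl
          · rfl
        rw [hm]
        refine pairMono_congr _ fun j hj => ?_
        by_cases hij : j = i
        · subst hij
          constructor
          · simp only [lowExp, Pi.add_apply, Pi.single_eq_same]
            rw [e_of_ne (i := pr N (rk N - j)) (by rw [pr]; omega), e, Pi.single_eq_same]
          · simp only [highExp, Pi.add_apply, Pi.single_eq_same]
            rw [e_of_ne (i := rk N - j) (by rw [pr]; omega), e, Pi.single_eq_same, add_zero]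
        · constructor
          · simp only [lowExp, Pi.add_apply, Pi.single_eq_of_ne hij]
            rw [e_of_ne (i := pr N (rk N - i)) (by rw [pr]; omega), e_of_ne (by omega)]
            rfl
          · simp only [highExp, Pi.add_apply, Pi.single_eq_of_ne hij]
            rw [e_of_ne (i := rk N - i) (by rw [pr]; omega), e_of_ne (by simp only [pr]; omega)]
            rfl
      rw [e1]
      congr 1
      rw [qp_sub h.ne_zero, div_eq_mul_inv, inv_pow, ← qp_natCast, ← qp_natCast,
        pairDeg_eq _ (by omega)]
      congr 3
      · omega
      · congr 1
        · omega
        · rw [pr]; omega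
  · by_cases ho : Odd N
    · have h1 : odd01 N = 1 := by tauto
      rw [if_pos ho, qp_natCast, mono_eq_pairMono]
      have hm : midExp N (ν + e (rk N + 1) + e (rk N + 1)) = midExp N ν + 2 := by
        simp [midExp, ho, e]
      rw [hm]
      congr 1
      refine pairMono_congr _ fun j hj => ⟨?_, ?_⟩
      · simp only [lowExp, Pi.add_apply]
        rw [e_of_ne (by omega)]
        rfl
      · simp only [highExp, Pi.add_apply]
        rw [e_of_ne (by rw [pr]; omega)]
        rfl
    · simp [kap, ho]

/-- Multiplication by the radius, in divided powers. -/
theorem Generic.rad_y (h : Generic N s) (v : ℕ → ℤ) : rad N s * y N s v =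
    ∑ j ∈ Finset.Icc 1 (rk N), (qp s ((j : ℤ) - 1 - SZ v (j + 1) (pr N j - 1)) *
      (br N s j (v j + 1) * br N s (pr N j) (v (pr N j) + 1))) • y N s (v + ez j + ez (pr N j)) +
    if Odd N then (qp s (rk N) * kap N s *
      (br N s (rk N + 1) (v (rk N + 1) + 1) * br N s (rk N + 1) (v (rk N + 1) + 2))) •
      y N s (v + ez (rk N + 1) + ez (rk N + 1)) else 0 := by
  have hN := rk_spec N
  by_cases hv : ∀ i, 0 ≤ v i
  · obtain ⟨ν, rfl⟩ := exists_up hv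
    have hw := h.wt_ne ν
    rw [y_up, mul_smul_comm, h.rad_mono, smul_add, Finset.smul_sum]
    congr 1
    · refine Finset.sum_congr rfl fun j hj => ?_
      rw [Finset.mem_Icc] at hj
      rw [h.raise_raise_mono (by rw [pr]; omega) (by rw [pr]; omega) (by omega) (by omega),
        ez_of_ne (i := j) (by rw [pr]; omega), add_zero, smul_smul, smul_smul]
      congr 1
      simp only [up_apply]
      field_simp
    · by_cases ho : Odd N
      · have h1 : odd01 N = 1 := by have := odd01_cases N; tauto
        simp only [if_pos ho]
        rw [h.raise_raise_mono (by omega) (by omega) (by omega) (by omega), smul_smul, smul_smul,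
          ez_same]
        congr 1
        simp only [up_apply, add_assoc]
        field_simp
        norm_num
      · simp only [if_neg ho, smul_zero]
  · push Not at hv
    obtain ⟨i, hi⟩ := hv
    rw [y_neg hi, mul_zero, Finset.sum_eq_zero, zero_add]
    · split_ifs with ho
      · by_cases h1 : i = rk N + 1
        · subst h1
          rcases (by omega : v (rk N + 1) = -1 ∨ v (rk N + 1) = -2 ∨ v (rk N + 1) < -2)
            with h1 | h1 | h1
          · simp [h1]
          · simp [h1]
          · rw [y_neg (i := rk N + 1) (by simp; omega), smul_zero]
        · rw [y_neg (i := i) (by simp [ez_of_ne h1, hi]), smul_zero]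
      · rfl
    · intro j hj
      rw [Finset.mem_Icc] at hj
      have hne : j ≠ pr N j := by rw [pr]; omega
      by_cases h1 : i = j
      · subst h1
        by_cases h2 : v i = -1
        · simp [h2]
        · rw [y_neg (i := i) (by simp [ez_of_ne hne]; omega), smul_zero]
      · by_cases h3 : i = pr N j
        · rw [← h3]
          by_cases h2 : v i = -1
          · simp [h2]
          · rw [y_neg (i := i) (by simp [ez_of_ne h1]; omega), smul_zero]
        · rw [y_neg (i := i) (by simp [ez_of_ne h1, ez_of_ne h3, hi]), smul_zero]

theorem Generic.q_mul_qsym (h : Generic N s) (a : ℤ) :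
    (qp s 1 - qp s (-1)) * qsym s a = qp s a - qp s (-a) := by
  have := q_sub_ne h.ne_zero h.root
  rw [← qp_one, ← qp_neg] at this
  rw [qsym]
  field_simp

/-- The coefficients of the telescoping sum that computes the Laplace operator. -/
def lapCoeff (N : ℕ) (s : ℂ) (v : ℕ → ℤ) (k j : ℕ) : ℂ :=
  qp s (SZ v k (j - 1) + SZ v k N + SZ v (pr N (j - 1)) N - 1) * qh s (-rho2 N j) *
    (1 + qp s ((N : ℤ) - 2 * k))

/-- The middle coefficients of the telescoping sum that computes the Laplace operator. -/
def lapCoeffMid (N : ℕ) (s : ℂ) (v : ℕ → ℤ) (k : ℕ) : ℂ :=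
  qp s (1 + 2 * SZ v k N - 2 * v (rk N + 1)) / (1 + qp s 1) * (1 + qp s ((N : ℤ) - 2 * k))

/-- The coefficients from `∂_k ∂_{k'}` and `∂_{k'} ∂_k` add up to a difference. -/
theorem Generic.lap_scalar (h : Generic N s) (r r' a b c d : ℤ) :
    qh s r * ((qp s 1 - qp s (-1)) * qh s (r - r') * qp s (a + b + d) * qsym s (a + 1) *
        qp s (c - 2)) +
      qh s (-r) * (qp s c * ((qp s 1 - qp s (-1)) * qh s (r - r') * qp s (a - 1 + b + d) *
        qsym s a)) =
    qp s (a + b + (a + c) + d - 1) * qh s (-r') * (1 + qp s r) -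
      qp s (b + c + d - 1) * qh s (-r') * (1 + qp s (r - 2)) := by
  have h1 := h.q_mul_qsym a
  have h2 := h.q_mul_qsym (a + 1)
  have hs := h.ne_zero
  have h3 : qp s r = qh s r * qh s r := by rw [qp_eq_qh, two_mul, qh_add hs]
  have h4 : qp s 2 = qp s 1 * qp s 1 := by rw [← qp_add hs]; norm_num
  have e : qh s r * ((qp s 1 - qp s (-1)) * qh s (r - r') * qp s (a + b + d) * qsym s (a + 1) *
        qp s (c - 2)) +
      qh s (-r) * (qp s c * ((qp s 1 - qp s (-1)) * qh s (r - r') * qp s (a - 1 + b + d) *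
        qsym s a)) = qh s r * qh s (r - r') * qp s (a + b + d) * qp s (c - 2) *
          (qp s (a + 1) - qp s (-(a + 1))) + qh s (-r) * qp s c * qh s (r - r') *
            qp s (a - 1 + b + d) * (qp s a - qp s (-a)) := by
    rw [← h1, ← h2]; ring
  rw [e]
  have ha := qp_ne hs a
  have hb := qp_ne hs b
  have hc := qp_ne hs c
  have hd := qp_ne hs d
  have hr := qh_ne hs r
  have hr' := qh_ne hs r'
  have h11 := qp_ne hs 1
  simp only [qp_add hs, qp_sub hs, qh_sub hs, qp_neg, qh_neg, h3, h4]
  field_simp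
  ring

/-- The analogue of `Generic.lap_scalar` for the terms that lower the middle exponent. -/
theorem Generic.lap_scalar_mid (h : Generic N s) (r a c m : ℤ) :
    qh s r * ((qp s 1 - qp s (-1)) / (1 + qp s 1) * qh s (r + 4) * qp s (a + c - 2 * m) *
        qsym s (a + 1) * qp s (c - 2)) +
      qh s (-r) * (qp s c * ((qp s 1 - qp s (-1)) / (1 + qp s 1) * qh s (r + 4) *
        qp s (a - 1 + c - 2 * m) * qsym s a)) =
    qp s (1 + 2 * (a + c) - 2 * m) / (1 + qp s 1) * (1 + qp s r) -
      qp s (1 + 2 * c - 2 * m) / (1 + qp s 1) * (1 + qp s (r - 2)) := by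
  have h1 := h.q_mul_qsym a
  have h2 := h.q_mul_qsym (a + 1)
  have hs := h.ne_zero
  have h3 : qp s r = qh s r * qh s r := by rw [qp_eq_qh, two_mul, qh_add hs]
  have h4 : qp s 2 = qp s 1 * qp s 1 := by rw [← qp_add hs]; norm_num
  have h5 : qh s 4 = qp s 1 * qp s 1 := by rw [← h4, qp_eq_qh]; norm_num
  have e : qh s r * ((qp s 1 - qp s (-1)) / (1 + qp s 1) * qh s (r + 4) * qp s (a + c - 2 * m) *
        qsym s (a + 1) * qp s (c - 2)) +
      qh s (-r) * (qp s c * ((qp s 1 - qp s (-1)) / (1 + qp s 1) * qh s (r + 4) *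
        qp s (a - 1 + c - 2 * m) * qsym s a)) =
      (qh s r * qh s (r + 4) * qp s (a + c - 2 * m) * qp s (c - 2) *
          (qp s (a + 1) - qp s (-(a + 1))) + qh s (-r) * qp s c * qh s (r + 4) *
            qp s (a - 1 + c - 2 * m) * (qp s a - qp s (-a))) / (1 + qp s 1) := by
    rw [← h1, ← h2]; ring
  rw [e]
  have ha := qp_ne hs a
  have hc := qp_ne hs c
  have hm := qp_ne hs m
  have hr := qh_ne hs r
  have h11 := qp_ne hs 1
  have h12 := one_add_qp_ne hs h.root 1
  simp only [two_mul, qp_add hs, qp_sub hs, qh_add hs, qp_neg, qh_neg, h3, h4, h5]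
  field_simp
  ring

/-- The contribution of a pair of indices to the Laplace operator. -/
theorem Generic.lap_pair (h : Generic N s) {k : ℕ} (hk : 1 ≤ k) (hk' : k ≤ rk N) (v : ℕ → ℤ) :
    qh s (rho2 N k) • D N s k (D N s (pr N k) (y N s v)) +
      qh s (rho2 N (pr N k)) • D N s (pr N k) (D N s (pr N (pr N k)) (y N s v)) =
    lapCoeff N s v k k • y N s (v - ez k - ez (pr N k)) +
      ∑ j ∈ Finset.Icc (k + 1) (rk N), (lapCoeff N s v k j - lapCoeff N s v (k + 1) j) •
        y N s (v - ez j - ez (pr N j)) +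
      if Odd N then (lapCoeffMid N s v k - lapCoeffMid N s v (k + 1)) •
        y N s (v - ez (rk N + 1) - ez (rk N + 1)) else 0 := by
  have hN := rk_spec N
  have hs := h.ne_zero
  have hodd := odd01_cases N
  have hr1 : rho2 N k = (N : ℤ) - 2 * k := if_pos hk'
  have hr2 : rho2 N (pr N k) = -((N : ℤ) - 2 * k) := by
    obtain ⟨t, ht, rfl⟩ : ∃ t, t < rk N ∧ k = rk N - t := ⟨rk N - k, by omega, by omega⟩
    rw [rho2_high ht]
    omega
  have hkk : k ≠ pr N k := by rw [pr]; omega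
  have hbr : ∀ a, br N s k a = qsym s a := br_sym hkk
  have hD1 : ∀ v, D N s k (y N s v) = qp s (SZ v (k + 1) N) • y N s (v - ez k) :=
    h.D_y_low hk (by omega) (Or.inl hk')
  rw [pr_pr hk (by omega), hD1 v, h.D_y_high hk hk', map_smul, h.D_y_high hk hk']
  simp only [map_add, map_smul, map_sum, smul_add, Finset.smul_sum]
  have add3 : ∀ a b c a' b' c' : A N s, a + b + c + (a' + b' + c') =
      a + a' + (b + b') + (c + c') := by intros; abel
  rw [add3, ← Finset.sum_add_distrib]
  refine congrArg₂ _ (congrArg₂ _ ?_ (Finset.sum_congr rfl fun j hj => ?_)) ?_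
  · rw [hD1, show v - ez (pr N k) - ez k = v - ez k - ez (pr N k) by abel]
    simp only [smul_smul, ← add_smul]
    congr 1
    have e1 : SZ (v - ez (pr N k)) (k + 1) N = SZ v (k + 1) N - 1 := by
      simp only [SZ_sub, SZ_ez, pr]; split_ifs <;> omega
    have e2 : SZ (v - ez k) (pr N k + 1) N = SZ v (pr N k + 1) N := by
      simp only [SZ_sub, SZ_ez, pr]; split_ifs <;> omega
    rw [e1, e2, lapCoeff, SZ_empty (a := k) (b := k - 1) (by omega),
      show pr N (k - 1) = pr N k + 1 by simp only [pr]; omega,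
      SZ_first (a := k) (b := N) (by omega), hr1, hr2, Pi.sub_apply, ez_same]
    generalize SZ v (k + 1) N = c
    generalize SZ v (pr N k + 1) N = d
    generalize (N : ℤ) - 2 * k = r
    generalize v k = a
    have h3 : qp s r = qh s r * qh s r := by rw [qp_eq_qh, two_mul, qh_add hs]
    have hr := qh_ne hs r
    have ha := qp_ne hs a
    have hc := qp_ne hs c
    have hd := qp_ne hs d
    have h11 := qp_ne hs 1
    simp only [qp_add hs, qp_sub hs, qh_neg, h3, qp_zero]
    field_simp
    ring
  · rw [Finset.mem_Icc] at hj
    rw [hD1, show v + ez k - ez j - ez (pr N j) - ez k = v - ez j - ez (pr N j) by abel,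
      show v - ez k + ez k - ez j - ez (pr N j) = v - ez j - ez (pr N j) by abel]
    simp only [smul_smul, ← add_smul]
    congr 1
    have e1 : SZ (v + ez k - ez j - ez (pr N j)) (k + 1) N = SZ v (k + 1) N - 2 := by
      simp only [SZ_sub, SZ_add, SZ_ez, pr]; split_ifs <;> omega
    have e2 : SZ (v - ez k) k (j - 1) = SZ v k (j - 1) - 1 := by
      simp only [SZ_sub, SZ_ez]; split_ifs <;> omega
    have e3 : SZ (v - ez k) (pr N (j - 1)) N = SZ v (pr N (j - 1)) N := by
      simp only [SZ_sub, SZ_ez, pr]; split_ifs <;> omega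
    have := h.lap_scalar ((N : ℤ) - 2 * k) (rho2 N j) (v k) (SZ v (k + 1) (j - 1))
      (SZ v (k + 1) N) (SZ v (pr N (j - 1)) N)
    rw [e1, e2, e3, lapCoeff, lapCoeff, SZ_first (a := k) (by omega),
      SZ_first (a := k) (b := N) (by omega), hr1, hr2, Pi.sub_apply, ez_same, hbr, hbr]
    push_cast
    rw [show (N : ℤ) - 2 * (k + 1) = N - 2 * k - 2 by ring, ← this,
      show v k + SZ v (k + 1) (j - 1) - 1 + SZ v (pr N (j - 1)) N =
        v k - 1 + SZ v (k + 1) (j - 1) + SZ v (pr N (j - 1)) N by ring, sub_add_cancel]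
  · by_cases ho : Odd N
    · have h1 : odd01 N = 1 := by tauto
      simp only [if_pos ho, map_smul]
      rw [hD1, show v + ez k - ez (rk N + 1) - ez (rk N + 1) - ez k =
          v - ez (rk N + 1) - ez (rk N + 1) by abel, show v - ez k + ez k - ez (rk N + 1) -
          ez (rk N + 1) = v - ez (rk N + 1) - ez (rk N + 1) by abel]
      simp only [smul_smul, ← add_smul]
      congr 1
      have e1 : SZ (v + ez k - ez (rk N + 1) - ez (rk N + 1)) (k + 1) N = SZ v (k + 1) N - 2 := by
        simp only [SZ_sub, SZ_add, SZ_ez]; split_ifs <;> omega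
      have e2 : SZ (v - ez k) k N = SZ v k N - 1 := by
        simp only [SZ_sub, SZ_ez]; split_ifs <;> omega
      have := h.lap_scalar_mid ((N : ℤ) - 2 * k) (v k) (SZ v (k + 1) N) (v (rk N + 1))
      rw [e1, e2, lapCoeffMid, lapCoeffMid, SZ_first (a := k) (b := N) (by omega), hr1, hr2,
        Pi.sub_apply, Pi.sub_apply, ez_same, ez_of_ne (by omega), hbr, hbr]
      push_cast
      rw [show (N : ℤ) - 2 * (k + 1) = N - 2 * k - 2 by ring, ← this,
        show v k + SZ v (k + 1) N - 1 - 2 * (v (rk N + 1) - 0) =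
          v k - 1 + SZ v (k + 1) N - 2 * v (rk N + 1) by ring, sub_add_cancel]
    · simp [ho]

/-- Summation by parts over a triangle. -/
theorem sum_triangle {M : Type*} [AddCommGroup M] [Module ℂ M] (n : ℕ) (W : ℕ → ℕ → ℂ)
    (Y : ℕ → M) : ∑ k ∈ Finset.Icc 1 n, (W k k • Y k +
      ∑ j ∈ Finset.Icc (k + 1) n, (W k j - W (k + 1) j) • Y j) =
    ∑ j ∈ Finset.Icc 1 n, W 1 j • Y j := by
  have h1 : ∑ k ∈ Finset.Icc 1 n, ∑ j ∈ Finset.Icc (k + 1) n, (W k j - W (k + 1) j) • Y j =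
      ∑ j ∈ Finset.Icc 1 n, ∑ k ∈ Finset.Ico 1 j, (W k j - W (k + 1) j) • Y j := by
    refine Finset.sum_comm' fun k j => ?_
    simp only [Finset.mem_Icc, Finset.mem_Ico]
    omega
  rw [Finset.sum_add_distrib, h1, ← Finset.sum_add_distrib]
  refine Finset.sum_congr rfl fun j hj => ?_
  rw [Finset.mem_Icc] at hj
  rw [← Finset.sum_smul, ← add_smul]
  congr 1
  have := Finset.sum_Ico_sub (fun k => W k j) hj.1
  have h2 : ∑ k ∈ Finset.Ico 1 j, (W k j - W (k + 1) j) =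
      -∑ k ∈ Finset.Ico 1 j, (W (k + 1) j - W k j) := by
    rw [← Finset.sum_neg_distrib]
    simp
  rw [h2, this]
  ring

theorem two_rk (N : ℕ) : (2 : ℤ) * rk N + odd01 N = N := by exact_mod_cast rk_spec N

/-- The Laplace operator in divided powers: the sum over `k` of the contributions `Generic.lap_pair`
telescopes, so that each `y (v - ε_l - ε_{l'})` occurs with a single power of `q` as coefficient. -/
theorem Generic.Lap_y (h : Generic N s) (v : ℕ → ℤ) : Lap N s (y N s v) = dd N s (rk N) •
    (∑ l ∈ Finset.Icc 1 (rk N), qp s ((l : ℤ) - 2 + SZ v 1 N + SZ v 1 (l - 1) +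
        SZ v (pr N l + 1) N) • y N s (v - ez l - ez (pr N l)) +
      if Odd N then (qp s (rk N + 2 * (SZ v 1 N - v (rk N + 1))) * kap N s) •
        y N s (v - ez (rk N + 1) - ez (rk N + 1)) else 0) := by
  have hN := rk_spec N
  have hN' := two_rk N
  have h2 := h.two_le
  have hs := h.ne_zero
  have hodd := odd01_cases N
  have hdd : dd N s (rk N) = qh s (-((N : ℤ) - 2)) * (1 + qp s ((N : ℤ) - 2)) := by
    rw [dd, show (2 : ℤ) * rk N - 2 + odd01 N = N - 2 by omega, mul_add, qp_eq_qh, ← qh_add hs]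
    ring_nf
  rw [Lap, LinearMap.sum_apply]
  simp only [LinearMap.smul_apply, LinearMap.comp_apply]
  rw [sum_pairs]
  rw [Finset.sum_congr rfl fun k hk =>
    h.lap_pair (Finset.mem_Icc.1 hk).1 (Finset.mem_Icc.1 hk).2 v, Finset.sum_add_distrib,
      sum_triangle (rk N) (lapCoeff N s v)
    (fun j => y N s (v - ez j - ez (pr N j))), add_assoc, smul_add, Finset.smul_sum]
  congr 1
  · refine Finset.sum_congr rfl fun j hj => ?_
    rw [Finset.mem_Icc] at hj
    rw [smul_smul]
    congr 1
    rw [lapCoeff, hdd, show rho2 N j = (N : ℤ) - 2 * j from if_pos hj.2,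
      show pr N (j - 1) = pr N j + 1 by simp only [pr]; omega]
    have e2 : qh s (-((N : ℤ) - 2 * j)) = qh s (-((N : ℤ) - 2)) * qp s (j - 1) := by
      rw [qp_eq_qh, ← qh_add hs]; ring_nf
    have e3 : qp s ((j : ℤ) - 2 + SZ v 1 N + SZ v 1 (j - 1) + SZ v (pr N j + 1) N) =
        qp s (SZ v 1 (j - 1) + SZ v 1 N + SZ v (pr N j + 1) N - 1) * qp s (j - 1) := by
      rw [← qp_add hs]; ring_nf
    rw [e2, e3]
    push_cast
    ring
  · by_cases ho : Odd N
    · have h1 : odd01 N = 1 := by tauto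
      have hpm : pr N (rk N + 1) = rk N + 1 := by rw [pr]; omega
      simp only [if_pos ho]
      have hD : ∀ v, D N s (rk N + 1) (y N s v) =
          qp s (SZ v (rk N + 1 + 1) N) • y N s (v - ez (rk N + 1)) :=
        h.D_y_low (by omega) (by omega) (Or.inr hpm.symm)
      rw [hpm, hD, map_smul, hD, rho2_mid ho, ← Finset.sum_smul, smul_smul, smul_smul, smul_smul,
        ← add_smul]
      congr 1
      have e2 : SZ (v - ez (rk N + 1)) (rk N + 1 + 1) N = SZ v (rk N + 1 + 1) N := by
        simp only [SZ_sub, SZ_ez]; split_ifs <;> omega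
      have e3 : ∑ k ∈ Finset.Icc 1 (rk N), (lapCoeffMid N s v k - lapCoeffMid N s v (k + 1)) =
          lapCoeffMid N s v 1 - lapCoeffMid N s v (rk N + 1) := by
        have := Finset.sum_Ico_sub (fun k => lapCoeffMid N s v k) (show 1 ≤ rk N + 1 by omega)
        rw [← neg_inj, ← Finset.sum_neg_distrib, neg_sub, ← this]
        refine Finset.sum_congr ?_ fun k _ => by ring
        ext k; simp only [Finset.mem_Icc, Finset.mem_Ico]; omega
      have h12 := one_add_qp_ne hs h.root 1
      have h13 := qh_add_qh_neg_ne hs h.root 1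
      have hkap : kap N s = qh s 1 / (1 + qp s 1) := by
        rw [kap, if_pos ho, qp_eq_qh, two_mul, qh_add hs, inv_eq_one_div, div_eq_div_iff]
        · rw [qh_one]
          field_simp
          ring
        · rwa [qh_neg, qh_one] at h13
        · rwa [← qh_add hs, ← two_mul, ← qp_eq_qh]
      rw [e2, e3, hkap, hdd, lapCoeffMid, lapCoeffMid, SZ_first (a := rk N + 1) (by omega), qh_zero,
        show (N : ℤ) - 2 * ((rk N + 1 : ℕ) : ℤ) = -1 by push_cast; omega,
        show qh s (-((N : ℤ) - 2)) = qp s (1 - rk N) * qh s (-1) by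
          rw [qp_eq_qh, ← qh_add hs]; congr 1; omega]
      generalize SZ v 1 N = a
      generalize SZ v (rk N + 1 + 1) N = b
      generalize v (rk N + 1) = m
      have ha := qp_ne hs a
      have hb := qp_ne hs b
      have hm := qp_ne hs m
      have h11 := qp_ne hs 1
      have hh1 := qh_ne hs 1
      have hn := qp_ne hs (rk N)
      push_cast
      generalize qp s ((N : ℤ) - 2) = c
      simp only [two_mul, qp_add hs, qp_sub hs, qp_neg, qh_neg]
      field_simp
      ring
    · simp [ho]

/-- The coefficients of multiplication by the radius: `rad * y v = ∑ j,
  radC j v • y (v + ε_j + ε_{j'})`.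
The second case is that of the middle index. -/
def radC (N : ℕ) (s : ℂ) (j : ℕ) (v : ℕ → ℤ) : ℂ :=
  qp s ((j : ℤ) - 1 - SZ v (j + 1) (pr N j - 1)) *
    if j ≤ rk N then br N s j (v j + 1) * br N s (pr N j) (v (pr N j) + 1)
    else kap N s * (br N s j (v j + 1) * br N s j (v j + 2))

/-- The coefficients of the Laplace operator: up to a common factor,
`Δ (y v) = ∑ j, lapC j v • y (v - ε_j - ε_{j'})`. The second case is that of the middle index. -/
def lapC (N : ℕ) (s : ℂ) (j : ℕ) (v : ℕ → ℤ) : ℂ :=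
  if j ≤ rk N then qp s ((j : ℤ) - 2 + SZ v 1 N + SZ v 1 (j - 1) + SZ v (pr N j + 1) N)
  else qp s ((j : ℤ) - 1 + 2 * (SZ v 1 N - v j)) * kap N s

/-- The indices `1, …, n` and, for odd `N`, the middle index. -/
def half (N : ℕ) : Finset ℕ := Finset.Icc 1 (rk N + odd01 N)

/-- The multi-index `ε_j + ε_{j'}`. -/
def ep (N j : ℕ) : ℕ → ℤ := ez j + ez (pr N j)

theorem sum_half {M : Type*} [AddCommMonoid M] (g : ℕ → M) : ∑ j ∈ half N, g j =
    ∑ j ∈ Finset.Icc 1 (rk N), g j + if Odd N then g (rk N + 1) else 0 := by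
  rcases odd01_cases N with ⟨ho, h1⟩ | ⟨ho, h1⟩
  · rw [half, h1, Finset.sum_Icc_succ_top (by omega), if_pos ho]
  · rw [half, h1, if_neg ho, add_zero, add_zero]

theorem mem_half {j : ℕ} (hj : j ∈ half N) :
    1 ≤ j ∧ (j ≤ rk N ∧ j < pr N j ∨ Odd N ∧ j = rk N + 1 ∧ pr N j = j) := by
  have hN := rk_spec N
  have := odd01_cases N
  rw [half, Finset.mem_Icc] at hj
  refine ⟨hj.1, ?_⟩
  by_cases h : j ≤ rk N
  · exact Or.inl ⟨h, by rw [pr]; omega⟩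
  · have h1 : Odd N := by
      by_contra h2
      have : odd01 N = 0 := by tauto
      omega
    have h2 : odd01 N = 1 := by tauto
    exact Or.inr ⟨h1, by omega, by rw [pr]; omega⟩

theorem Generic.rad_y' (h : Generic N s) (v : ℕ → ℤ) :
    rad N s * y N s v = ∑ j ∈ half N, radC N s j v • y N s (v + ep N j) := by
  have hN := rk_spec N
  rw [h.rad_y, sum_half]
  congr 1
  · refine Finset.sum_congr rfl fun j hj => ?_
    rw [Finset.mem_Icc] at hj
    rw [radC, if_pos hj.2, ep, add_assoc]
  · by_cases ho : Odd N
    · have h1 : odd01 N = 1 := by have := odd01_cases N; tauto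
      have h2 : pr N (rk N + 1) = rk N + 1 := by rw [pr]; omega
      rw [if_pos ho, if_pos ho, radC, if_neg (by omega), ep, h2, SZ_empty (by omega), add_assoc]
      push_cast
      congr 1
      rw [add_sub_cancel_right, sub_zero, mul_assoc]
    · rw [if_neg ho, if_neg ho]

theorem Generic.Lap_y' (h : Generic N s) (v : ℕ → ℤ) : Lap N s (y N s v) =
    dd N s (rk N) • ∑ j ∈ half N, lapC N s j v • y N s (v - ep N j) := by
  have hN := rk_spec N
  rw [h.Lap_y, sum_half]
  congr 2
  · refine Finset.sum_congr rfl fun j hj => ?_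
    rw [Finset.mem_Icc] at hj
    rw [lapC, if_pos hj.2, ep, sub_sub]
  · by_cases ho : Odd N
    · have h1 : odd01 N = 1 := by have := odd01_cases N; tauto
      have h2 : pr N (rk N + 1) = rk N + 1 := by rw [pr]; omega
      rw [if_pos ho, if_pos ho, lapC, if_neg (by omega), ep, h2, sub_sub]
      push_cast
      rw [add_sub_cancel_right]
    · rw [if_neg ho, if_neg ho]

theorem ep_same {j : ℕ} (hj : j < pr N j) : ep N j j = 1 ∧ ep N j (pr N j) = 1 := by
  rw [ep, Pi.add_apply, Pi.add_apply, ez_same, ez_same, ez_of_ne (by omega), ez_of_ne (by omega)]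
  exact ⟨rfl, rfl⟩

theorem ep_mid {j : ℕ} (hj : pr N j = j) : ep N j j = 2 := by
  rw [ep, Pi.add_apply, hj, ez_same]; rfl

theorem ep_of_ne {i j : ℕ} (h : i ≠ j) (h' : i ≠ pr N j) : ep N j i = 0 := by
  rw [ep, Pi.add_apply, ez_of_ne h, ez_of_ne h']; rfl

theorem SZ_ep (j a b : ℕ) : SZ (ep N j) a b =
    (if a ≤ j ∧ j ≤ b then 1 else 0) + if a ≤ pr N j ∧ pr N j ≤ b then 1 else 0 := by
  rw [ep, SZ_add, SZ_ez, SZ_ez]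

/-- The diagonal part of the `q²`-commutator of the Laplace operator and the radius is a difference of
consecutive values of a function of `j`. -/
theorem Generic.comm_diag (h : Generic N s) {j : ℕ} (hj : 1 ≤ j) (hj' : j ≤ rk N)
    (v : ℕ → ℤ) : lapC N s j (v + ep N j) * radC N s j v -
      qp s 2 * (radC N s j (v - ep N j) * lapC N s j v) =
    (qp s (2 * ((j + 1 : ℕ) : ℤ) - 2 + 2 * (SZ v 1 N - SZ v (j + 1) (pr N (j + 1)))) -
      qp s (2 * (j : ℤ) - 2 + 2 * (SZ v 1 N - SZ v j (pr N j)))) / (qp s 1 - qp s (-1)) := by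
  have hN := rk_spec N
  have hs := h.ne_zero
  have hlt : j < pr N j := by rw [pr]; omega
  have hp : pr N (j + 1) = pr N j - 1 := by simp only [pr]; omega
  have e1 : SZ (v + ep N j) 1 N = SZ v 1 N + 2 := by
    simp only [SZ_add, SZ_ep, pr]; split_ifs <;> omega
  have e2 : SZ (v + ep N j) 1 (j - 1) = SZ v 1 (j - 1) := by
    simp only [SZ_add, SZ_ep, pr]; split_ifs <;> omega
  have e3 : SZ (v + ep N j) (pr N j + 1) N = SZ v (pr N j + 1) N := by
    simp only [SZ_add, SZ_ep, pr]; split_ifs <;> omega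
  have e4 : SZ (v - ep N j) (j + 1) (pr N j - 1) = SZ v (j + 1) (pr N j - 1) := by
    simp only [SZ_sub, SZ_ep, pr]; split_ifs <;> omega
  have e5 : SZ v j (pr N j) = v j + SZ v (j + 1) (pr N j - 1) + v (pr N j) := by
    rw [SZ_first (by omega)]
    have := SZ_last (v := v) (a := j + 1) (b := pr N j - 1) (by omega)
    rw [Nat.sub_add_cancel (by omega)] at this
    rw [this]; ring
  have e6 : SZ v 1 (j - 1) + SZ v (pr N j + 1) N = SZ v 1 N - SZ v j (pr N j) := by
    have h1 := SZ_append (v := v) (a := 1) (b := j - 1) (c := N) (by omega) (by omega)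
    have h2 := SZ_append (v := v) (a := j) (b := pr N j) (c := N) (by omega) (by rw [pr]; omega)
    rw [Nat.sub_add_cancel hj] at h1
    omega
  rw [lapC, lapC, radC, radC, if_pos hj', if_pos hj', if_pos hj', if_pos hj', e1, e2, e3, e4,
    br_sym (i := j) (by omega), br_sym (i := j) (by omega),
    br_sym (i := pr N j) (by simp only [pr]; omega),
    br_sym (i := pr N j) (by simp only [pr]; omega), Pi.sub_apply, Pi.sub_apply, (ep_same hlt).1,
    (ep_same hlt).2, sub_add_cancel, sub_add_cancel,
    show (j : ℤ) - 2 + (SZ v 1 N + 2) + SZ v 1 (j - 1) + SZ v (pr N j + 1) N =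
      j + SZ v 1 N + (SZ v 1 N - SZ v j (pr N j)) by rw [← e6]; ring,
    show (j : ℤ) - 2 + SZ v 1 N + SZ v 1 (j - 1) + SZ v (pr N j + 1) N =
      j - 2 + SZ v 1 N + (SZ v 1 N - SZ v j (pr N j)) by rw [← e6]; ring, e5, hp]
  generalize SZ v 1 N = m
  generalize SZ v (j + 1) (pr N j - 1) = i
  generalize v j = a
  generalize v (pr N j) = b
  have h0 := q_sub_ne hs h.root
  rw [← qp_one] at h0
  have h1 := qp_ne hs 1
  have hj := qp_ne hs j
  have hm := qp_ne hs m
  have hi := qp_ne hs i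
  have ha := qp_ne hs a
  have hb := qp_ne hs b
  have h4 : qp s 2 = qp s 1 * qp s 1 := by rw [← qp_add hs]; norm_num
  push_cast
  simp only [qsym, two_mul, qp_add hs, qp_sub hs, qp_neg, h4]
  generalize qp s 1 = q at *
  generalize qp s j = J at *
  generalize qp s m = M at *
  generalize qp s i = I at *
  generalize qp s a = A at *
  generalize qp s b = B at *
  have h0' : q ^ 2 - 1 ≠ 0 := by
    intro h
    apply h0
    field_simp
    rw [h, mul_zero]
  field_simp
  ring

/-- The analogue of `Generic.comm_diag` for the middle index,
  which is the end of the telescoping sum. -/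
theorem Generic.comm_diag_mid (h : Generic N s) (ho : Odd N) (v : ℕ → ℤ) :
    lapC N s (rk N + 1) (v + ep N (rk N + 1)) * radC N s (rk N + 1) v -
      qp s 2 * (radC N s (rk N + 1) (v - ep N (rk N + 1)) * lapC N s (rk N + 1) v) =
    (qp s (N + 2 * SZ v 1 N) -
      qp s (2 * ((rk N + 1 : ℕ) : ℤ) - 2 + 2 * (SZ v 1 N - SZ v (rk N + 1) (pr N (rk N + 1))))) /
        (qp s 1 - qp s (-1)) := by
  have hN := rk_spec N
  have hN' := two_rk N
  have hs := h.ne_zero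
  have ho1 : odd01 N = 1 := by have := odd01_cases N; tauto
  have hp : pr N (rk N + 1) = rk N + 1 := by rw [pr]; omega
  have e1 : SZ (v + ep N (rk N + 1)) 1 N = SZ v 1 N + 2 := by
    simp only [SZ_add, SZ_ep, pr]; split_ifs <;> omega
  have hkap : kap N s * kap N s = qp s 1 / ((1 + qp s 1) * (1 + qp s 1)) := by
    have h13 := qh_add_qh_neg_ne hs h.root 1
    have h12 := one_add_qp_ne hs h.root 1
    rw [qh_neg, qh_one] at h13
    rw [qp_one] at h12 ⊢
    rw [kap, if_pos ho, ← mul_inv, inv_eq_one_div, div_eq_div_iff (mul_ne_zero h13 h13)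
      (mul_ne_zero h12 h12)]
    field_simp
    ring
  rw [lapC, lapC, radC, radC, if_neg (by omega), if_neg (by omega), if_neg (by omega),
    if_neg (by omega), e1, hp, SZ_empty (v := v) (a := rk N + 1 + 1) (by omega),
    SZ_empty (v := v - ep N (rk N + 1)) (a := rk N + 1 + 1) (by omega),
    br_mid ho, br_mid ho, br_mid ho, br_mid ho, Pi.sub_apply, Pi.add_apply, ep_mid hp,
    show SZ v (rk N + 1) (rk N + 1) = v (rk N + 1) by simp [SZ], sub_add_cancel]
  have hN2 : (N : ℤ) = 2 * rk N + 1 := by omega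
  rw [hN2]
  generalize SZ v 1 N = m
  generalize v (rk N + 1) = a
  have h0 := q_sub_ne hs h.root
  rw [← qp_one] at h0
  have h1 := qp_ne hs 1
  have hn := qp_ne hs (rk N)
  have hm := qp_ne hs m
  have ha := qp_ne hs a
  have h11 : 1 - qp s 1 ≠ 0 := by rw [qp_one]; exact one_sub_q_ne h.root
  have h12 := one_add_qp_ne hs h.root 1
  have h4 : qp s 2 = qp s 1 * qp s 1 := by rw [← qp_add hs]; norm_num
  push_cast
  have e : ∀ a b c d e f g : ℂ, a * kap N s * (b * (kap N s * c)) -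
      d * (e * (kap N s * f) * (g * kap N s)) = (kap N s * kap N s) * (a * b * c - d * e * f * g) :=
    fun a b c d e f g => by ring
  rw [e, hkap]
  simp only [qnum, two_mul, qp_add hs, qp_sub hs, qp_neg, h4, qp_zero]
  generalize qp s 1 = q at *
  generalize qp s (rk N) = J at *
  generalize qp s m = M at *
  generalize qp s a = A at *
  have h0' : q ^ 2 - 1 ≠ 0 := by
    intro h
    apply h0
    field_simp
    rw [h, mul_zero]
  field_simp
  ring

/-- The parts of the Laplace operator and of the radius with different indices `q²`-commute. -/
theorem Generic.comm_off_diag (h : Generic N s) {j l : ℕ} (hj : j ∈ half N) (hl : l ∈ half N)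
    (hjl : j ≠ l) (v : ℕ → ℤ) : radC N s j v * lapC N s l (v + ep N j) =
      qp s 2 * (lapC N s l v * radC N s j (v - ep N l)) := by
  have hN := rk_spec N
  have hs := h.ne_zero
  have hodd := odd01_cases N
  obtain ⟨hj1, hj⟩ := mem_half hj
  obtain ⟨hl1, hl⟩ := mem_half hl
  have hpj : pr N j = N + 1 - j := rfl
  have hpl : pr N l = N + 1 - l := rfl
  have h1 : SZ (v - ep N l) (j + 1) (pr N j - 1) =
      SZ v (j + 1) (pr N j - 1) - if j < l then 2 else 0 := by
    simp only [SZ_sub, SZ_ep]; split_ifs <;> omega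
  have e1 : SZ (v + ep N j) 1 N = SZ v 1 N + 2 := by
    simp only [SZ_add, SZ_ep]; split_ifs <;> omega
  have h2 : radC N s j (v - ep N l) = qp s (if j < l then 2 else 0) * radC N s j v := by
    rw [radC, radC, h1, Pi.sub_apply, Pi.sub_apply, ep_of_ne hjl (by omega),
      ep_of_ne (by omega : pr N j ≠ l) (by omega : pr N j ≠ pr N l), sub_zero, sub_zero,
      ← mul_assoc (qp s _) (qp s _), ← qp_add hs]
    congr 2
    ring
  have h3 : lapC N s l (v + ep N j) = qp s (2 + if j < l then 2 else 0) * lapC N s l v := by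
    rw [lapC, lapC]
    split_ifs with h4 h5 h5
    · have e2 : SZ (v + ep N j) 1 (l - 1) + SZ (v + ep N j) (pr N l + 1) N =
          SZ v 1 (l - 1) + SZ v (pr N l + 1) N + 2 := by
        simp only [SZ_add, SZ_ep]; split_ifs <;> omega
      rw [add_assoc, e2, e1, ← qp_add hs]
      congr 1
      ring
    · have e2 : SZ (v + ep N j) 1 (l - 1) + SZ (v + ep N j) (pr N l + 1) N =
          SZ v 1 (l - 1) + SZ v (pr N l + 1) N := by
        simp only [SZ_add, SZ_ep]; split_ifs <;> omega
      rw [add_assoc, e2, e1, ← qp_add hs]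
      congr 1
      ring
    · rw [e1, Pi.add_apply, ep_of_ne (by omega) (by omega), ← mul_assoc (qp s _) (qp s _),
        ← qp_add hs]
      congr 2
      ring
    · omega
  rw [h2, h3, qp_add hs]
  ring

/-- The commutation relation of the Laplace operator and the radius. Terms with different indices
cancel by `Generic.comm_off_diag`, and the diagonal terms telescope by `Generic.comm_diag`. -/
theorem Generic.Lap_rad_y (h : Generic N s) (v : ℕ → ℤ) :
    Lap N s (rad N s * y N s v) = qp s 2 • (rad N s * Lap N s (y N s v)) +
      (dd N s (rk N) * ((qp s (N + 2 * SZ v 1 N) - 1) / (qp s 1 - qp s (-1)))) • y N s v := by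
  have hN := rk_spec N
  have hN' := two_rk N
  have h2 := h.two_le
  rw [h.rad_y', h.Lap_y', map_sum, mul_smul_comm, Finset.mul_sum, smul_comm, mul_smul, ← smul_add]
  have e1 : ∀ j ∈ half N, Lap N s (radC N s j v • y N s (v + ep N j)) = dd N s (rk N) •
      ∑ l ∈ half N, (radC N s j v * lapC N s l (v + ep N j)) • y N s (v + ep N j - ep N l) := by
    intro j hj
    rw [map_smul, h.Lap_y', smul_comm, Finset.smul_sum]
    simp only [smul_smul]
  rw [Finset.sum_congr rfl e1, ← Finset.smul_sum]
  congr 1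
  have e2 : ∀ l ∈ half N, rad N s * (lapC N s l v • y N s (v - ep N l)) =
      ∑ j ∈ half N, (lapC N s l v * radC N s j (v - ep N l)) • y N s (v + ep N j - ep N l) := by
    intro l hl
    rw [mul_smul_comm, h.rad_y', Finset.smul_sum]
    simp only [smul_smul, sub_add_eq_add_sub]
  have e5 := Finset.sum_comm (s := half N) (t := half N) (f := fun l j =>
    (lapC N s l v * radC N s j (v - ep N l)) • y N s (v + ep N j - ep N l))
  rw [Finset.sum_congr rfl e2, e5, Finset.smul_sum, ← sub_eq_iff_eq_add',
    ← Finset.sum_sub_distrib]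
  have e3 : ∀ j ∈ half N, (∑ l ∈ half N, (radC N s j v * lapC N s l (v + ep N j)) •
      y N s (v + ep N j - ep N l)) - qp s 2 • ∑ l ∈ half N,
        (lapC N s l v * radC N s j (v - ep N l)) • y N s (v + ep N j - ep N l) =
      (lapC N s j (v + ep N j) * radC N s j v -
        qp s 2 * (radC N s j (v - ep N j) * lapC N s j v)) • y N s v := by
    intro j hj
    rw [Finset.smul_sum, ← Finset.sum_sub_distrib, Finset.sum_eq_single_of_mem j hj]
    · rw [add_sub_cancel_right]
      module
    · intro l hl hne
      rw [h.comm_off_diag hj hl hne.symm, mul_smul, sub_self]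
  rw [Finset.sum_congr rfl e3, ← Finset.sum_smul]
  congr 1
  rw [sum_half, Finset.sum_congr rfl fun j hj =>
    h.comm_diag (Finset.mem_Icc.1 hj).1 (Finset.mem_Icc.1 hj).2 v, ← Finset.sum_div]
  have e4 := Finset.sum_Ico_sub (fun j : ℕ => qp s (2 * (j : ℤ) - 2 +
    2 * (SZ v 1 N - SZ v j (pr N j)))) (show 1 ≤ rk N + 1 by omega)
  rw [show Finset.Icc 1 (rk N) = Finset.Ico 1 (rk N + 1) by
    ext; simp only [Finset.mem_Icc, Finset.mem_Ico]; omega, e4,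
    show SZ v 1 (pr N 1) = SZ v 1 N by rw [pr]; rfl]
  rcases odd01_cases N with ⟨ho, h1⟩ | ⟨ho, h1⟩
  · rw [if_pos ho, h.comm_diag_mid ho, ← add_div]
    congr 1
    simp
  · rw [if_neg ho, SZ_empty (a := rk N + 1) (by rw [pr]; omega), add_zero]
    congr 2
    · congr 1; push_cast; omega
    · simp

/-! ### The radius is invariant -/

/-- A criterion for an operator with two terms to commute with the radius: only the terms that
belong to the indices `j₁` and `j₂` interact. -/
theorem Generic.map_rad_y_of_two_terms (h : Generic N s) {T : A N s →ₗ[ℂ] A N s}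
    {a b : (ℕ → ℤ) → ℂ} {α β : ℕ → ℤ} {j₁ j₂ : ℕ} (hj₁ : j₁ ∈ half N) (hj₂ : j₂ ∈ half N)
    (hαβ : β + ep N j₁ = α + ep N j₂)
    (hT : ∀ v, T (y N s v) = a v • y N s (v + α) - b v • y N s (v + β))
    (hA : ∀ v, ∀ j ∈ half N, j ≠ j₂ → radC N s j v * a (v + ep N j) = a v * radC N s j (v + α))
    (hB : ∀ v, ∀ j ∈ half N, j ≠ j₁ → radC N s j v * b (v + ep N j) = b v * radC N s j (v + β))
    (hC : ∀ v, radC N s j₂ v * a (v + ep N j₂) - a v * radC N s j₂ (v + α) =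
      radC N s j₁ v * b (v + ep N j₁) - b v * radC N s j₁ (v + β)) (v : ℕ → ℤ) :
    T (rad N s * y N s v) = rad N s * T (y N s v) := by
  have e1 : ∀ (α : ℕ → ℤ) (a : (ℕ → ℤ) → ℂ) (i : ℕ), i ∈ half N →
      (∀ j ∈ half N, j ≠ i → radC N s j v * a (v + ep N j) = a v * radC N s j (v + α)) →
      ∑ j ∈ half N, radC N s j v • a (v + ep N j) • y N s (v + ep N j + α) =
        rad N s * (a v • y N s (v + α)) +
          (radC N s i v * a (v + ep N i) - a v * radC N s i (v + α)) •
            y N s (v + (α + ep N i)) := by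
    intro α a i hi hA
    rw [mul_smul_comm, h.rad_y', Finset.smul_sum, ← sub_eq_iff_eq_add', ← Finset.sum_sub_distrib,
      Finset.sum_eq_single_of_mem i hi]
    · rw [add_right_comm v, ← add_assoc v]
      module
    · intro j hj hne
      rw [add_right_comm v, smul_smul, hA j hj hne, mul_smul, sub_self]
  rw [hT, mul_sub, h.rad_y', map_sum]
  simp only [map_smul, hT, smul_sub]
  rw [Finset.sum_sub_distrib, e1 α a j₂ hj₂ (hA v), e1 β b j₁ hj₁ (hB v), hαβ, hC]
  abel

theorem radC_add {α : ℕ → ℤ} (hs : s ≠ 0) {j : ℕ} (h1 : α j = 0) (h2 : α (pr N j) = 0)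
    (v : ℕ → ℤ) : radC N s j (v + α) = qp s (-SZ α (j + 1) (pr N j - 1)) * radC N s j v := by
  rw [radC, radC, Pi.add_apply, Pi.add_apply, h1, h2, add_zero, add_zero, SZ_add,
    ← mul_assoc (qp s _) (qp s _), ← qp_add hs]
  congr 2
  ring

theorem radC_low {j : ℕ} (hj : 1 ≤ j) (hj' : j ≤ rk N) (v : ℕ → ℤ) : radC N s j v =
    qp s ((j : ℤ) - 1 - SZ v (j + 1) (pr N j - 1)) *
      (qsym s (v j + 1) * qsym s (v (pr N j) + 1)) := by
  have := rk_spec N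
  rw [radC, if_pos hj', br_sym (by rw [pr]; omega), br_sym (by simp only [pr]; omega)]

/-- Operators with the formula of `E_k`, `k < n`,
  commute with the radius. With `l` and `l'` exchanged,
this is the formula of `E_n` for even `N`, where `k = n - 1`. -/
theorem Generic.map_rad_y_raising (h : Generic N s) {T : A N s →ₗ[ℂ] A N s} {k l l' : ℕ}
    (hk : 1 ≤ k) (hk' : k < rk N) (hl : l = k + 1 ∧ l' = pr N (k + 1) ∨
      l = pr N (k + 1) ∧ l' = k + 1 ∧ pr N (k + 1) = k + 2)
    (hT : ∀ v, T (y N s v) =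
      (br N s k (v k + 1) * qp s (v k - v l + 1)) • y N s (v + ez k - ez l) -
      (br N s l' (v l' + 1) * qp s (v k - v l - v (pr N k) + v l' + 1)) •
        y N s (v + ez l' - ez (pr N k))) (v : ℕ → ℤ) :
    T (rad N s * y N s v) = rad N s * T (y N s v) := by
  have hN := rk_spec N
  have hodd := odd01_cases N
  have hs := h.ne_zero
  have p1 : pr N k = N + 1 - k := rfl
  have p2 : pr N (k + 1) = N - k := by rw [pr]; omega
  have b1 : ∀ a, br N s k a = qsym s a := br_sym (by omega)
  have b2 : ∀ a, br N s l' a = qsym s a := br_sym (by simp only [pr]; omega)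
  have ep2 : ep N (k + 1) = ez l + ez l' := by
    rcases hl with ⟨rfl, rfl⟩ | ⟨rfl, rfl, -⟩
    · rfl
    · exact add_comm _ _
  have rC : ∀ v, radC N s (k + 1) v = qp s ((k + 1 : ℕ) - 1 - SZ v (k + 2) (pr N (k + 1) - 1)) *
      (qsym s (v l + 1) * qsym s (v l' + 1)) := by
    intro v
    rw [radC_low (by omega) (by omega)]
    rcases hl with ⟨rfl, rfl⟩ | ⟨rfl, rfl, -⟩
    · rfl
    · rw [mul_comm (qsym s _)]
  have hI : ∀ v, SZ v (k + 1) (pr N k - 1) = v l + SZ v (k + 2) (pr N (k + 1) - 1) + v l' := by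
    intro v
    have := SZ_last (v := v) (a := k + 2) (b := pr N (k + 1) - 1) (by omega)
    rw [Nat.sub_add_cancel (by omega)] at this
    rw [SZ_first (by omega), show pr N k - 1 = pr N (k + 1) by omega, this]
    rcases hl with ⟨rfl, rfl⟩ | ⟨rfl, rfl, -⟩ <;> ring
  have q1 := qp_ne hs
  have q2 : qp s 1 - (qp s 1)⁻¹ ≠ 0 := by rw [qp_one]; exact q_sub_ne hs h.root
  have q4 : qp s 1 ^ 2 - 1 ≠ 0 := by
    intro h; apply q2; have := q1 1; field_simp; rw [h, mul_zero]
  have z1 : ∀ i j : ℕ, j = i → ez i j = 1 := fun i j h => by rw [h, ez_same]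
  have z0 : ∀ i j : ℕ, j ≠ i → ez i j = 0 := fun i j h => ez_of_ne h
  refine h.map_rad_y_of_two_terms (j₁ := k) (j₂ := k + 1)
    (a := fun v => br N s k (v k + 1) * qp s (v k - v l + 1))
    (b := fun v => br N s l' (v l' + 1) * qp s (v k - v l - v (pr N k) + v l' + 1))
    (α := ez k - ez l) (β := ez l' - ez (pr N k)) (by rw [half, Finset.mem_Icc]; omega)
    (by rw [half, Finset.mem_Icc]; omega) ?_ ?_ ?_ ?_ ?_ v
  · rw [ep2, ep]; abel
  · intro v
    rw [hT, add_sub_assoc, add_sub_assoc]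
  · intro v j hj hne
    obtain ⟨hj1, hj⟩ := mem_half hj
    have p3 : pr N j = N + 1 - j := rfl
    by_cases hjk : j = k
    · subst hjk
      rw [radC_low hj1 (by omega), radC_low hj1 (by omega), hI, hI]
      simp only [Pi.add_apply, Pi.sub_apply, SZ_add, SZ_sub, SZ_ez, b1, ep,
        z1 j j rfl, z0 j (pr N j) (by omega), z0 l j (by omega), z0 (pr N j) l (by omega),
        z0 (pr N j) j (by omega), z0 j l (by omega), z1 l l rfl, z0 l (pr N j) (by omega),
        z0 l l' (by omega), z0 j l' (by omega)]
      rw [if_neg (by omega), if_neg (by omega)]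
      simp only [qsym, qp_add hs, qp_sub hs, qp_neg, qp_zero,
        zero_sub]
      have := q1 1
      have := q1 (v l)
      have := q1 (v l')
      field_simp
    · simp only [Pi.add_apply, ep, z0 j k (by omega), z0 (pr N j) k (by omega), z0 j l (by omega),
        z0 (pr N j) l (by omega), add_zero]
      rw [radC_add hs (by simp only [Pi.sub_apply, z0 k j (by omega), z0 l j (by omega), sub_zero])
        (by simp only [Pi.sub_apply, z0 k (pr N j) (by omega), z0 l (pr N j) (by omega), sub_zero]),
        show SZ (ez k - ez l) (j + 1) (pr N j - 1) = 0 by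
          simp only [SZ_sub, SZ_ez]; split_ifs <;> omega, neg_zero, qp_zero]
      ring
  · intro v j hj hne
    obtain ⟨hj1, hj⟩ := mem_half hj
    have p3 : pr N j = N + 1 - j := rfl
    by_cases hjk : j = k + 1
    · subst hjk
      rw [rC, rC, ep2]
      simp only [Pi.add_apply, Pi.sub_apply, SZ_add, SZ_sub, SZ_ez, b2,
        z1 l l rfl, z1 l' l' rfl, z0 l l' (by omega), z0 l' l (by omega), z0 l k (by omega),
        z0 l' k (by omega), z0 l (pr N k) (by omega), z0 l' (pr N k) (by omega),
        z0 (pr N k) l (by omega), z0 (pr N k) l' (by omega)]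
      rw [if_neg (by omega), if_neg (by omega)]
      simp only [qsym, qp_add hs, qp_sub hs, qp_neg, qp_zero, Nat.cast_add, Nat.cast_one,
        zero_sub]
      have := q1 1
      have := q1 (v l)
      have := q1 (v l')
      field_simp
    · simp only [Pi.add_apply, ep, z0 j k (by omega), z0 (pr N j) k (by omega), z0 j l (by omega),
        z0 (pr N j) l (by omega), z0 j l' (by omega), z0 (pr N j) l' (by omega),
        z0 j (pr N k) (by omega), z0 (pr N j) (pr N k) (by omega), add_zero]
      rw [radC_add hs (by simp only [Pi.sub_apply, z0 l' j (by omega), z0 (pr N k) j (by omega),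
        sub_zero])
        (by simp only [Pi.sub_apply, z0 l' (pr N j) (by omega), z0 (pr N k) (pr N j) (by omega),
          sub_zero]),
        show SZ (ez l' - ez (pr N k)) (j + 1) (pr N j - 1) = 0 by
          simp only [SZ_sub, SZ_ez]; split_ifs <;> omega, neg_zero, qp_zero]
      ring
  · intro v
    rw [rC, rC, ep2, radC_low hk hk'.le, radC_low hk hk'.le, hI, hI, ep]
    simp only [Pi.add_apply, Pi.sub_apply, SZ_add, SZ_sub, SZ_ez, b1, b2,
        z1 l l rfl, z1 l' l' rfl, z0 l l' (by omega), z0 l' l (by omega), z0 l k (by omega),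
        z0 l' k (by omega), z0 l' (pr N k) (by omega),
        z0 (pr N k) l (by omega), z0 (pr N k) l' (by omega), z1 k k rfl,
        z1 (pr N k) (pr N k) rfl, z0 k l (by omega), z0 k l' (by omega), z0 k (pr N k) (by omega),
        z0 (pr N k) k (by omega)]
    rw [if_neg (by omega), if_neg (by omega), if_neg (by omega), if_neg (by omega)]
    simp only [qsym, qp_add hs, qp_sub hs, qp_neg, qp_zero, Nat.cast_add, Nat.cast_one,
        zero_sub]
    generalize SZ v (k + 2) (pr N (k + 1) - 1) = i
    have := q1 1
    have := q1 k
    have := q1 i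
    have := q1 (v k)
    have := q1 (v l)
    have := q1 (v l')
    have := q1 (v (pr N k))
    generalize qp s 1 = q at *
    generalize qp s (v k) = A at *
    generalize qp s (v l) = B at *
    generalize qp s (v l') = C at *
    generalize qp s (v (pr N k)) = D at *
    generalize qp s k = K at *
    generalize qp s i = I at *
    field_simp
    ring

/-- Operators with the formula of `F_k`, `k < n`, or, with `l` and `l'` exchanged,
  of `F_n` for even `N`,
commute with the radius. -/
theorem Generic.map_rad_y_lowering (h : Generic N s) {T : A N s →ₗ[ℂ] A N s} {k l l' : ℕ}
    (hk : 1 ≤ k) (hk' : k < rk N) (hl : l = k + 1 ∧ l' = pr N (k + 1) ∨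
      l = pr N (k + 1) ∧ l' = k + 1 ∧ pr N (k + 1) = k + 2)
    (hT : ∀ v, T (y N s v) =
      (br N s l (v l + 1) * qp s (-v k + v l - v l' + v (pr N k) + 1)) • y N s (v + ez l - ez k) -
      (br N s (pr N k) (v (pr N k) + 1) * qp s (-v l' + v (pr N k) + 1)) •
        y N s (v + ez (pr N k) - ez l')) (v : ℕ → ℤ) :
    T (rad N s * y N s v) = rad N s * T (y N s v) := by
  have hN := rk_spec N
  have hodd := odd01_cases N
  have hs := h.ne_zero
  have p1 : pr N k = N + 1 - k := rfl
  have p2 : pr N (k + 1) = N - k := by rw [pr]; omega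
  have b1 : ∀ a, br N s l a = qsym s a := br_sym (by simp only [pr]; omega)
  have b2 : ∀ a, br N s (pr N k) a = qsym s a := br_sym (by simp only [pr]; omega)
  have ep2 : ep N (k + 1) = ez l + ez l' := by
    rcases hl with ⟨rfl, rfl⟩ | ⟨rfl, rfl, -⟩
    · rfl
    · exact add_comm _ _
  have rC : ∀ v, radC N s (k + 1) v = qp s ((k + 1 : ℕ) - 1 - SZ v (k + 2) (pr N (k + 1) - 1)) *
      (qsym s (v l + 1) * qsym s (v l' + 1)) := by
    intro v
    rw [radC_low (by omega) (by omega)]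
    rcases hl with ⟨rfl, rfl⟩ | ⟨rfl, rfl, -⟩
    · rfl
    · rw [mul_comm (qsym s _)]
  have hI : ∀ v, SZ v (k + 1) (pr N k - 1) = v l + SZ v (k + 2) (pr N (k + 1) - 1) + v l' := by
    intro v
    have := SZ_last (v := v) (a := k + 2) (b := pr N (k + 1) - 1) (by omega)
    rw [Nat.sub_add_cancel (by omega)] at this
    rw [SZ_first (by omega), show pr N k - 1 = pr N (k + 1) by omega, this]
    rcases hl with ⟨rfl, rfl⟩ | ⟨rfl, rfl, -⟩ <;> ring
  have q1 := qp_ne hs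
  have q2 : qp s 1 - (qp s 1)⁻¹ ≠ 0 := by rw [qp_one]; exact q_sub_ne hs h.root
  have q4 : qp s 1 ^ 2 - 1 ≠ 0 := by
    intro h; apply q2; have := q1 1; field_simp; rw [h, mul_zero]
  have z1 : ∀ i j : ℕ, j = i → ez i j = 1 := fun i j h => by rw [h, ez_same]
  have z0 : ∀ i j : ℕ, j ≠ i → ez i j = 0 := fun i j h => ez_of_ne h
  refine h.map_rad_y_of_two_terms (j₁ := k + 1) (j₂ := k)
    (a := fun v => br N s l (v l + 1) * qp s (-v k + v l - v l' + v (pr N k) + 1))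
    (b := fun v => br N s (pr N k) (v (pr N k) + 1) * qp s (-v l' + v (pr N k) + 1))
    (α := ez l - ez k) (β := ez (pr N k) - ez l') (by rw [half, Finset.mem_Icc]; omega)
    (by rw [half, Finset.mem_Icc]; omega) ?_ ?_ ?_ ?_ ?_ v
  · rw [ep2, ep]; abel
  · intro v
    rw [hT, add_sub_assoc v, add_sub_assoc v]
  · intro v j hj hne
    obtain ⟨hj1, hj⟩ := mem_half hj
    have p3 : pr N j = N + 1 - j := rfl
    by_cases hjk : j = k + 1
    · subst hjk
      rw [rC, rC, ep2]
      simp only [Pi.add_apply, Pi.sub_apply, SZ_add, SZ_sub, SZ_ez, b1,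
        z0 k l (by omega), z0 k l' (by omega),
        z0 l k (by omega), z0 l (pr N k) (by omega), z1 l l rfl, z0 l l' (by omega),
        z0 l' k (by omega), z0 l' (pr N k) (by omega), z0 l' l (by omega), z1 l' l' rfl]
      rw [if_neg (by omega), if_neg (by omega)]
      simp only [qsym, qp_add hs, qp_sub hs, qp_neg, qp_zero, zero_sub]
      have := q1 1
      have := q1 (v l)
      have := q1 (v l')
      field_simp
    · simp only [Pi.add_apply, ep, z0 j k (by omega), z0 (pr N j) k (by omega), z0 j l (by omega),
        z0 (pr N j) l (by omega), z0 j l' (by omega), z0 (pr N j) l' (by omega),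
        z0 j (pr N k) (by omega), z0 (pr N j) (pr N k) (by omega), add_zero]
      rw [radC_add hs (by simp only [Pi.sub_apply, z0 l j (by omega), z0 k j (by omega), sub_zero])
        (by simp only [Pi.sub_apply, z0 l (pr N j) (by omega), z0 k (pr N j) (by omega), sub_zero]),
        show SZ (ez l - ez k) (j + 1) (pr N j - 1) = 0 by
          simp only [SZ_sub, SZ_ez]; split_ifs <;> omega, neg_zero, qp_zero]
      ring
  · intro v j hj hne
    obtain ⟨hj1, hj⟩ := mem_half hj
    have p3 : pr N j = N + 1 - j := rfl
    by_cases hjk : j = k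
    · subst hjk
      rw [radC_low hj1 (by omega), radC_low hj1 (by omega), hI, hI]
      simp only [Pi.add_apply, Pi.sub_apply, SZ_add, SZ_sub, SZ_ez, b2, ep,
        z1 j k rfl, z0 j (pr N j) (by omega), z0 j l' (by omega),
        z0 (pr N j) j (by omega), z1 (pr N j) (pr N j) rfl, z0 (pr N j) l (by omega),
        z0 (pr N j) l' (by omega),
        z0 l' j (by omega), z0 l' (pr N j) (by omega), z0 l' l (by omega), z1 l' l' rfl]
      rw [if_neg (by omega), if_neg (by omega)]
      simp only [qsym, qp_add hs, qp_sub hs, qp_neg, qp_zero, zero_sub]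
      have := q1 1
      have := q1 (v l)
      have := q1 (v l')
      field_simp
    · simp only [Pi.add_apply, ep, z0 j (pr N k) (by omega), z0 (pr N j) (pr N k) (by omega),
        z0 j l' (by omega), z0 (pr N j) l' (by omega), add_zero]
      rw [radC_add hs
        (by simp only [Pi.sub_apply, z0 l' j (by omega), z0 (pr N k) j (by omega), sub_zero])
        (by simp only [Pi.sub_apply, z0 l' (pr N j) (by omega), z0 (pr N k) (pr N j) (by omega),
          sub_zero]),
        show SZ (ez (pr N k) - ez l') (j + 1) (pr N j - 1) = 0 by
          simp only [SZ_sub, SZ_ez]; split_ifs <;> omega, neg_zero, qp_zero]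
      ring
  · intro v
    rw [rC, rC, ep2, radC_low hk hk'.le, radC_low hk hk'.le, hI, hI, ep]
    simp only [Pi.add_apply, Pi.sub_apply, SZ_add, SZ_sub, SZ_ez, b1, b2,
        z1 k k rfl, z0 k (pr N k) (by omega), z0 k l (by omega), z0 k l' (by omega),
        z0 (pr N k) k (by omega), z1 (pr N k) (pr N k) rfl, z0 (pr N k) l (by omega),
        z0 (pr N k) l' (by omega),
        z0 l k (by omega), z0 l (pr N k) (by omega), z1 l l rfl, z0 l l' (by omega),
        z0 l' (pr N k) (by omega), z0 l' l (by omega), z1 l' l' rfl]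
    rw [if_neg (by omega), if_neg (by omega), if_neg (by omega), if_neg (by omega)]
    simp only [qsym, qp_add hs, qp_sub hs, qp_neg, qp_zero, Nat.cast_add, Nat.cast_one,
        zero_sub]
    generalize SZ v (k + 2) (pr N (k + 1) - 1) = i
    have := q1 1
    have := q1 k
    have := q1 i
    have := q1 (v k)
    have := q1 (v l)
    have := q1 (v l')
    have := q1 (v (pr N k))
    generalize qp s 1 = q at *
    generalize qp s (v k) = A at *
    generalize qp s (v l) = B at *
    generalize qp s (v l') = C at *
    generalize qp s (v (pr N k)) = D at *
    generalize qp s k = K at *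
    generalize qp s i = I at *
    field_simp
    ring

/-- For odd `N`, operators with the formula of `E_n` commute with the radius. -/
theorem Generic.map_rad_y_raising_middle (h : Generic N s) (ho : Odd N) {T : A N s →ₗ[ℂ] A N s}
    {n c d : ℕ} (hn : n = rk N) (hc : c = rk N + 1) (hd : d = rk N + 2)
    (hT : ∀ v, T (y N s v) =
      (br N s n (v n + 1) * qh s (2 * (v n - v c) + 3)) • y N s (v + ez n - ez c) -
      (br N s c (v c + 1) * qp s (v n - v d + 1)) • y N s (v + ez c - ez d))
    (v : ℕ → ℤ) : T (rad N s * y N s v) = rad N s * T (y N s v) := by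
  have hN := rk_spec N
  have h2 := h.two_le
  have ho1 : odd01 N = 1 := by have := odd01_cases N; tauto
  have hs := h.ne_zero
  have p1 : pr N n = d := by rw [pr]; omega
  have p2 : pr N c = c := by rw [pr]; omega
  have b1 : ∀ a, br N s n a = qsym s a := br_sym (by omega)
  have b2 : ∀ a, br N s d a = qsym s a := br_sym (by rw [pr]; omega)
  have b3 : ∀ a, br N s c a = qnum s a := by rw [hc]; exact br_mid ho
  have epn : ep N n = ez n + ez d := by rw [ep, p1]
  have epc : ep N c = ez c + ez c := by rw [ep, p2]
  have rn : ∀ v, radC N s n v = qp s ((n : ℤ) - 1 - v c) *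
      (qsym s (v n + 1) * qsym s (v d + 1)) := by
    intro v
    rw [radC_low (by omega) (by omega), p1, show n + 1 = c by omega, show d - 1 = c by omega,
      show SZ v c c = v c by simp [SZ]]
  have rc : ∀ v, radC N s c v =
      qp s n * (s / (1 + qp s 1) * (qnum s (v c + 1) * qnum s (v c + 2))) := by
    intro v
    rw [radC, if_neg (by omega), b3, b3, SZ_empty (by omega), kap, if_pos ho]
    congr 2
    · omega
    · rw [qp_one]
      field_simp
      ring
  have qh2 : ∀ a, qh s (2 * a) = qp s a := fun a => (qp_eq_qh s a).symm
  have qh3 : qh s 3 = qp s 1 * s := by rw [qp_one, qh]; norm_cast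
  have q1 := qp_ne hs
  have q2 : qp s 1 - (qp s 1)⁻¹ ≠ 0 := by rw [qp_one]; exact q_sub_ne hs h.root
  have q3 : 1 - qp s 1 ≠ 0 := by rw [qp_one]; exact one_sub_q_ne h.root
  have q5 : 1 + qp s 1 ≠ 0 := one_add_qp_ne hs h.root 1
  have q6 : qp s 2 = qp s 1 * qp s 1 := by rw [← qp_add hs]; norm_num
  have q4 : qp s 1 ^ 2 - 1 ≠ 0 := by
    intro h; apply q2; have := q1 1; field_simp; rw [h, mul_zero]
  have z1 : ∀ i j : ℕ, j = i → ez i j = 1 := fun i j h => by rw [h, ez_same]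
  have z0 : ∀ i j : ℕ, j ≠ i → ez i j = 0 := fun i j h => ez_of_ne h
  refine h.map_rad_y_of_two_terms (j₁ := n) (j₂ := c)
    (a := fun v => br N s n (v n + 1) * (qp s (v n - v c) * (qp s 1 * s)))
    (b := fun v => br N s c (v c + 1) * qp s (v n - v d + 1))
    (α := ez n - ez c) (β := ez c - ez d) (by rw [half, Finset.mem_Icc]; omega)
    (by rw [half, Finset.mem_Icc]; omega) ?_ ?_ ?_ ?_ ?_ v
  · rw [epn, epc]; abel
  · intro v
    rw [hT, add_sub_assoc v, add_sub_assoc v, qh_add hs, qh2]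
    simp only [qh3]
  · intro v j hj hne
    obtain ⟨hj1, hj⟩ := mem_half hj
    have p3 : pr N j = N + 1 - j := rfl
    by_cases hjk : j = n
    · rw [hjk]
      rw [rn, rn]
      simp only [Pi.add_apply, Pi.sub_apply, epn, b1,
        z1 n n rfl, z0 n c (by omega), z0 n d (by omega), z0 c n (by omega), z1 c c rfl,
        z0 c d (by omega), z0 d n (by omega), z0 d c (by omega)]
      simp only [qsym, qp_add hs, qp_sub hs, qp_neg, qp_zero, zero_sub]
      have := q1 1
      have := q1 (v n)
      have := q1 (v c)
      have := q1 (v d)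
      field_simp
    · have hc' : j ≠ c := by omega
      simp only [Pi.add_apply, ep, z0 j n (by omega), z0 (pr N j) n (by omega), z0 j c (by omega),
        z0 (pr N j) c (by omega), add_zero]
      rw [radC_add hs (by simp only [Pi.sub_apply, z0 n j (by omega), z0 c j (by omega), sub_zero])
        (by simp only [Pi.sub_apply, z0 n (pr N j) (by omega), z0 c (pr N j) (by omega),
          sub_zero]),
        show SZ (ez n - ez c) (j + 1) (pr N j - 1) = 0 by
          simp only [SZ_sub, SZ_ez]; split_ifs <;> omega, neg_zero, qp_zero]
      ring
  · intro v j hj hne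
    obtain ⟨hj1, hj⟩ := mem_half hj
    have p3 : pr N j = N + 1 - j := rfl
    by_cases hjk : j = c
    · rw [hjk]
      rw [rc, rc]
      simp only [Pi.add_apply, Pi.sub_apply, epc, b3,
        z0 c n (by omega), z1 c c rfl, z0 c d (by omega), z0 d c (by omega)]
      simp only [qnum, qp_add hs, qp_sub hs, qp_zero, q6]
      have := q1 1
      have := q1 (v n)
      have := q1 (v c)
      have := q1 (v d)
      field_simp
    · have hc' : j ≠ c := by omega
      simp only [Pi.add_apply, ep, z0 j n (by omega), z0 (pr N j) n (by omega), z0 j c (by omega),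
        z0 (pr N j) c (by omega), z0 j d (by omega), z0 (pr N j) d (by omega), add_zero]
      rw [radC_add hs (by simp only [Pi.sub_apply, z0 c j (by omega), z0 d j (by omega), sub_zero])
        (by simp only [Pi.sub_apply, z0 c (pr N j) (by omega), z0 d (pr N j) (by omega),
          sub_zero]),
        show SZ (ez c - ez d) (j + 1) (pr N j - 1) = 0 by
          simp only [SZ_sub, SZ_ez]; split_ifs <;> omega, neg_zero, qp_zero]
      ring
  · intro v
    rw [rn, rn, rc, rc]
    simp only [Pi.add_apply, Pi.sub_apply, epn, epc, b1, b3,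
      z1 n n rfl, z0 n c (by omega), z0 n d (by omega), z0 c n (by omega), z1 c c rfl,
      z0 c d (by omega), z0 d n (by omega), z0 d c (by omega), z1 d d rfl]
    simp only [qsym, qnum, qp_add hs, qp_sub hs, qp_neg, qp_zero, zero_sub, q6]
    have := q1 1
    have := q1 n
    have := q1 (v n)
    have := q1 (v c)
    have := q1 (v d)
    have hsq := qp_one s
    generalize qp s 1 = q at *
    generalize qp s (v n) = A at *
    generalize qp s (v c) = B at *
    generalize qp s (v d) = C at *
    generalize qp s n = K at *
    field_simp
    subst hsq
    ring

/-- For odd `N`, operators with the formula of `F_n` commute with the radius. -/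
theorem Generic.map_rad_y_lowering_middle (h : Generic N s) (ho : Odd N) {T : A N s →ₗ[ℂ] A N s}
    {n c d : ℕ} (hn : n = rk N) (hc : c = rk N + 1) (hd : d = rk N + 2)
    (hT : ∀ v, T (y N s v) =
      (br N s c (v c + 1) * qh s (2 * (-v n + v d) + 1)) • y N s (v + ez c - ez n) -
      (br N s d (v d + 1) * qp s (-v c + v d + 1)) • y N s (v + ez d - ez c))
    (v : ℕ → ℤ) : T (rad N s * y N s v) = rad N s * T (y N s v) := by
  have hN := rk_spec N
  have h2 := h.two_le
  have ho1 : odd01 N = 1 := by have := odd01_cases N; tauto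
  have hs := h.ne_zero
  have p1 : pr N n = d := by rw [pr]; omega
  have p2 : pr N c = c := by rw [pr]; omega
  have b1 : ∀ a, br N s n a = qsym s a := br_sym (by omega)
  have b2 : ∀ a, br N s d a = qsym s a := br_sym (by rw [pr]; omega)
  have b3 : ∀ a, br N s c a = qnum s a := by rw [hc]; exact br_mid ho
  have epn : ep N n = ez n + ez d := by rw [ep, p1]
  have epc : ep N c = ez c + ez c := by rw [ep, p2]
  have rn : ∀ v, radC N s n v = qp s ((n : ℤ) - 1 - v c) *
      (qsym s (v n + 1) * qsym s (v d + 1)) := by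
    intro v
    rw [radC_low (by omega) (by omega), p1, show n + 1 = c by omega, show d - 1 = c by omega,
      show SZ v c c = v c by simp [SZ]]
  have rc : ∀ v, radC N s c v =
      qp s n * (s / (1 + qp s 1) * (qnum s (v c + 1) * qnum s (v c + 2))) := by
    intro v
    rw [radC, if_neg (by omega), b3, b3, SZ_empty (by omega), kap, if_pos ho]
    congr 2
    · omega
    · rw [qp_one]
      field_simp
      ring
  have qh2 : ∀ a, qh s (2 * a) = qp s a := fun a => (qp_eq_qh s a).symm
  have qh3 : qh s 3 = qp s 1 * s := by rw [qp_one, qh]; norm_cast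
  have q1 := qp_ne hs
  have q2 : qp s 1 - (qp s 1)⁻¹ ≠ 0 := by rw [qp_one]; exact q_sub_ne hs h.root
  have q3 : 1 - qp s 1 ≠ 0 := by rw [qp_one]; exact one_sub_q_ne h.root
  have q5 : 1 + qp s 1 ≠ 0 := one_add_qp_ne hs h.root 1
  have q6 : qp s 2 = qp s 1 * qp s 1 := by rw [← qp_add hs]; norm_num
  have q4 : qp s 1 ^ 2 - 1 ≠ 0 := by
    intro h; apply q2; have := q1 1; field_simp; rw [h, mul_zero]
  have z1 : ∀ i j : ℕ, j = i → ez i j = 1 := fun i j h => by rw [h, ez_same]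
  have z0 : ∀ i j : ℕ, j ≠ i → ez i j = 0 := fun i j h => ez_of_ne h
  refine h.map_rad_y_of_two_terms (j₁ := c) (j₂ := n)
    (a := fun v => br N s c (v c + 1) * (qp s (-v n + v d) * s))
    (b := fun v => br N s d (v d + 1) * qp s (-v c + v d + 1))
    (α := ez c - ez n) (β := ez d - ez c) (by rw [half, Finset.mem_Icc]; omega)
    (by rw [half, Finset.mem_Icc]; omega) ?_ ?_ ?_ ?_ ?_ v
  · rw [epn, epc]; abel
  · intro v
    rw [hT, add_sub_assoc v, add_sub_assoc v, qh_add hs, qh2]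
    simp only [qh_one]
  · intro v j hj hne
    obtain ⟨hj1, hj⟩ := mem_half hj
    have p3 : pr N j = N + 1 - j := rfl
    by_cases hjk : j = c
    · rw [hjk]
      rw [rc, rc]
      simp only [Pi.add_apply, Pi.sub_apply, epc, b3,
        z0 n c (by omega), z0 c n (by omega), z1 c c rfl, z0 c d (by omega)]
      simp only [qnum, qp_add hs, qp_sub hs, qp_neg, qp_zero, q6]
      have := q1 1
      have := q1 (v n)
      have := q1 (v c)
      have := q1 (v d)
      field_simp
    · have hc' : j ≠ c := by omega
      simp only [Pi.add_apply, ep, z0 j n (by omega), z0 (pr N j) n (by omega), z0 j c (by omega),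
        z0 (pr N j) c (by omega), z0 j d (by omega), z0 (pr N j) d (by omega), add_zero]
      rw [radC_add hs (by simp only [Pi.sub_apply, z0 c j (by omega), z0 n j (by omega), sub_zero])
        (by simp only [Pi.sub_apply, z0 c (pr N j) (by omega), z0 n (pr N j) (by omega),
          sub_zero]),
        show SZ (ez c - ez n) (j + 1) (pr N j - 1) = 0 by
          simp only [SZ_sub, SZ_ez]; split_ifs <;> omega, neg_zero, qp_zero]
      ring
  · intro v j hj hne
    obtain ⟨hj1, hj⟩ := mem_half hj
    have p3 : pr N j = N + 1 - j := rfl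
    by_cases hjk : j = n
    · rw [hjk]
      rw [rn, rn]
      simp only [Pi.add_apply, Pi.sub_apply, epn, b2,
        z0 n c (by omega), z0 n d (by omega), z0 c n (by omega), z1 c c rfl, z0 c d (by omega),
        z0 d n (by omega), z0 d c (by omega), z1 d d rfl]
      simp only [qsym, qp_add hs, qp_sub hs, qp_neg, qp_zero, zero_sub]
      have := q1 1
      have := q1 (v n)
      have := q1 (v c)
      have := q1 (v d)
      field_simp
    · have hc' : j ≠ c := by omega
      simp only [Pi.add_apply, ep, z0 j c (by omega),
        z0 (pr N j) c (by omega), z0 j d (by omega), z0 (pr N j) d (by omega), add_zero]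
      rw [radC_add hs (by simp only [Pi.sub_apply, z0 d j (by omega), z0 c j (by omega), sub_zero])
        (by simp only [Pi.sub_apply, z0 d (pr N j) (by omega), z0 c (pr N j) (by omega),
          sub_zero]),
        show SZ (ez d - ez c) (j + 1) (pr N j - 1) = 0 by
          simp only [SZ_sub, SZ_ez]; split_ifs <;> omega, neg_zero, qp_zero]
      ring
  · intro v
    rw [rn, rn, rc, rc]
    simp only [Pi.add_apply, Pi.sub_apply, epn, epc, b2, b3,
      z1 n n rfl, z0 n c (by omega), z0 n d (by omega), z0 c n (by omega), z1 c c rfl,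
      z0 c d (by omega), z0 d n (by omega), z0 d c (by omega), z1 d d rfl]
    simp only [qsym, qnum, qp_add hs, qp_sub hs, qp_neg, qp_zero, zero_sub, q6]
    have := q1 1
    have := q1 n
    have := q1 (v n)
    have := q1 (v c)
    have := q1 (v d)
    have hsq := qp_one s
    generalize qp s 1 = q at *
    generalize qp s (v n) = A at *
    generalize qp s (v c) = B at *
    generalize qp s (v d) = C at *
    generalize qp s n = K at *
    field_simp
    subst hsq
    ring

theorem Generic.ext_y (h : Generic N s) {M : Type*} [AddCommGroup M] [Module ℂ M]
    {f g : A N s →ₗ[ℂ] M} (hfg : ∀ v, f (y N s v) = g (y N s v)) : f = g :=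
  h.ext_mono fun ν => by rw [h.mono_eq_y, map_smul, map_smul, hfg]

theorem Generic.map_rad (h : Generic N s) {T : A N s →ₗ[ℂ] A N s}
    (hT : ∀ v, T (rad N s * y N s v) = rad N s * T (y N s v)) (p : A N s) :
    T (rad N s * p) = rad N s * T p := by
  have : T ∘ₗ LinearMap.mulLeft ℂ (rad N s) = LinearMap.mulLeft ℂ (rad N s) ∘ₗ T :=
    h.ext_y fun v => hT v
  exact LinearMap.congr_fun this p

theorem Generic.Khat_rad (h : Generic N s) {k : ℕ} (hk : 1 ≤ k) (hk' : k ≤ N) (p : A N s) :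
    Khat N s k (rad N s * p) = rad N s * Khat N s k p := by
  refine h.map_rad (fun v => ?_) p
  have hN := rk_spec N
  rw [h.Khat_y hk hk', mul_smul_comm, h.rad_y', map_sum, Finset.smul_sum]
  refine Finset.sum_congr rfl fun j hj => ?_
  rw [map_smul, h.Khat_y hk hk', smul_comm]
  have e1 : ep N j k = ep N j (pr N k) := by
    have hk2 := pr_pr hk hk'
    obtain ⟨hj1, hj⟩ := mem_half hj
    have hj2 := pr_pr hj1 (show j ≤ N by omega)
    by_cases h1 : k = j
    · rw [ep, h1, Pi.add_apply, Pi.add_apply, ez_same, ez_same]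
      by_cases h2 : j = pr N j
      · rw [← h2, ez_same]
      · rw [ez_of_ne h2, ez_of_ne (Ne.symm h2), add_comm]
    · by_cases h2 : k = pr N j
      · rw [h2, hj2, ep, Pi.add_apply, Pi.add_apply, ez_same, ez_same, ez_of_ne (by omega),
          ez_of_ne (by omega), add_comm]
      · rw [ep_of_ne h1 h2, ep_of_ne (fun h3 => h2 (by rw [← h3, hk2]))
          (fun h3 => h1 (by rw [← hk2, h3, hj2]))]
  rw [Pi.add_apply, Pi.add_apply, e1, add_sub_add_right_eq_sub]

theorem Generic.E_rad (h : Generic N s) {k : ℕ} (hk : 1 ≤ k) (hk' : k ≤ rk N) (p : A N s) :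
    E N s k (rad N s * p) = rad N s * E N s k p := by
  refine h.map_rad (fun v => ?_) p
  have hN := rk_spec N
  have h2 := h.two_le
  rcases lt_or_eq_of_le hk' with hk' | rfl
  · exact h.map_rad_y_raising hk hk' (Or.inl ⟨rfl, rfl⟩) (h.E_y hk hk') v
  · rcases odd01_cases N with ⟨ho, h1⟩ | ⟨ho, h1⟩
    · exact h.map_rad_y_raising_middle ho rfl rfl rfl (h.E_y_odd ho) v
    · refine h.map_rad_y_raising (k := rk N - 1) (l := rk N + 1) (l' := rk N) (by omega) (by omega)
        (Or.inr (by simp only [pr]; omega)) (fun v => ?_) v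
      rw [h.E_y_even ho, show pr N (rk N - 1) = rk N + 2 by rw [pr]; omega]
      congr 4
      ring

theorem Generic.F_rad (h : Generic N s) {k : ℕ} (hk : 1 ≤ k) (hk' : k ≤ rk N) (p : A N s) :
    F N s k (rad N s * p) = rad N s * F N s k p := by
  refine h.map_rad (fun v => ?_) p
  have hN := rk_spec N
  have h2 := h.two_le
  rcases lt_or_eq_of_le hk' with hk' | rfl
  · exact h.map_rad_y_lowering hk hk' (Or.inl ⟨rfl, rfl⟩) (h.F_y hk hk') v
  · rcases odd01_cases N with ⟨ho, h1⟩ | ⟨ho, h1⟩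
    · exact h.map_rad_y_lowering_middle ho rfl rfl rfl (h.F_y_odd ho) v
    · refine h.map_rad_y_lowering (k := rk N - 1) (l := rk N + 1) (l' := rk N) (by omega) (by omega)
        (Or.inr (by simp only [pr]; omega)) (fun v => ?_) v
      rw [h.F_y_even ho, show pr N (rk N - 1) = rk N + 2 by rw [pr]; omega]
      congr 4
      ring

/-! ### Homogeneous polynomials and the action of the Laplace operator on `Q ^ k p` -/

theorem mono_mem_homog (ν : ℕ → ℕ) : mono N s ν ∈ homog N s (∑ i ∈ Finset.Icc 1 N, ν i) :=
  Submodule.subset_span ⟨ν, rfl, rfl⟩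

theorem y_mem_homog {v : ℕ → ℤ} {m : ℕ} (hv : SZ v 1 N = m) : y N s v ∈ homog N s m := by
  by_cases h : ∀ i, 0 ≤ v i
  · obtain ⟨ν, rfl⟩ := exists_up h
    rw [y_up]
    refine Submodule.smul_mem _ _ ?_
    have : ∑ i ∈ Finset.Icc 1 N, ν i = m := by
      simp only [SZ, up_apply] at hv
      exact_mod_cast hv
    rw [← this]
    exact mono_mem_homog ν
  · push Not at h
    obtain ⟨i, hi⟩ := h
    rw [y_neg hi]
    exact Submodule.zero_mem _

theorem Generic.homog_induction (h : Generic N s) {m : ℕ} {P : A N s → Prop}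
    (hy : ∀ v : ℕ → ℤ, (∀ i, 0 ≤ v i) → SZ v 1 N = m → P (y N s v)) (h0 : P 0)
    (hadd : ∀ a b, P a → P b → P (a + b)) (hsmul : ∀ (c : ℂ) a, P a → P (c • a)) {p : A N s}
    (hp : p ∈ homog N s m) : P p := by
  induction hp using Submodule.span_induction with
  | mem x hx =>
    obtain ⟨ν, hν, rfl⟩ := hx
    rw [h.mono_eq_y]
    refine hsmul _ _ (hy _ (fun i => by simp) ?_)
    rw [SZ, ← hν]
    simp
  | zero => exact h0
  | add a b _ _ ha hb => exact hadd a b ha hb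
  | smul c a _ ha => exact hsmul c a ha

theorem SZ_ep_total {j : ℕ} (hj : j ∈ half N) : SZ (ep N j) 1 N = 2 := by
  have hN := rk_spec N
  have := odd01_cases N
  obtain ⟨hj1, hj⟩ := mem_half hj
  have hpj : pr N j = N + 1 - j := rfl
  rw [SZ_ep, if_pos (by omega), if_pos (by omega)]
  norm_num

theorem Generic.rad_mem_homog (h : Generic N s) {m : ℕ} {p : A N s} (hp : p ∈ homog N s m) :
    rad N s * p ∈ homog N s (m + 2) := by
  refine h.homog_induction (P := fun p => rad N s * p ∈ homog N s (m + 2)) (fun v _ hv => ?_)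
    (by simp) (fun a b ha hb => by rw [mul_add]; exact add_mem ha hb)
    (fun c a ha => by rw [mul_smul_comm]; exact Submodule.smul_mem _ _ ha) hp
  rw [h.rad_y']
  refine Submodule.sum_mem _ fun j hj => Submodule.smul_mem _ _ (y_mem_homog ?_)
  rw [SZ_add, hv, SZ_ep_total hj]
  push_cast
  ring

theorem Generic.Lap_mem_homog (h : Generic N s) {m : ℕ} {p : A N s} (hp : p ∈ homog N s (m + 2)) :
    Lap N s p ∈ homog N s m := by
  refine h.homog_induction (P := fun p => Lap N s p ∈ homog N s m) (fun v _ hv => ?_)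
    (by simp) (fun a b ha hb => by rw [map_add]; exact add_mem ha hb)
    (fun c a ha => by rw [map_smul]; exact Submodule.smul_mem _ _ ha) hp
  rw [h.Lap_y']
  refine Submodule.smul_mem _ _ (Submodule.sum_mem _ fun j hj =>
    Submodule.smul_mem _ _ (y_mem_homog ?_))
  rw [SZ_sub, hv, SZ_ep_total hj]
  push_cast
  ring

theorem Generic.Lap_eq_zero (h : Generic N s) {m : ℕ} (hm : m < 2) {p : A N s}
    (hp : p ∈ homog N s m) : Lap N s p = 0 := by
  refine h.homog_induction (P := fun p => Lap N s p = 0) (fun v hv0 hv => ?_)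
    (by simp) (fun a b ha hb => by rw [map_add, ha, hb, add_zero])
    (fun c a ha => by rw [map_smul, ha, smul_zero]) hp
  rw [h.Lap_y']
  rw [Finset.sum_eq_zero, smul_zero]
  intro j hj
  have : ∃ i, (v - ep N j) i < 0 := by
    by_contra hcon
    push Not at hcon
    have h1 : 0 ≤ SZ (v - ep N j) 1 N := Finset.sum_nonneg fun i _ => hcon i
    rw [SZ_sub, SZ_ep_total hj, hv] at h1
    omega
  obtain ⟨i, hi⟩ := this
  rw [y_neg hi, smul_zero]

/-- The commutation relation of the Laplace operator and the radius, on homogeneous polynomials. -/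
theorem Generic.Lap_rad (h : Generic N s) {m : ℕ} {p : A N s} (hp : p ∈ homog N s m) :
    Lap N s (rad N s * p) = qp s 2 • (rad N s * Lap N s p) +
      (dd N s (rk N) * ((qp s (N + 2 * m) - 1) / (qp s 1 - qp s (-1)))) • p := by
  refine h.homog_induction (P := fun p => Lap N s (rad N s * p) = qp s 2 • (rad N s * Lap N s p) +
      (dd N s (rk N) * ((qp s (N + 2 * m) - 1) / (qp s 1 - qp s (-1)))) • p)
    (fun v _ hv => ?_) (by simp) (fun a b ha hb => ?_) (fun c a ha => ?_) hp
  · rw [h.Lap_rad_y, hv]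
  · rw [mul_add, map_add, ha, hb, map_add, mul_add]
    module
  · rw [mul_smul_comm, map_smul, ha, map_smul, mul_smul_comm]
    module

/-- The scalar in the action of the Laplace operator on `Q ^ k p`. -/
def lapScalar (N : ℕ) (s : ℂ) (m k : ℕ) : ℂ :=
  dd N s (rk N) ^ 2 * ((1 - qp s (2 * k)) / (1 - qp s 2)) *
    ((qp s (N + 2 * m + 2 * k - 2) - 1) / (qp s 1 - qp s (-1)))

theorem Generic.Q_mem_homog (h : Generic N s) {m : ℕ} {p : A N s} (hp : p ∈ homog N s m) :
    Q N s * p ∈ homog N s (m + 2) := by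
  rw [h.Q_eq, smul_mul_assoc]
  exact Submodule.smul_mem _ _ (h.rad_mem_homog hp)

theorem Generic.Q_pow_mem_homog (h : Generic N s) {m : ℕ} {p : A N s} (hp : p ∈ homog N s m)
    (k : ℕ) : Q N s ^ k * p ∈ homog N s (m + 2 * k) := by
  induction k with
  | zero => simpa using hp
  | succ k ih =>
    rw [pow_succ', mul_assoc, mul_add, ← add_assoc]
    exact h.Q_mem_homog ih

theorem Generic.one_sub_ne (h : Generic N s) {a : ℤ} (ha : a ≠ 0) : 1 - qp s a ≠ 0 :=
  sub_ne_zero.2 (qp_ne_one h.root ha).symm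

/-- The action of the Laplace operator on `Q ^ k p`. For `k = 0` the exponent `k - 1` is truncated,
  but
its scalar `lapScalar` is zero. -/
theorem Generic.Lap_Q_pow (h : Generic N s) {m : ℕ} {p : A N s} (hp : p ∈ homog N s m) (k : ℕ) :
    Lap N s (Q N s ^ k * p) = qp s (2 * k) • (Q N s ^ k * Lap N s p) +
      lapScalar N s m k • (Q N s ^ (k - 1) * p) := by
  have hs := h.ne_zero
  induction k with
  | zero => simp [lapScalar]
  | succ k ih =>
    rw [pow_succ', mul_assoc, h.Q_eq, smul_mul_assoc, map_smul, ← h.Q_eq,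
      h.Lap_rad (h.Q_pow_mem_homog hp k), ih, Nat.add_sub_cancel]
    have e1 : rad N s = (dd N s (rk N))⁻¹ • Q N s := by
      rw [h.Q_eq, smul_smul, inv_mul_cancel₀ (dd_ne N hs h.root _), one_smul]
    have e2 : lapScalar N s m k • (Q N s * (Q N s ^ (k - 1) * p)) =
        lapScalar N s m k • (Q N s ^ k * p) := by
      rcases k with _ | k
      · simp [lapScalar]
      · rw [Nat.add_sub_cancel, pow_succ', mul_assoc]
    have e3 : lapScalar N s m (k + 1) = qp s 2 * lapScalar N s m k + dd N s (rk N) ^ 2 *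
        ((qp s (N + 2 * (m + 2 * k : ℕ)) - 1) / (qp s 1 - qp s (-1))) := by
      have h1 := h.one_sub_ne (a := 2) (by norm_num)
      have h2 : qp s 1 - qp s (-1) ≠ 0 := by
        rw [qp_neg, qp_one]; exact q_sub_ne hs h.root
      have e4 : qp s (2 * (k + 1 : ℕ)) = qp s 2 * qp s (2 * k) := by
        rw [← qp_add hs]; congr 1; push_cast; ring
      have e5 : qp s (N + 2 * m + 2 * (k + 1 : ℕ) - 2) = qp s (N + 2 * m) * qp s (2 * k) := by
        rw [← qp_add hs]; congr 1; push_cast; ring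
      have e6 : qp s (N + 2 * m + 2 * k - 2) = qp s (N + 2 * m) * qp s (2 * k) / qp s 2 := by
        rw [← qp_add hs, ← qp_sub hs]
      have e7 : qp s (N + 2 * (m + 2 * k : ℕ)) = qp s (N + 2 * m) * qp s (2 * k) ^ 2 := by
        rw [sq, ← qp_add hs, ← qp_add hs]; congr 1; push_cast; ring
      have h3 := qp_ne hs 2
      rw [lapScalar, lapScalar, e4, e5, e6, e7]
      field_simp
      ring
    rw [e1, smul_mul_assoc, mul_add, mul_smul_comm, mul_smul_comm, e2, e3,
      show qp s (2 * (k + 1 : ℕ)) = qp s 2 * qp s (2 * k) by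
        rw [← qp_add hs]; congr 1; push_cast; ring, ← mul_assoc (Q N s), ← pow_succ']
    have h4 := dd_ne N hs h.root (rk N)
    match_scalars <;> field_simp

/-- This is where `q` must not be a root of unity. -/
theorem Generic.lapScalar_ne (h : Generic N s) (m : ℕ) {k : ℕ} (hk : k ≠ 0) :
    lapScalar N s m k ≠ 0 := by
  have hs := h.ne_zero
  have := h.four_le
  have h2 : qp s 1 - qp s (-1) ≠ 0 := by
    rw [qp_neg, qp_one]; exact q_sub_ne hs h.root
  exact mul_ne_zero (mul_ne_zero (pow_ne_zero _ (dd_ne N hs h.root _))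
    (div_ne_zero (h.one_sub_ne (by omega)) (h.one_sub_ne (by norm_num))))
    (div_ne_zero (sub_ne_zero.2 (qp_ne_one h.root (by omega))) h2)

/-! ### The projector onto harmonic polynomials -/

/-- If `Q ^ (k + 1) r` is harmonic, then `Q ^ k r = 0`. By `Generic.Lap_Q_pow`,
  `Q ^ k r` is a nonzero
multiple of `Q ^ (k + 1) Δ r`, and induction on the degree of `r` applies to `Δ r`. -/
theorem Generic.Q_pow_eq_zero (h : Generic N s) (d : ℕ) : ∀ (k : ℕ) (r : A N s),
    r ∈ homog N s d → Lap N s (Q N s ^ (k + 1) * r) = 0 → Q N s ^ k * r = 0 := by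
  induction d using Nat.strong_induction_on with
  | _ d ih =>
    intro k r hr hL
    have hB := h.lapScalar_ne d k.succ_ne_zero
    have h1 := h.Lap_Q_pow hr (k + 1)
    rw [hL, Nat.add_sub_cancel] at h1
    by_cases hd : d < 2
    · rw [h.Lap_eq_zero hd hr, mul_zero, smul_zero, zero_add] at h1
      exact (smul_eq_zero.1 h1.symm).resolve_left hB
    · obtain ⟨d, rfl⟩ : ∃ d', d = d' + 2 := ⟨d - 2, by omega⟩
      have hc := qp_ne h.ne_zero (2 * (k + 1 : ℕ))
      have h2 : Q N s ^ (k + 1) * Lap N s r =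
          (-(lapScalar N s (d + 2) (k + 1) / qp s (2 * (k + 1 : ℕ)))) • (Q N s ^ k * r) := by
        have h3 := eq_neg_of_add_eq_zero_left h1.symm
        rw [← inv_smul_smul₀ hc (Q N s ^ (k + 1) * Lap N s r), h3]
        module
      have h3 : Q N s ^ (k + 1) * Lap N s r = 0 := by
        refine ih d (by omega) (k + 1) _ (h.Lap_mem_homog hr) ?_
        rw [pow_succ', mul_assoc, h2, mul_smul_comm, ← mul_assoc, ← pow_succ', map_smul, hL,
          smul_zero]
      rw [h3, smul_zero, zero_add] at h1
      exact (smul_eq_zero.1 h1.symm).resolve_left hB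

/-- The projection onto the homogeneous component of degree `m`. -/
def comp (N : ℕ) (s : ℂ) (m : ℕ) : A N s →ₗ[ℂ] A N s :=
  linExt N s fun ν => if ∑ i ∈ Finset.Icc 1 N, ν i = m then mono N s ν else 0

theorem Generic.comp_mono (h : Generic N s) (m : ℕ) (ν : ℕ → ℕ) :
    comp N s m (mono N s ν) = if ∑ i ∈ Finset.Icc 1 N, ν i = m then mono N s ν else 0 := by
  refine h.linExt_mono (fun ν ν' hν => ?_) ν
  rw [mono_congr' hν, Finset.sum_congr rfl fun i hi =>
    hν i (Finset.mem_Icc.1 hi).1 (Finset.mem_Icc.1 hi).2]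

theorem Generic.comp_of_mem (h : Generic N s) {m k : ℕ} {p : A N s} (hp : p ∈ homog N s k) :
    comp N s m p = if k = m then p else 0 := by
  induction hp using Submodule.span_induction with
  | mem x hx =>
    obtain ⟨ν, hν, rfl⟩ := hx
    rw [h.comp_mono, hν]
  | zero => simp
  | add a b _ _ ha hb => rw [map_add, ha, hb]; split_ifs <;> simp
  | smul c a _ ha => rw [map_smul, ha]; split_ifs <;> simp

/-- The space `Q 𝒜_{m-2}`. -/
def qMul (N : ℕ) (s : ℂ) (m : ℕ) : Submodule ℂ (A N s) :=
  Submodule.span ℂ {p | ∃ k r, k + 2 = m ∧ r ∈ homog N s k ∧ p = Q N s * r}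

theorem mem_qMul {m : ℕ} {p : A N s} (hp : p ∈ qMul N s m) :
    p = 0 ∨ ∃ k r, k + 2 = m ∧ r ∈ homog N s k ∧ p = Q N s * r := by
  induction hp using Submodule.span_induction with
  | mem x hx => exact Or.inr hx
  | zero => exact Or.inl rfl
  | add a b _ _ ha hb =>
    rcases ha with rfl | ⟨k, r, hk, hr, rfl⟩
    · rwa [zero_add]
    · rcases hb with rfl | ⟨k', r', hk', hr', rfl⟩
      · rw [add_zero]; exact Or.inr ⟨k, r, hk, hr, rfl⟩
      · obtain rfl : k = k' := by omega
        exact Or.inr ⟨k, r + r', hk, add_mem hr hr', by rw [mul_add]⟩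
  | smul c a _ ha =>
    rcases ha with rfl | ⟨k, r, hk, hr, rfl⟩
    · rw [smul_zero]; exact Or.inl rfl
    · exact Or.inr ⟨k, c • r, hk, Submodule.smul_mem _ _ hr, by rw [mul_smul_comm]⟩

/-- Harmonic polynomials and multiples of `Q` are independent. -/
theorem Generic.harm_inf_qMul (h : Generic N s) {m : ℕ} {p : A N s} (hp : Lap N s p = 0)
    (hp' : p ∈ qMul N s m) : p = 0 := by
  rcases mem_qMul hp' with rfl | ⟨k, r, -, hr, rfl⟩
  · rfl
  · have := h.Q_pow_eq_zero k 0 r hr (by rwa [zero_add, pow_one])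
    rw [pow_zero, one_mul] at this
    rw [this, mul_zero]

theorem Generic.qMul_le (h : Generic N s) (m : ℕ) : qMul N s m ≤ homog N s m := by
  refine Submodule.span_le.2 ?_
  rintro _ ⟨k, r, rfl, hr, rfl⟩
  exact h.Q_mem_homog hr

/-- If `W ∩ U = 0`, there is an endomorphism that is the identity on `W` and zero on `U`. -/
theorem exists_projector {K V : Type*} [Field K] [AddCommGroup V] [Module K V]
    (W U : Submodule K V) (hd : ∀ p ∈ W, p ∈ U → p = 0) :
    ∃ P : V →ₗ[K] V, (∀ p ∈ W, P p = p) ∧ ∀ p ∈ U, P p = 0 := by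
  have hinj : LinearMap.ker (U.mkQ ∘ₗ W.subtype) = ⊥ :=
    LinearMap.ker_eq_bot'.2 fun p hp => Subtype.ext (hd p p.2 (by simpa using hp))
  obtain ⟨g, hg⟩ := LinearMap.exists_leftInverse_of_injective _ hinj
  refine ⟨W.subtype ∘ₗ g ∘ₗ U.mkQ, fun p hp => ?_, fun p hp => ?_⟩
  · exact congrArg Subtype.val (LinearMap.congr_fun hg ⟨p, hp⟩)
  · rw [LinearMap.comp_apply, LinearMap.comp_apply, Submodule.mkQ_apply,
      (Submodule.Quotient.mk_eq_zero U).2 hp, map_zero, map_zero]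

/-- The conditions that define `harmProj` can be satisfied. All of them are of the kind of
`exists_projector`, where `U` is the sum of `Q 𝒜_{m-2}` and of the other homogeneous components. -/
theorem Generic.harmProj_spec (h : Generic N s) (m : ℕ) :
    (∀ p ∈ harm N s m, harmProj N s m p = p) ∧
    (∀ k : ℕ, k + 2 = m → ∀ r ∈ homog N s k, harmProj N s m (Q N s * r) = 0) ∧
    (∀ k : ℕ, k ≠ m → ∀ r ∈ homog N s k, harmProj N s m r = 0) := by
  refine Classical.epsilon_spec (p := fun P : A N s →ₗ[ℂ] A N s =>
    (∀ p ∈ harm N s m, P p = p) ∧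
    (∀ k : ℕ, k + 2 = m → ∀ r ∈ homog N s k, P (Q N s * r) = 0) ∧
    (∀ k : ℕ, k ≠ m → ∀ r ∈ homog N s k, P r = 0)) ?_
  let U := qMul N s m ⊔ ⨆ k, ⨆ _ : k ≠ m, homog N s k
  have hU : U ≤ (qMul N s m).comap (comp N s m) := by
    refine sup_le (fun p hp => ?_) (iSup₂_le fun k hk p hp => ?_)
    · rwa [Submodule.mem_comap, h.comp_of_mem (h.qMul_le m hp), if_pos rfl]
    · rw [Submodule.mem_comap, h.comp_of_mem hp, if_neg hk]
      exact Submodule.zero_mem _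
  have hd : ∀ p ∈ harm N s m, p ∈ U → p = 0 := by
    intro p hp hp'
    have h2 := hU hp'
    rw [Submodule.mem_comap, h.comp_of_mem hp.1, if_pos rfl] at h2
    exact h.harm_inf_qMul hp.2 h2
  obtain ⟨P, hP, hP'⟩ := exists_projector (harm N s m) U hd
  exact ⟨P, hP,
    fun k hk r hr => hP' _ (le_sup_left (a := qMul N s m)
      (Submodule.subset_span ⟨k, r, hk, hr, rfl⟩)),
    fun k hk r hr => hP' _ (le_sup_right (a := qMul N s m)
      (le_iSup₂ (f := fun k (_ : k ≠ m) => homog N s k) k hk hr))⟩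

/-! ### The explicit form of the polynomials `φ` -/

/-- The multi-index of `x_1^a x_{1'}^b`. -/
def edge (N a b : ℕ) : ℕ → ℕ := a • e 1 + b • e (pr N 1)

theorem Generic.edge_one (h : Generic N s) (a b : ℕ) : edge N a b 1 = a := by
  have := h.four_le
  rw [edge]
  simp [e, show (1 : ℕ) ≠ pr N 1 by rw [pr]; omega]

theorem Generic.edge_last (h : Generic N s) (a b : ℕ) : edge N a b (pr N 1) = b := by
  have := h.four_le
  rw [edge]
  simp [e, show pr N 1 ≠ 1 by rw [pr]; omega]

theorem edge_of_ne {a b i : ℕ} (h1 : i ≠ 1) (h2 : i ≠ pr N 1) : edge N a b i = 0 := by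
  rw [edge]
  simp [e, h1, h2]

theorem Generic.mono_edge (h : Generic N s) (a b : ℕ) :
    mono N s (edge N a b) = X N s 1 ^ a * X N s (pr N 1) ^ b := by
  have h4 := h.four_le
  obtain ⟨M, hM⟩ : ∃ M, N = M + 2 := ⟨N - 2, by omega⟩
  have e1 : List.range N = 0 :: ((List.range M).map Nat.succ ++ [M + 1]) := by
    rw [hM, List.range_succ, List.range_succ_eq_map]; rfl
  have e2 : pr N 1 = M + 1 + 1 := by rw [pr]; omega
  rw [mono, e1, List.map_cons, List.map_append, List.prod_cons, List.prod_append, List.map_map,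
    List.prod_eq_one (l := List.map _ (List.range M)), one_mul, zero_add, h.edge_one]
  · rw [List.map_singleton, List.prod_singleton, ← e2, h.edge_last]
  · intro x hx
    rw [List.mem_map] at hx
    obtain ⟨i, hi, rfl⟩ := hx
    rw [List.mem_range] at hi
    rw [Function.comp_apply, edge_of_ne (by omega) (by omega), pow_zero]

theorem Generic.edge_degree (h : Generic N s) (a b : ℕ) :
    ∑ i ∈ Finset.Icc 1 N, edge N a b i = a + b := by
  have h4 := h.four_le
  rw [edge]
  simp only [Pi.add_apply, Pi.smul_apply, smul_eq_mul, Finset.sum_add_distrib, ← Finset.mul_sum, e,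
    Pi.single_apply, Finset.sum_ite_eq']
  rw [if_pos (by simp; omega), if_pos (by simp [pr]; omega), mul_one, mul_one]

theorem Generic.edge_mem_homog (h : Generic N s) (a b : ℕ) :
    X N s 1 ^ a * X N s (pr N 1) ^ b ∈ homog N s (a + b) := by
  rw [← h.mono_edge, ← h.edge_degree a b]
  exact mono_mem_homog _

theorem up_edge_apply_of_ne {a b i : ℕ} (h1 : i ≠ 1) (h2 : i ≠ pr N 1) :
    up (edge N a b) i = 0 := by
  rw [up_apply, edge_of_ne h1 h2]; rfl

theorem Generic.Lap_edge_zero (h : Generic N s) {a b : ℕ} (hab : a = 0 ∨ b = 0) :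
    Lap N s (X N s 1 ^ a * X N s (pr N 1) ^ b) = 0 := by
  have hN := rk_spec N
  have := odd01_cases N
  have h4 := h.four_le
  rw [← h.mono_edge, h.mono_eq_y, map_smul, h.Lap_y', Finset.sum_eq_zero, smul_zero, smul_zero]
  intro j hj
  obtain ⟨hj1, hj⟩ := mem_half hj
  have hpj : pr N j = N + 1 - j := rfl
  have hp1 : pr N 1 = N := by rw [pr]; omega
  by_cases h1 : j = 1
  · subst h1
    have h5 := ep_same (N := N) (j := 1) (by omega)
    rcases hab with rfl | rfl
    · rw [y_neg (i := 1), smul_zero]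
      rw [Pi.sub_apply, up_apply, h.edge_one, h5.1]; norm_num
    · rw [y_neg (i := pr N 1), smul_zero]
      rw [Pi.sub_apply, up_apply, h.edge_last, h5.2]; norm_num
  · rw [y_neg (i := j), smul_zero]
    rw [Pi.sub_apply, up_edge_apply_of_ne h1 (by omega)]
    rcases hj with hj | hj
    · rw [(ep_same hj.2).1]; norm_num
    · rw [ep_mid hj.2.2]; norm_num

/-- On `x_1^a x_{1'}^b` only the term of the Laplace operator with the index `1` is not zero. -/
theorem Generic.Lap_edge (h : Generic N s) (a b : ℕ) :
    Lap N s (X N s 1 ^ (a + 1) * X N s (pr N 1) ^ (b + 1)) =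
      (dd N s (rk N) * qp s (a + b + 1) * (qsym s (a + 1) * qsym s (b + 1))) •
        (X N s 1 ^ a * X N s (pr N 1) ^ b) := by
  have hN := rk_spec N
  have := odd01_cases N
  have h4 := h.four_le
  have hp1 : pr N 1 = N := by rw [pr]; omega
  have e1 : edge N (a + 1) (b + 1) = edge N a b + e 1 + e (pr N 1) := by
    rw [edge, edge, add_smul, add_smul, one_smul, one_smul]; abel
  have e2 : up (edge N (a + 1) (b + 1)) - ep N 1 = up (edge N a b) := by
    rw [e1, up_add, up_add, up_e, up_e, ep]; abel
  have e3 : wt N s (edge N (a + 1) (b + 1)) =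
      wt N s (edge N a b) * (qsym s (a + 1) * qsym s (b + 1)) := by
    rw [e1, wt_add_e (by omega) (by omega), wt_add_e (by omega) (by omega), h.edge_one,
      Pi.add_apply, h.edge_last, e, Pi.single_eq_of_ne (by omega), br_sym (by omega),
      br_sym (by rw [hp1, pr]; omega)]
    push_cast
    rw [add_zero]
    ring
  have e4 : SZ (up (edge N (a + 1) (b + 1))) 1 N = a + b + 2 := by
    have := h.edge_degree (a + 1) (b + 1)
    rw [SZ]
    simp only [up_apply]
    rw [← Nat.cast_sum, this]
    push_cast
    ring
  rw [← h.mono_edge, ← h.mono_edge, h.mono_eq_y, map_smul, h.Lap_y',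
    Finset.sum_eq_single_of_mem 1 (by rw [half, Finset.mem_Icc]; omega)]
  · rw [e2, h.mono_eq_y (edge N a b), lapC, if_pos (by omega), e3, e4, SZ_empty (by omega),
      SZ_empty (by omega), smul_smul, smul_smul, smul_smul]
    congr 1
    rw [show ((1 : ℕ) : ℤ) - 2 + (a + b + 2) + 0 + 0 = a + b + 1 by push_cast; ring]
    ring
  · intro j hj h1
    obtain ⟨hj1, hj⟩ := mem_half hj
    have hpj : pr N j = N + 1 - j := rfl
    rw [y_neg (i := j), smul_zero]
    rw [Pi.sub_apply, up_edge_apply_of_ne h1 (by omega)]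
    rcases hj with hj | hj
    · rw [(ep_same hj.2).1]; norm_num
    · rw [ep_mid hj.2.2]; norm_num

theorem poch_succ (a b : ℂ) (k : ℕ) : poch a b (k + 1) = poch a b k * (1 - a * b ^ k) :=
  Finset.prod_range_succ _ _

theorem coeffC_zero (a b : ℕ) : coeffC N s a b 0 = 1 := by simp [coeffC, poch]

theorem qp_mul_pow (hs : s ≠ 0) (a : ℤ) (k : ℕ) : qp s a * qp s 2 ^ k = qp s (a + 2 * k) := by
  rw [qp_add hs, qp, qp, qp, zpow_mul, zpow_natCast]

/-- Two consecutive coefficients of `φ`, with `a = a₀ + k + 1` and `b = b₀ + k + 1`. -/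
theorem coeffC_succ (hs : s ≠ 0) (a₀ b₀ k : ℕ) :
    coeffC N s (a₀ + k + 1) (b₀ + k + 1) (k + 1) = coeffC N s (a₀ + k + 1) (b₀ + k + 1) k *
      ((1 - qp s (-2 * (a₀ + 1))) * (1 - qp s (-2 * (b₀ + 1))) /
        ((1 - qp s (2 * k + 2)) * (1 - qp s (-(N + 2 * a₀ + 2 * b₀ + 2 * k)))) *
      (qh s (-2 * (rk N : ℤ) + 4 + eps2 N) / (1 + qp s ((N : ℤ) - 2)))) := by
  rw [coeffC, coeffC, poch_succ, poch_succ, poch_succ, poch_succ, qp_mul_pow hs, qp_mul_pow hs,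
    qp_mul_pow hs, qp_mul_pow hs, Nat.cast_succ k, mul_add _ (k : ℤ), mul_one, qh_add hs, pow_succ,
    show -2 * ((a₀ + k + 1 : ℕ) : ℤ) + 2 * k = -2 * (a₀ + 1) by push_cast; ring,
    show -2 * ((b₀ + k + 1 : ℕ) : ℤ) + 2 * k = -2 * (b₀ + 1) by push_cast; ring,
    show (2 : ℤ) + 2 * k = 2 * k + 2 by ring,
    show -(N : ℤ) - 2 * (((a₀ + k + 1 : ℕ) : ℤ) + (b₀ + k + 1 : ℕ)) + 4 + 2 * k =
      -(N + 2 * a₀ + 2 * b₀ + 2 * k) by push_cast; ring]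
  simp only [div_eq_mul_inv, mul_inv]
  ring

theorem dd_rk (hs : s ≠ 0) : dd N s (rk N) = qh s (-((N : ℤ) - 2)) * (1 + qp s (N - 2)) := by
  have hN := two_rk N
  rw [dd, show 2 * (rk N : ℤ) - 2 + odd01 N = N - 2 by omega, mul_add, mul_one, qp_eq_qh,
    ← qh_add hs, show -((N : ℤ) - 2) + 2 * (N - 2) = N - 2 by ring, add_comm]

/-- The factor of `coeffC` that depends on the parity of `N` compensates the normalization of `Q`. -/
theorem Generic.coeff_mul_dd (h : Generic N s) :
    qh s (-2 * (rk N : ℤ) + 4 + eps2 N) / (1 + qp s ((N : ℤ) - 2)) * dd N s (rk N) =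
      qp s (4 - N) := by
  have hs := h.ne_zero
  have h1 := one_add_qp_ne hs h.root (N - 2)
  have hN := two_rk N
  have e2 : -2 * (rk N : ℤ) + 4 + eps2 N = 6 - N := by
    rw [eps2]
    rcases odd01_cases N with ⟨ho, h1⟩ | ⟨ho, h1⟩
    · rw [if_pos ho]; omega
    · rw [if_neg ho]; omega
  rw [e2, dd_rk hs, mul_comm (qh s _) (1 + _), ← mul_assoc, div_mul_cancel₀ _ h1, ← qh_add hs,
    qp_eq_qh]
  congr 1
  ring

/-- The recursion for the coefficients of `φ` that makes this polynomial harmonic. -/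
theorem Generic.coeffC_rec (h : Generic N s) (a₀ b₀ k : ℕ) :
    coeffC N s (a₀ + k + 1) (b₀ + k + 1) (k + 1) * lapScalar N s (a₀ + b₀) (k + 1) +
      coeffC N s (a₀ + k + 1) (b₀ + k + 1) k * (qp s (2 * k) *
        (dd N s (rk N) * qp s (a₀ + b₀ + 1) * (qsym s (a₀ + 1) * qsym s (b₀ + 1)))) = 0 := by
  have hs := h.ne_zero
  have h4 := h.four_le
  rw [coeffC_succ hs, lapScalar]
  generalize coeffC N s (a₀ + k + 1) (b₀ + k + 1) k = C
  have e1 := h.coeff_mul_dd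
  generalize qh s (-2 * (rk N : ℤ) + 4 + eps2 N) / (1 + qp s ((N : ℤ) - 2)) = g at *
  have e2 : ((N : ℤ) + 2 * (a₀ + b₀ : ℕ) + 2 * (k + 1 : ℕ) - 2) = N + 2 * a₀ + 2 * b₀ + 2 * k := by
    push_cast; ring
  have n1 : 1 - qp s (2 * k + 2) ≠ 0 := h.one_sub_ne (by omega)
  have n2 : 1 - qp s (-(N + 2 * a₀ + 2 * b₀ + 2 * k)) ≠ 0 := h.one_sub_ne (by omega)
  have n3 : 1 - qp s 2 ≠ 0 := h.one_sub_ne (by norm_num)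
  have n4 : qp s 1 - (qp s 1)⁻¹ ≠ 0 := by rw [qp_one]; exact q_sub_ne hs h.root
  have e3 : qp s (4 - N) * qp s (N + 2 * a₀ + 2 * b₀ + 2 * k) =
      qp s (a₀ + 1) ^ 2 * qp s (b₀ + 1) ^ 2 * qp s (2 * k) := by
    simp only [sq, ← qp_add hs]
    congr 1
    ring
  have e4 : qp s (a₀ + b₀ + 1) = qp s (a₀ + 1) * qp s (b₀ + 1) / qp s 1 := by
    rw [← qp_add hs, ← qp_sub hs]; congr 1; ring
  have e5 : qp s (-2 * (a₀ + 1)) = (qp s (a₀ + 1) ^ 2)⁻¹ := by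
    rw [sq, ← qp_add hs, ← qp_neg]; congr 1; ring
  have e6 : qp s (-2 * (b₀ + 1)) = (qp s (b₀ + 1) ^ 2)⁻¹ := by
    rw [sq, ← qp_add hs, ← qp_neg]; congr 1; ring
  have e7 : qp s 2 = qp s 1 ^ 2 := by rw [sq, ← qp_add hs]; norm_num
  have e8 : (2 * ((k + 1 : ℕ) : ℤ)) = 2 * k + 2 := by push_cast; ring
  rw [e2, e4, e5, e6, e8]
  rw [qp_neg] at n2 ⊢
  rw [e7] at n3 ⊢
  simp only [qsym, qp_neg]
  have h1 := qp_ne hs 1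
  have h2 := qp_ne hs (a₀ + 1)
  have h3 := qp_ne hs (b₀ + 1)
  have h5 := qp_ne hs (N + 2 * a₀ + 2 * b₀ + 2 * k)
  generalize qp s (N + 2 * a₀ + 2 * b₀ + 2 * k) = M at *
  generalize qp s (a₀ + 1) = u at *
  generalize qp s (b₀ + 1) = w at *
  generalize qp s (2 * k + 2) = P at *
  generalize qp s (2 * k) = R at *
  generalize qp s (4 - N) = K at *
  generalize qp s 1 = q at *
  generalize dd N s (rk N) = d at *
  have n5 : M - 1 ≠ 0 := by
    intro h; apply n2; field_simp; rw [h, mul_zero]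
  have n6 : q ^ 2 - 1 ≠ 0 := by
    intro h; apply n4; field_simp; rw [h, mul_zero]
  have e9 : C * ((1 - (u ^ 2)⁻¹) * (1 - (w ^ 2)⁻¹) / ((1 - P) * (1 - M⁻¹)) * g) *
      (d ^ 2 * ((1 - P) / (1 - q ^ 2)) * ((M - 1) / (q - q⁻¹))) =
      C * (1 - (u ^ 2)⁻¹) * (1 - (w ^ 2)⁻¹) * d * (g * d * M) / ((1 - q ^ 2) * (q - q⁻¹)) := by
    have : 1 - M⁻¹ = (M - 1) / M := by field_simp
    rw [this]
    field_simp
  rw [e9, e1, e3]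
  have : 1 - q ^ 2 = - (q * (q - q⁻¹)) := by field_simp; ring
  rw [this]
  field_simp
  ring

/-- The explicit form of `φ` is harmonic: neighbouring terms cancel by `Generic.coeffC_rec`. -/
theorem Generic.Lap_explicit (h : Generic N s) (a b : ℕ) :
    Lap N s (∑ k ∈ Finset.range (min a b + 1), coeffC N s a b k • (Q N s ^ k *
      (X N s 1 ^ (a - k) * X N s (pr N 1) ^ (b - k)))) = 0 := by
  have e1 : ∀ k ∈ Finset.range (min a b + 1), Lap N s (coeffC N s a b k • (Q N s ^ k *
      (X N s 1 ^ (a - k) * X N s (pr N 1) ^ (b - k)))) =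
      (coeffC N s a b k * qp s (2 * k)) • (Q N s ^ k *
        Lap N s (X N s 1 ^ (a - k) * X N s (pr N 1) ^ (b - k))) +
      (coeffC N s a b k * lapScalar N s (a - k + (b - k)) k) • (Q N s ^ (k - 1) *
        (X N s 1 ^ (a - k) * X N s (pr N 1) ^ (b - k))) := by
    intro k _
    rw [map_smul, h.Lap_Q_pow (h.edge_mem_homog _ _), smul_add, smul_smul, smul_smul]
  rw [map_sum, Finset.sum_congr rfl e1, Finset.sum_add_distrib, Finset.sum_range_succ,
    Finset.sum_range_succ', h.Lap_edge_zero (by omega), mul_zero, smul_zero, add_zero]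
  have e2 : lapScalar N s (a - 0 + (b - 0)) 0 = 0 := by simp [lapScalar]
  rw [e2, mul_zero, zero_smul, add_zero, ← Finset.sum_add_distrib]
  refine Finset.sum_eq_zero fun k hk => ?_
  rw [Finset.mem_range] at hk
  obtain ⟨a₀, rfl⟩ : ∃ a₀, a = a₀ + k + 1 := ⟨a - k - 1, by omega⟩
  obtain ⟨b₀, rfl⟩ : ∃ b₀, b = b₀ + k + 1 := ⟨b - k - 1, by omega⟩
  rw [show a₀ + k + 1 - k = a₀ + 1 by omega, show b₀ + k + 1 - k = b₀ + 1 by omega,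
    show a₀ + k + 1 - (k + 1) = a₀ by omega, show b₀ + k + 1 - (k + 1) = b₀ by omega,
    h.Lap_edge, Nat.add_sub_cancel, mul_smul_comm, smul_smul, ← add_smul, mul_assoc, add_comm,
    h.coeffC_rec, zero_smul]

theorem Generic.Q_pow_edge_mem_homog (h : Generic N s) {a b k : ℕ} (hk : k ≤ min a b) :
    Q N s ^ k * (X N s 1 ^ (a - k) * X N s (pr N 1) ^ (b - k)) ∈ homog N s (a + b) := by
  have := h.Q_pow_mem_homog (h.edge_mem_homog (a - k) (b - k)) k
  rwa [show a - k + (b - k) + 2 * k = a + b by omega] at this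

/-- The explicit form lies in `ℋ_m` and differs from `x_1^a x_{1'}^b` by a multiple of `Q`. -/
theorem Generic.phi_eq (h : Generic N s) (a b : ℕ) : phi N s a b =
    ∑ k ∈ Finset.range (min a b + 1), coeffC N s a b k • (Q N s ^ k *
      (X N s 1 ^ (a - k) * X N s (pr N 1) ^ (b - k))) := by
  obtain ⟨h1, h2, -⟩ := h.harmProj_spec (a + b)
  have hm : ∑ k ∈ Finset.range (min a b + 1), coeffC N s a b k • (Q N s ^ k *
      (X N s 1 ^ (a - k) * X N s (pr N 1) ^ (b - k))) ∈ harm N s (a + b) :=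
    ⟨Submodule.sum_mem _ fun k hk => Submodule.smul_mem _ _
      (h.Q_pow_edge_mem_homog (by rw [Finset.mem_range] at hk; omega)), h.Lap_explicit a b⟩
  rw [← h1 _ hm, map_sum, Finset.sum_range_succ', Finset.sum_eq_zero, zero_add, phi, coeffC_zero,
    one_smul, pow_zero, one_mul, Nat.sub_zero, Nat.sub_zero]
  intro k hk
  rw [Finset.mem_range] at hk
  rw [map_smul, pow_succ', mul_assoc, h2 (a + b - 2) (by omega), smul_zero]
  have := h.Q_pow_mem_homog (h.edge_mem_homog (a - (k + 1)) (b - (k + 1))) k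
  rwa [show a - (k + 1) + (b - (k + 1)) + 2 * k = a + b - 2 by omega] at this

theorem Generic.phi_mem_harm (h : Generic N s) (a b : ℕ) : phi N s a b ∈ harm N s (a + b) := by
  rw [h.phi_eq]
  exact ⟨Submodule.sum_mem _ fun k hk => Submodule.smul_mem _ _
      (h.Q_pow_edge_mem_homog (by rw [Finset.mem_range] at hk; omega)), h.Lap_explicit a b⟩

theorem Generic.map_Q_pow (h : Generic N s) {T : A N s →ₗ[ℂ] A N s}
    (hT : ∀ p, T (rad N s * p) = rad N s * T p) (k : ℕ) (p : A N s) :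
    T (Q N s ^ k * p) = Q N s ^ k * T p := by
  induction k with
  | zero => simp
  | succ k ih =>
    rw [pow_succ', mul_assoc, mul_assoc, ← ih, h.Q_eq, smul_mul_assoc, smul_mul_assoc, map_smul, hT]

/-- Operators that lower exponents of the generators other than `x_1`,
  `x_{1'}` annihilate `x_1^a x_{1'}^b`. -/
theorem Generic.two_term_edge (h : Generic N s) {T : A N s →ₗ[ℂ] A N s}
    {a b : (ℕ → ℤ) → ℂ} {i j k l : ℕ}
    (hT : ∀ v, T (y N s v) = a v • y N s (v + ez i - ez j) - b v • y N s (v + ez k - ez l))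
    (hj : j ≠ 1 ∧ j ≠ pr N 1) (hij : i ≠ j) (hl : l ≠ 1 ∧ l ≠ pr N 1) (hkl : k ≠ l) (c d : ℕ) :
    T (X N s 1 ^ c * X N s (pr N 1) ^ d) = 0 := by
  rw [← h.mono_edge, h.mono_eq_y, map_smul, hT, y_neg (i := j), y_neg (i := l), smul_zero,
    smul_zero, sub_zero, smul_zero]
  · rw [Pi.sub_apply, Pi.add_apply, up_edge_apply_of_ne hl.1 hl.2, ez_same, ez_of_ne hkl.symm]
    norm_num
  · rw [Pi.sub_apply, Pi.add_apply, up_edge_apply_of_ne hj.1 hj.2, ez_same, ez_of_ne hij.symm]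
    norm_num

theorem Generic.isInvariant_edge (h : Generic N s) (a b : ℕ) :
    IsInvariant N s (X N s 1 ^ a * X N s (pr N 1) ^ b) := by
  intro i hi hi'
  have hN := rk_spec N
  have h4 := h.four_le
  have hp1 : pr N 1 = N := by rw [pr]; omega
  have hpi : pr N i = N + 1 - i := rfl
  have hpi' : pr N (i + 1) = N - i := by rw [pr]; omega
  refine ⟨?_, fun h5 => ⟨?_, ?_⟩⟩
  · rw [← h.mono_edge, h.Khat_mono (by omega) (by omega), edge_of_ne (by omega) (by omega),
      edge_of_ne (by omega) (by omega)]
    simp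
  · rcases lt_or_eq_of_le hi' with hk' | rfl
    · exact h.two_term_edge (h.E_y (by omega) hk') (by omega) (by omega) (by omega) (by omega) a b
    · rcases odd01_cases N with ⟨ho, h1⟩ | ⟨ho, h1⟩
      · exact h.two_term_edge (h.E_y_odd ho) (by omega) (by omega) (by omega) (by omega) a b
      · exact h.two_term_edge (h.E_y_even ho) (by omega) (by omega) (by omega) (by omega) a b
  · rcases lt_or_eq_of_le hi' with hk' | rfl
    · exact h.two_term_edge (h.F_y (by omega) hk') (by omega) (by omega) (by omega) (by omega) a b
    · rcases odd01_cases N with ⟨ho, h1⟩ | ⟨ho, h1⟩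
      · exact h.two_term_edge (h.F_y_odd ho) (by omega) (by omega) (by omega) (by omega) a b
      · exact h.two_term_edge (h.F_y_even ho) (by omega) (by omega) (by omega) (by omega) a b

theorem Generic.isInvariant_Q_pow (h : Generic N s) {p : A N s} (hp : IsInvariant N s p) (k : ℕ) :
    IsInvariant N s (Q N s ^ k * p) := by
  intro i hi hi'
  have hN := rk_spec N
  obtain ⟨h1, h2⟩ := hp i hi hi'
  refine ⟨?_, fun h5 => ⟨?_, ?_⟩⟩
  · rw [h.map_Q_pow (h.Khat_rad (by omega) (by omega)), h1]
  · rw [h.map_Q_pow (h.E_rad (by omega) hi'), (h2 h5).1, mul_zero]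
  · rw [h.map_Q_pow (h.F_rad (by omega) hi'), (h2 h5).2, mul_zero]

theorem isInvariant_zero : IsInvariant N s 0 := fun i _ _ => by simp

theorem IsInvariant.add {p r : A N s} (hp : IsInvariant N s p) (hr : IsInvariant N s r) :
    IsInvariant N s (p + r) := by
  intro i hi hi'
  obtain ⟨h1, h2⟩ := hp i hi hi'
  obtain ⟨h3, h4⟩ := hr i hi hi'
  refine ⟨by rw [map_add, h1, h3], fun h5 => ⟨?_, ?_⟩⟩
  · rw [map_add, (h2 h5).1, (h4 h5).1, add_zero]
  · rw [map_add, (h2 h5).2, (h4 h5).2, add_zero]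

theorem IsInvariant.smul {p : A N s} (hp : IsInvariant N s p) (c : ℂ) :
    IsInvariant N s (c • p) := by
  intro i hi hi'
  obtain ⟨h1, h2⟩ := hp i hi hi'
  refine ⟨by rw [map_smul, h1], fun h5 => ⟨?_, ?_⟩⟩
  · rw [map_smul, (h2 h5).1, smul_zero]
  · rw [map_smul, (h2 h5).2, smul_zero]

theorem isInvariant_sum {ι : Type*} {t : Finset ι} {f : ι → A N s}
    (hf : ∀ i ∈ t, IsInvariant N s (f i)) : IsInvariant N s (∑ i ∈ t, f i) :=
  Finset.sum_induction f (IsInvariant N s) (fun _ _ => IsInvariant.add) isInvariant_zero hf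

theorem Generic.isZonal_phi (h : Generic N s) (a b : ℕ) :
    IsZonal N s (a + b) (phi N s a b) := by
  refine ⟨h.phi_mem_harm a b, ?_⟩
  rw [h.phi_eq]
  exact isInvariant_sum fun k _ => (h.isInvariant_Q_pow (h.isInvariant_edge _ _) k).smul _

/-! ### The invariant functional on the quantum sphere -/

/-- Half of the degree of a monomial with a nonzero invariant integral. -/
def halfDeg (N : ℕ) (ν : ℕ → ℕ) : ℕ :=
  (∑ i ∈ Finset.Icc 1 (rk N), ν i) + if Odd N then ν (rk N + 1) / 2 else 0

/-- The condition on a multi-index for the invariant integral of the monomial not to vanish. -/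
def Balanced (N : ℕ) (ν : ℕ → ℕ) : Prop :=
  (∀ i ∈ Finset.Icc 1 (rk N), ν i = ν (pr N i)) ∧ (Odd N → Even (ν (rk N + 1)))

theorem haarValue_of_not_balanced {ν : ℕ → ℕ} (h : ¬ Balanced N ν) : haarValue N s ν = 0 :=
  if_neg h

theorem haarValue_of_balanced {ν : ℕ → ℕ} (h : Balanced N ν) : haarValue N s ν =
    ((∏ i ∈ Finset.Icc 1 (rk N), poch (qp s (-2)) (qp s (-2)) (ν i)) *
        poch (qp s (-1)) (qp s (-2)) (if Odd N then ν (rk N + 1) / 2 else 0) *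
        (1 + qp s 1) ^ (if Odd N then ν (rk N + 1) / 2 else 0)) /
      (qh s ((∑ i ∈ Finset.Icc 1 (rk N), rho2 N i * (ν i : ℤ)) +
          2 * (if Odd N then ν (rk N + 1) / 2 else 0 : ℕ)) *
        (1 + qp s ((N : ℤ) - 2)) ^ halfDeg N ν *
        poch (qp s (-(N : ℤ))) (qp s (-2)) (halfDeg N ν)) :=
  if_pos h

theorem qp_mul_neg_pow (hs : s ≠ 0) (a : ℤ) (k : ℕ) :
    qp s a * qp s (-2) ^ k = qp s (a - 2 * k) := by
  have : qp s (-2) ^ k = qp s (-2 * k) := by rw [qp, qp, zpow_mul, zpow_natCast]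
  rw [this, ← qp_add hs]
  congr 1

theorem add_pair_low {ν : ℕ → ℕ} {i j : ℕ} (hj : j ≤ rk N) (hi : i ≤ rk N) :
    (ν + e j + e (pr N j)) i = ν i + if i = j then 1 else 0 := by
  have hN := rk_spec N
  rw [Pi.add_apply, Pi.add_apply, e_of_ne (show i ≠ pr N j by rw [pr]; omega), add_zero, e,
    Pi.single_apply]

theorem add_pair_high {ν : ℕ → ℕ} {i j : ℕ} (hj : j ≤ rk N)
    (hi : i ≤ rk N) :
    (ν + e j + e (pr N j)) (pr N i) = ν (pr N i) + if i = j then 1 else 0 := by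
  have hN := rk_spec N
  rw [Pi.add_apply, Pi.add_apply, e_of_ne (show pr N i ≠ j by rw [pr]; omega), add_zero, e,
    Pi.single_apply]
  by_cases h : i = j
  · rw [if_pos h, if_pos (by rw [h])]
  · rw [if_neg h, if_neg (by simp only [pr]; omega)]

theorem add_pair_mid {ν : ℕ → ℕ} {j : ℕ} (hj : j ≤ rk N) (ho : Odd N) :
    (ν + e j + e (pr N j)) (rk N + 1) = ν (rk N + 1) := by
  have hN := rk_spec N
  have h1 : odd01 N = 1 := by have := odd01_cases N; tauto
  rw [Pi.add_apply, Pi.add_apply, e_of_ne (by omega), e_of_ne (by rw [pr]; omega), add_zero,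
    add_zero]

theorem add_mid_low {ν : ℕ → ℕ} {i : ℕ} (hi : i ≠ rk N + 1) :
    (ν + e (rk N + 1) + e (rk N + 1)) i = ν i := by
  rw [Pi.add_apply, Pi.add_apply, e_of_ne hi, add_zero, add_zero]

theorem add_mid_mid (ν : ℕ → ℕ) :
    (ν + e (rk N + 1) + e (rk N + 1)) (rk N + 1) = ν (rk N + 1) + 2 := by
  simp [e]

/-- The effect of two more factors `x_j`, `x_{j'}` on the value of the invariant functional. -/
theorem haarValue_add_pair (hs : s ≠ 0) {j : ℕ} (hj1 : 1 ≤ j) (hj : j ≤ rk N) (ν : ℕ → ℕ) :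
    haarValue N s (ν + e j + e (pr N j)) = haarValue N s ν *
      ((1 - qp s (-2 * (ν j + 1))) * (qh s (rho2 N j))⁻¹ *
        ((1 + qp s ((N : ℤ) - 2)) * (1 - qp s (-N - 2 * halfDeg N ν)))⁻¹) := by
  have hmem : j ∈ Finset.Icc 1 (rk N) := Finset.mem_Icc.2 ⟨hj1, hj⟩
  have hb : Balanced N (ν + e j + e (pr N j)) ↔ Balanced N ν := by
    refine and_congr (forall₂_congr fun i hi => ?_) (forall_congr' fun ho => ?_)
    · rw [Finset.mem_Icc] at hi
      rw [add_pair_low hj hi.2, add_pair_high hj hi.2, add_left_inj]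
    · rw [add_pair_mid hj ho]
  by_cases h : Balanced N ν
  swap
  · rw [haarValue_of_not_balanced h, haarValue_of_not_balanced (by rwa [hb]), zero_mul]
  have hm : (if Odd N then (ν + e j + e (pr N j)) (rk N + 1) / 2 else 0) =
      if Odd N then ν (rk N + 1) / 2 else 0 := by
    by_cases ho : Odd N
    · rw [add_pair_mid hj ho]
    · rw [if_neg ho, if_neg ho]
  have hd : halfDeg N (ν + e j + e (pr N j)) = halfDeg N ν + 1 := by
    rw [halfDeg, hm, halfDeg, Finset.sum_congr rfl fun i hi =>
      add_pair_low hj (Finset.mem_Icc.1 hi).2, Finset.sum_add_distrib, Finset.sum_ite_eq',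
      if_pos hmem]
    ring
  have hr : ∑ i ∈ Finset.Icc 1 (rk N), rho2 N i * (((ν + e j + e (pr N j)) i : ℕ) : ℤ) =
      ∑ i ∈ Finset.Icc 1 (rk N), rho2 N i * (ν i : ℤ) + rho2 N j := by
    have : ∀ i ∈ Finset.Icc 1 (rk N), rho2 N i * (((ν + e j + e (pr N j)) i : ℕ) : ℤ) =
        rho2 N i * (ν i : ℤ) + if i = j then rho2 N i else 0 := by
      intro i hi
      rw [add_pair_low hj (Finset.mem_Icc.1 hi).2]
      split_ifs <;> push_cast <;> ring
    rw [Finset.sum_congr rfl this, Finset.sum_add_distrib, Finset.sum_ite_eq', if_pos hmem]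
  have hp : ∏ i ∈ Finset.Icc 1 (rk N),
      poch (qp s (-2)) (qp s (-2)) ((ν + e j + e (pr N j)) i) =
      (∏ i ∈ Finset.Icc 1 (rk N), poch (qp s (-2)) (qp s (-2)) (ν i)) *
        (1 - qp s (-2 * (ν j + 1))) := by
    have : ∀ i ∈ Finset.Icc 1 (rk N), poch (qp s (-2)) (qp s (-2)) ((ν + e j + e (pr N j)) i) =
        poch (qp s (-2)) (qp s (-2)) (ν i) * if i = j then (1 - qp s (-2 * (ν i + 1))) else 1 := by
      intro i hi
      rw [add_pair_low hj (Finset.mem_Icc.1 hi).2]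
      split_ifs
      · rw [poch_succ, qp_mul_neg_pow hs]
        congr 3
        ring
      · rw [add_zero, mul_one]
    rw [Finset.prod_congr rfl this, Finset.prod_mul_distrib, Finset.prod_ite_eq', if_pos hmem]
  rw [haarValue_of_balanced h, haarValue_of_balanced (hb.2 h), hm, hd, hr, hp, poch_succ,
    qp_mul_neg_pow hs, pow_succ, add_right_comm, qh_add hs _ (rho2 N j)]
  simp only [div_eq_mul_inv, mul_inv]
  ring

/-- The effect of two more factors `x_{n+1}` on the value of the invariant functional. -/
theorem haarValue_add_mid (hs : s ≠ 0) (ho : Odd N) (ν : ℕ → ℕ) :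
    haarValue N s (ν + e (rk N + 1) + e (rk N + 1)) = haarValue N s ν *
      ((1 - qp s (-1 - 2 * (ν (rk N + 1) / 2 : ℕ))) * ((1 + qp s 1) * (qp s 1)⁻¹) *
        ((1 + qp s ((N : ℤ) - 2)) * (1 - qp s (-N - 2 * halfDeg N ν)))⁻¹) := by
  have hN := rk_spec N
  have h1 : odd01 N = 1 := by have := odd01_cases N; tauto
  have hlow : ∀ i ∈ Finset.Icc 1 (rk N), (ν + e (rk N + 1) + e (rk N + 1)) i = ν i := by
    intro i hi
    rw [Finset.mem_Icc] at hi
    exact add_mid_low (by omega)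
  have hb : Balanced N (ν + e (rk N + 1) + e (rk N + 1)) ↔ Balanced N ν := by
    refine and_congr (forall₂_congr fun i hi => ?_) (forall_congr' fun ho => ?_)
    · rw [hlow i hi]
      rw [Finset.mem_Icc] at hi
      rw [add_mid_low (by rw [pr]; omega)]
    · rw [add_mid_mid, Nat.even_add]
      simp
  by_cases h : Balanced N ν
  swap
  · rw [haarValue_of_not_balanced h, haarValue_of_not_balanced (by rwa [hb]), zero_mul]
  have hm : (ν (rk N + 1) + 2) / 2 = ν (rk N + 1) / 2 + 1 := by omega
  have hd : halfDeg N (ν + e (rk N + 1) + e (rk N + 1)) = halfDeg N ν + 1 := by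
    rw [halfDeg, halfDeg, Finset.sum_congr rfl hlow, if_pos ho, if_pos ho, add_mid_mid, hm]
    ring
  have hr : ∑ i ∈ Finset.Icc 1 (rk N), rho2 N i * (((ν + e (rk N + 1) + e (rk N + 1)) i : ℕ) : ℤ) =
      ∑ i ∈ Finset.Icc 1 (rk N), rho2 N i * (ν i : ℤ) :=
    Finset.sum_congr rfl fun i hi => by rw [hlow i hi]
  have hp : ∏ i ∈ Finset.Icc 1 (rk N),
      poch (qp s (-2)) (qp s (-2)) ((ν + e (rk N + 1) + e (rk N + 1)) i) =
      ∏ i ∈ Finset.Icc 1 (rk N), poch (qp s (-2)) (qp s (-2)) (ν i) :=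
    Finset.prod_congr rfl fun i hi => by rw [hlow i hi]
  rw [haarValue_of_balanced h, haarValue_of_balanced (hb.2 h), hd, hr, hp, if_pos ho, if_pos ho,
    add_mid_mid, hm, poch_succ, poch_succ, qp_mul_neg_pow hs, qp_mul_neg_pow hs, pow_succ, pow_succ,
    Nat.cast_succ, mul_add (2 : ℤ), ← add_assoc, qh_add hs _ (2 * 1), ← qp_eq_qh]
  simp only [div_eq_mul_inv, mul_inv]
  ring

theorem SZ_pair {v : ℕ → ℤ} {j : ℕ} (hj1 : 1 ≤ j) (hj : j ≤ rk N) :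
    SZ v j (pr N j) = v j + SZ v (j + 1) (pr N j - 1) + v (pr N j) := by
  have hN := rk_spec N
  have hpj : pr N j = N + 1 - j := rfl
  rw [SZ_first (by omega)]
  have := SZ_last (v := v) (a := j + 1) (b := pr N j - 1) (by omega)
  rw [Nat.sub_add_cancel (by omega)] at this
  rw [this, add_assoc]

theorem Balanced.SZ_eq {ν : ℕ → ℕ} (h : Balanced N ν) {j : ℕ} (hj1 : 1 ≤ j) (hj : j ≤ rk N + 1) :
    SZ (up ν) j (pr N j) =
      2 * (SZ (up ν) j (rk N) + (if Odd N then ν (rk N + 1) / 2 else 0 : ℕ)) := by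
  have hN := rk_spec N
  have hpj : pr N j = N + 1 - j := rfl
  induction hj using Nat.decreasingInduction with
  | self =>
    rw [SZ_empty (b := rk N) (by omega)]
    rcases odd01_cases N with ⟨ho, h1⟩ | ⟨ho, h1⟩
    · have := h.2 ho
      rw [show pr N (rk N + 1) = rk N + 1 by rw [pr]; omega, if_pos ho]
      rw [Nat.even_iff] at this
      simp only [SZ, Finset.Icc_self, Finset.sum_singleton, up_apply]
      omega
    · rw [if_neg ho, SZ_empty (by omega)]
      simp
  | of_succ j hj ih =>
    have h1 := h.1 j (Finset.mem_Icc.2 ⟨hj1, by omega⟩)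
    rw [SZ_pair hj1 (by omega), show pr N j - 1 = pr N (j + 1) by simp only [pr]; omega,
      ih (by omega) rfl, SZ_first (a := j) (b := rk N) (by omega), up_apply, up_apply, ← h1]
    ring

/-- The values of the invariant functional are compatible with `Q = 1`: the sum over the terms of
`Q x^ν` telescopes. -/
theorem Generic.haar_telescope (h : Generic N s) (ν : ℕ → ℕ) :
    dd N s (rk N) * (∑ j ∈ Finset.Icc 1 (rk N),
      qp s ((j : ℤ) - 1 - SZ (up ν) (j + 1) (pr N j - 1)) *
        haarValue N s (ν + e j + e (pr N j)) +
      if Odd N then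
        qp s (rk N) * kap N s * haarValue N s (ν + e (rk N + 1) + e (rk N + 1)) else 0) =
    haarValue N s ν := by
  have hs := h.ne_zero
  have hN := two_rk N
  by_cases hb : Balanced N ν
  swap
  · rw [Finset.sum_congr rfl fun j hj => by
      rw [haarValue_add_pair hs (Finset.mem_Icc.1 hj).1 (Finset.mem_Icc.1 hj).2,
        haarValue_of_not_balanced hb, zero_mul, mul_zero], Finset.sum_const_zero]
    by_cases ho : Odd N
    · rw [haarValue_add_mid hs ho, haarValue_of_not_balanced hb]; simp
    · rw [if_neg ho, haarValue_of_not_balanced hb]; simp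
  let r : ℕ := if Odd N then ν (rk N + 1) / 2 else 0
  let f : ℕ → ℂ := fun j => qh s (4 * j - 6 - N - 4 * (SZ (up ν) j (rk N) + r))
  have h1 := one_add_qp_ne hs h.root (N - 2)
  have h2 : 1 - qp s (-(N : ℤ) - 2 * halfDeg N ν) ≠ 0 :=
    h.one_sub_ne (by have := h.four_le; omega)
  have e1 : ∀ j ∈ Finset.Icc 1 (rk N), qp s ((j : ℤ) - 1 - SZ (up ν) (j + 1) (pr N j - 1)) *
        haarValue N s (ν + e j + e (pr N j)) = haarValue N s ν *
        ((1 + qp s ((N : ℤ) - 2)) * (1 - qp s (-N - 2 * halfDeg N ν)))⁻¹ * (f (j + 1) - f j) := by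
    intro j hj
    rw [Finset.mem_Icc] at hj
    have h3 : pr N j - 1 = pr N (j + 1) := by simp only [pr]; omega
    have h4 : SZ (up ν) j (rk N) = ν j + SZ (up ν) (j + 1) (rk N) := SZ_first hj.2
    have h5 : f (j + 1) = qp s ((j : ℤ) - 1 - 2 * (SZ (up ν) (j + 1) (rk N) + r)) *
        (qh s (rho2 N j))⁻¹ := by
      rw [qp_eq_qh, ← qh_neg, ← qh_add hs, rho2, if_pos hj.2]
      simp only [f]
      congr 1
      push_cast
      ring
    have h6 : f j = f (j + 1) * qp s (-2 * (ν j + 1)) := by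
      rw [qp_eq_qh, ← qh_add hs]
      simp only [f]
      rw [h4]
      congr 1
      push_cast
      ring
    rw [haarValue_add_pair hs hj.1 hj.2, h3, hb.SZ_eq (by omega) (by omega), h6, h5]
    ring
  have e2 := Finset.sum_Ico_sub f (show 1 ≤ rk N + 1 by omega)
  have e3 : f 1 = qh s (N - 2) * qp s (-N - 2 * halfDeg N ν) := by
    rw [qp_eq_qh, ← qh_add hs]
    simp only [f, halfDeg, SZ, up_apply, r]
    congr 1
    push_cast
    ring
  have e4 : f (rk N + 1) = qh s (4 * rk N - 2 - N - 4 * r) := by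
    simp only [f]
    rw [SZ_empty (by omega)]
    congr 1
    push_cast
    ring
  have e5 : (if Odd N then qp s (rk N) * kap N s * haarValue N s (ν + e (rk N + 1) + e (rk N + 1))
      else 0) = haarValue N s ν *
        ((1 + qp s ((N : ℤ) - 2)) * (1 - qp s (-N - 2 * halfDeg N ν)))⁻¹ *
        (qh s (N - 2) - f (rk N + 1)) := by
    rw [e4]
    rcases odd01_cases N with ⟨ho, h7⟩ | ⟨ho, h7⟩
    · have h8 : kap N s * ((1 + qp s 1) * (qp s 1)⁻¹) = qh s (-1) := by
        have h13 := qh_add_qh_neg_ne hs h.root 1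
        rw [qh_neg, qh_one] at h13
        rw [kap, if_pos ho, qh_neg, qh_one, qp_one, inv_mul_eq_iff_eq_mul₀ h13]
        field_simp
        ring
      have h9 : qh s (N - 2) = qp s (rk N) * qh s (-1) := by
        rw [qp_eq_qh, ← qh_add hs]
        congr 1
        omega
      have h10 : qh s (4 * rk N - 2 - N - 4 * r) = qp s (rk N) * qh s (-1) *
          qp s (-1 - 2 * (ν (rk N + 1) / 2 : ℕ)) := by
        have : r = ν (rk N + 1) / 2 := if_pos ho
        rw [qp_eq_qh, qp_eq_qh, ← qh_add hs, ← qh_add hs, this]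
        congr 1
        omega
      rw [if_pos ho, haarValue_add_mid hs ho, h9, h10, ← h8]
      ring
    · have : r = 0 := if_neg ho
      rw [if_neg ho, this, show (4 * (rk N : ℤ) - 2 - N - 4 * (0 : ℕ)) = N - 2 by push_cast; omega,
        sub_self, mul_zero]
  rw [Finset.sum_congr rfl e1, ← Finset.mul_sum, show Finset.Icc 1 (rk N) =
    Finset.Ico 1 (rk N + 1) by ext; simp only [Finset.mem_Icc, Finset.mem_Ico]; omega, e2, e5,
    e3, dd_rk hs, qh_neg]
  have h11 := qh_ne hs (N - 2)
  field_simp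
  ring

theorem haarValue_congr {ν ν' : ℕ → ℕ} (hN : 1 ≤ N) (h : ∀ i, 1 ≤ i → i ≤ N → ν i = ν' i) :
    haarValue N s ν = haarValue N s ν' := by
  have hN := rk_spec N
  have := odd01_cases N
  have h1 : ∀ i ∈ Finset.Icc 1 (rk N), ν i = ν' i := fun i hi => by
    rw [Finset.mem_Icc] at hi
    exact h i hi.1 (by omega)
  have h2 : (if Odd N then ν (rk N + 1) / 2 else 0) = if Odd N then ν' (rk N + 1) / 2 else 0 := by
    by_cases ho : Odd N
    · rw [h _ (by omega) (by have : odd01 N = 1 := by tauto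
                             omega)]
    · rw [if_neg ho, if_neg ho]
  have hb : Balanced N ν ↔ Balanced N ν' := by
    refine and_congr (forall₂_congr fun i hi => ?_) (forall_congr' fun ho => ?_)
    · rw [h1 i hi]
      rw [Finset.mem_Icc] at hi
      rw [h (pr N i) (by rw [pr]; omega) (by rw [pr]; omega)]
    · rw [h _ (by omega) (by have : odd01 N = 1 := by tauto
                             omega)]
  have hd : halfDeg N ν = halfDeg N ν' := by rw [halfDeg, halfDeg, h2, Finset.sum_congr rfl h1]
  by_cases hν : Balanced N ν
  · rw [haarValue_of_balanced hν, haarValue_of_balanced (hb.1 hν), h2, hd,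
      Finset.prod_congr rfl fun i hi => by rw [h1 i hi],
      Finset.sum_congr rfl fun i hi => by rw [h1 i hi]]
  · rw [haarValue_of_not_balanced hν, haarValue_of_not_balanced (by rwa [← hb])]

/-- The radius is central. -/
theorem Generic.rad_comm (h : Generic N s) (a : A N s) : rad N s * a = a * rad N s := by
  have hq : s ^ 2 ≠ 0 := pow_ne_zero 2 h.ne_zero
  have hX := X_rels (N := N) h.ne_zero h.root
  induction a using algebra_induction with
  | h₀ c => exact (Algebra.commutes c _).symm
  | hX i hi hi' =>
    rcases idx_cases hi hi' with ⟨a, ha, rfl⟩ | ⟨ho, rfl⟩ | ⟨a, ha, rfl⟩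
    · exact hX.radius_u hq le_rfl ha
    · have hm : mid N (X N s) = X N s (rk N + 1) := if_pos ho
      rw [← hm]
      exact hX.radius_z hq le_rfl
    · exact hX.radius_w' hq le_rfl ha
  | hmul a b ha hb => rw [← mul_assoc, ha, mul_assoc, hb, mul_assoc]
  | hadd a b ha hb => rw [mul_add, ha, hb, add_mul]

theorem Generic.Q_comm (h : Generic N s) (a : A N s) : Q N s * a = a * Q N s := by
  rw [h.Q_eq, smul_mul_assoc, h.rad_comm, mul_smul_comm]

/-- The relation that identifies two elements if all linear functionals `p ↦ H (a p b)` agree on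
them. -/
def functionalCon {R : Type*} [Ring R] (H : R →+ ℂ) : RingCon R where
  r x y := ∀ a b, H (a * x * b) = H (a * y * b)
  iseqv := ⟨fun _ _ _ => rfl, fun h a b => (h a b).symm, fun h h' a b => (h a b).trans (h' a b)⟩
  mul' {w x y z} h h' a b := by
    rw [← mul_assoc, mul_assoc (a * w), h, ← mul_assoc, h', mul_assoc a x z]
  add' {w x y z} h h' a b := by
    rw [mul_add, add_mul, map_add, h, h', mul_add, add_mul, map_add]

/-- A linear functional that is constant on the fibres of a surjective homomorphism factors through it. -/
theorem exists_factor {R R' : Type*} [Semiring R] [Algebra ℂ R] [Semiring R'] [Algebra ℂ R']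
    (f : R →ₐ[ℂ] R') (hf : Function.Surjective f) (g : R →ₗ[ℂ] ℂ)
    (hg : ∀ v w, f v = f w → g v = g w) : ∃ k : R' →ₗ[ℂ] ℂ, ∀ v, k (f v) = g v := by
  have hs := Function.surjInv_eq hf
  refine ⟨⟨⟨fun w => g (Function.surjInv hf w), fun v w => ?_⟩, fun c v => ?_⟩, fun v => ?_⟩
  · rw [← map_add]
    exact hg _ _ (by rw [map_add, hs, hs, hs])
  · rw [RingHom.id_apply, ← map_smul]
    exact hg _ _ (by rw [map_smul, hs, hs])
  · exact hg _ _ (hs _)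

/-- The invariant functional is well defined. The functional `H` on `𝒜` with the prescribed values
satisfies `H (Q p) = H p` by `Generic.haar_telescope`, and `Q` is central,
  so that `H` vanishes on the
two-sided ideal generated by `Q - 1`. -/
theorem Generic.haar_spec (h : Generic N s) (ν : ℕ → ℕ) :
    haar N s (τ N s (mono N s ν)) = haarValue N s ν := by
  have h2 := h.two_le
  have h4 := h.four_le
  refine Classical.epsilon_spec (p := fun H : Sphere N s →ₗ[ℂ] ℂ =>
    ∀ ν : ℕ → ℕ, H (τ N s (mono N s ν)) = haarValue N s ν) ?_ ν
  obtain ⟨H, hH⟩ := exists_linear (N := N) h.ne_zero h.root (by omega) (M := ℂ)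
    (f := haarValue N s) (fun ν ν' hν => haarValue_congr (by omega) fun i hi hi' =>
      hν i (Finset.mem_Icc.2 ⟨hi, hi'⟩))
  have hQ : ∀ p, H (Q N s * p) = H p := by
    have : H ∘ₗ LinearMap.mulLeft ℂ (Q N s) = H := by
      refine h.ext_mono fun ν => ?_
      rw [LinearMap.comp_apply, LinearMap.mulLeft_apply, h.Q_eq, smul_mul_assoc, h.rad_mono,
        map_smul, map_add, map_sum, hH, ← h.haar_telescope ν, smul_eq_mul]
      congr 2
      · refine Finset.sum_congr rfl fun j _ => ?_
        rw [map_smul, hH, smul_eq_mul]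
      · split_ifs
        · rw [map_smul, hH, smul_eq_mul]
        · exact map_zero _
    exact fun p => LinearMap.congr_fun this p
  let f : Sphere N s →+* (functionalCon (H : A N s →+ ℂ)).Quotient :=
    RingQuot.lift ⟨(functionalCon (H : A N s →+ ℂ)).mk', by
      rintro _ _ ⟨⟩
      refine (RingCon.eq _).2 fun a b => ?_
      change H _ = H _
      rw [← h.Q_comm, mul_one, mul_assoc, hQ]⟩
  have hf : ∀ p, f (τ N s p) = (functionalCon (H : A N s →+ ℂ)).mk' p := by
    intro p
    have h5 : τ N s p = RingQuot.mkRingHom (SphereRel N s) p :=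
      RingHom.congr_fun (RingQuot.mkAlgHom_coe ℂ (SphereRel N s)) p
    rw [h5]
    exact RingQuot.lift_mkRingHom_apply _ _ _
  obtain ⟨k, hk⟩ := exists_factor (τ N s) (RingQuot.mkAlgHom_surjective ℂ _) H (by
    intro p r hp
    have h6 := (RingCon.eq _).1 (show (functionalCon (H : A N s →+ ℂ)).mk' p =
      (functionalCon (H : A N s →+ ℂ)).mk' r by rw [← hf, ← hf, hp]) 1 1
    simpa using h6)
  exact ⟨k, fun ν => by rw [← hH]; exact hk _⟩

/-! ### The `*`-operation -/

section Twist

variable {R R' : Type*} [Ring R] [Algebra ℂ R] [Ring R'] [Algebra ℂ R'] {q κ : ℂ} {z : R}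
  {u w : ℕ → R} {T : ℕ}

/-- A semilinear anti-homomorphism that exchanges the two generators of each pair maps the radius to
the radius. -/
theorem radius_anti {σ : ℂ →+* ℂ} (o : R →+ R') (hmul : ∀ a b, o (a * b) = o b * o a)
    (hsmul : ∀ (c : ℂ) a, o (c • a) = σ c • o a) (hq : σ q = q) (hκ : σ κ = κ) {g : ℕ → ℂ}
    (hg : ∀ i, g i ≠ 0) (t : ℕ) :
    radius q κ (o z) (fun i => g i • o (w i)) (fun i => (g i)⁻¹ • o (u i)) t =
      o (radius q κ z u w t) := by
  induction t with
  | zero => rw [radius, radius, hsmul, hmul, hκ]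
  | succ t ih =>
    rw [radius, radius, ih, map_add, hsmul, hmul, hq, smul_mul_smul_comm, mul_inv_cancel₀ (hg t),
      one_smul]

/-- A semilinear anti-homomorphism that exchanges the two generators of each pair preserves the
relations. -/
theorem PairRels.anti (h : PairRels q κ z u w T) {σ : ℂ →+* ℂ} (o : R →+ R')
    (hmul : ∀ a b, o (a * b) = o b * o a) (hsmul : ∀ (c : ℂ) a, o (c • a) = σ c • o a)
    (hq : σ q = q) (hκ : σ κ = κ) {g : ℕ → ℂ} (hg : ∀ i, g i ≠ 0) :
    PairRels q κ (o z) (fun i => g i • o (w i)) (fun i => (g i)⁻¹ • o (u i)) T where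
  uu i j hij hj := by
    rw [smul_mul_smul_comm, smul_mul_smul_comm, ← hmul, ← hmul, h.ww i j hij hj, hsmul, hq,
      smul_comm, mul_comm]
  ww i j hij hj := by
    rw [smul_mul_smul_comm, smul_mul_smul_comm, ← hmul, ← hmul, h.uu i j hij hj, hsmul, hq,
      smul_comm, mul_comm]
  uw i j hi hj hij := by
    rw [smul_mul_smul_comm, smul_mul_smul_comm, ← hmul, ← hmul, h.uw j i hj hi hij.symm, hsmul, hq,
      smul_comm, mul_comm]
  uz i hi := by
    rw [smul_mul_assoc, mul_smul_comm, ← hmul, ← hmul, h.zw i hi, hsmul, hq, smul_comm]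
  zw i hi := by
    rw [smul_mul_assoc, mul_smul_comm, ← hmul, ← hmul, h.uz i hi, hsmul, hq, smul_comm]
  wu i hi := by
    rw [radius_anti o hmul hsmul hq hκ hg, smul_mul_smul_comm, smul_mul_smul_comm, ← hmul, ← hmul,
      h.wu i hi, map_add, hsmul, mul_inv_cancel₀ (hg i), inv_mul_cancel₀ (hg i), one_smul, one_smul,
      map_sub, map_inv₀, hq]

theorem radius_scale {g : ℕ → ℂ} (hg : ∀ i, g i ≠ 0) (t : ℕ) :
    radius q κ z (fun i => g i • u i) (fun i => (g i)⁻¹ • w i) t = radius q κ z u w t := by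
  induction t with
  | zero => rfl
  | succ t ih => rw [radius, radius, ih, smul_mul_smul_comm, mul_inv_cancel₀ (hg t), one_smul]

/-- The relations are invariant under the maximal torus. -/
theorem PairRels.scale (h : PairRels q κ z u w T) {g : ℕ → ℂ} (hg : ∀ i, g i ≠ 0) :
    PairRels q κ z (fun i => g i • u i) (fun i => (g i)⁻¹ • w i) T where
  uu i j hij hj := by
    rw [smul_mul_smul_comm, smul_mul_smul_comm, h.uu i j hij hj, smul_comm, mul_comm]
  ww i j hij hj := by
    rw [smul_mul_smul_comm, smul_mul_smul_comm, h.ww i j hij hj, smul_comm, mul_comm]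
  uw i j hi hj hij := by
    rw [smul_mul_smul_comm, smul_mul_smul_comm, h.uw i j hi hj hij, smul_comm, mul_comm]
  uz i hi := by rw [smul_mul_assoc, mul_smul_comm, h.uz i hi, smul_comm]
  zw i hi := by rw [smul_mul_assoc, mul_smul_comm, h.zw i hi, smul_comm]
  wu i hi := by
    rw [radius_scale hg, smul_mul_smul_comm, smul_mul_smul_comm, h.wu i hi,
      mul_inv_cancel₀ (hg i), inv_mul_cancel₀ (hg i), one_smul, one_smul]

/-- The opposite ring, with the action of the scalars twisted by `σ`. -/
def Twist (_σ : ℂ →+* ℂ) (R : Type*) : Type _ := Rᵐᵒᵖ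

variable (σ : ℂ →+* ℂ)

instance : Ring (Twist σ R) := inferInstanceAs (Ring Rᵐᵒᵖ)

instance : Algebra ℂ (Twist σ R) :=
  RingHom.toAlgebra' (((algebraMap ℂ Rᵐᵒᵖ).comp σ : ℂ →+* Rᵐᵒᵖ) : ℂ →+* Twist σ R)
    fun c x => Algebra.commutes (A := Rᵐᵒᵖ) (σ c) x

/-- The passage to the twisted opposite ring. -/
def toTwist : R ≃+ Twist σ R := MulOpposite.opAddEquiv

theorem toTwist_mul {R : Type*} [Ring R] (σ : ℂ →+* ℂ) (a b : R) :
    toTwist σ (a * b) = toTwist σ b * toTwist σ a := rfl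

theorem algebraMap_twist (c : ℂ) :
    algebraMap ℂ (Twist σ R) c = toTwist σ (algebraMap ℂ R (σ c)) := rfl

theorem toTwist_smul_map (c : ℂ) (a : R) : toTwist σ (σ c • a) = c • toTwist σ a := by
  rw [Algebra.smul_def, Algebra.smul_def, algebraMap_twist, ← toTwist_mul, Algebra.commutes]

end Twist

theorem rho2_pr {i : ℕ} (hi : 1 ≤ i) (hi' : i ≤ N) : rho2 N (pr N i) = -rho2 N i := by
  have hN := rk_spec N
  rcases idx_cases hi hi' with ⟨a, ha, rfl⟩ | ⟨ho, rfl⟩ | ⟨a, ha, rfl⟩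
  · rw [rho2_high ha, rho2_low ha]
  · have : odd01 N = 1 := by have := odd01_cases N; tauto
    rw [show pr N (rk N + 1) = rk N + 1 by rw [pr]; omega, rho2_mid ho, neg_zero]
  · rw [pr_pr (by omega) (by omega), rho2_high ha, rho2_low ha, neg_neg]

/-- The properties that determine the `*`-operation. -/
theorem Generic.starMap_spec (h : Generic N s) {σ : ℂ →+* ℂ} (hσ : ∀ z, σ (σ z) = z)
    (hσq : σ (s ^ 2) = s ^ 2) (hσs : Odd N → σ s = s) :
    (∀ c : ℂ, starMap N s σ (algebraMap ℂ (A N s) c) = algebraMap ℂ (A N s) (σ c)) ∧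
    (∀ a b : A N s, starMap N s σ (a * b) = starMap N s σ b * starMap N s σ a) ∧
    (∀ i : ℕ, 1 ≤ i → i ≤ N →
      starMap N s σ (X N s i) = qh s (rho2 N (pr N i)) • X N s (pr N i)) := by
  have hs := h.ne_zero
  have hN := rk_spec N
  refine Classical.epsilon_spec (p := fun T : A N s →+ A N s =>
    (∀ c : ℂ, T (algebraMap ℂ (A N s) c) = algebraMap ℂ (A N s) (σ c)) ∧
    (∀ a b : A N s, T (a * b) = T b * T a) ∧
    (∀ i : ℕ, 1 ≤ i → i ≤ N → T (X N s i) = qh s (rho2 N (pr N i)) • X N s (pr N i))) ?_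
  have hκ : σ (kap N s) = kap N s := by
    rw [kap]
    split_ifs with ho
    · rw [map_inv₀, map_add, map_inv₀, hσs ho]
    · exact map_zero σ
  let o := toTwist (R := A N s) σ
  have hsmul : ∀ (c : ℂ) a, o (c • a) = σ c • o a := fun c a => by
    have := toTwist_smul_map (R := A N s) σ (σ c) a
    rwa [hσ] at this
  let g : ℕ → ℂ := fun i => σ (qh s (rho2 N (pr N (rk N - i))))
  have hg : ∀ i, g i ≠ 0 := fun i => (map_ne_zero σ).2 (qh_ne hs _)
  have hrel := (X_rels (N := N) hs h.root).anti (o : A N s →+ Twist σ (A N s))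
    (toTwist_mul σ) hsmul hσq hκ hg
  have hx : XRels N s (fun i => o (qh s (rho2 N (pr N i)) • X N s (pr N i))) (rk N) := by
    have hm : mid N (fun i => o (qh s (rho2 N (pr N i)) • X N s (pr N i))) =
        o (mid N (X N s)) := by
      rcases odd01_cases N with ⟨ho, h1⟩ | ⟨ho, h1⟩
      · rw [mid, mid, if_pos ho, if_pos ho, show pr N (rk N + 1) = rk N + 1 by rw [pr]; omega,
          rho2_mid ho, qh_zero, one_smul]
      · rw [mid, mid, if_neg ho, if_neg ho, map_zero]
    rw [XRels, hm]
    refine PairRels.congr hrel fun i hi => ⟨(hsmul _ _).symm, ?_⟩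
    rw [pr_pr (by omega) (by omega), hsmul]
    simp only [g, rho2_pr (show 1 ≤ rk N - i by omega) (show rk N - i ≤ N by omega), qh_neg,
      map_inv₀, inv_inv]
    rfl
  obtain ⟨f, hf⟩ := exists_lift hs h.root (by have := h.two_le; omega) _ hx
  refine ⟨(o.symm : Twist σ (A N s) →+ A N s).comp (f : A N s →+ Twist σ (A N s)),
    fun c => ?_, fun a b => ?_, fun i hi hi' => ?_⟩
  · change o.symm (f _) = _
    rw [AlgHom.commutes, algebraMap_twist]
    exact o.symm_apply_apply _
  · change o.symm (f _) = o.symm (f _) * o.symm (f _)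
    rw [map_mul]
    rfl
  · change o.symm (f _) = _
    rw [hf i hi hi']
    exact o.symm_apply_apply _

/-! ### Orthogonality -/

theorem smul_list_prod {R : Type*} [Semiring R] [Algebra ℂ R] (c : ℕ → ℂ) (x : ℕ → R)
    (l : List ℕ) : (l.map fun i => c i • x i).prod = (l.map c).prod • (l.map x).prod := by
  induction l with
  | nil => simp
  | cons i l ih => simp only [List.map_cons, List.prod_cons, ih, smul_mul_smul_comm]

/-- The operator `K̂_1` is an automorphism of the algebra, since the relations are homogeneous. -/
theorem Generic.exists_algHom_eq_Khat (h : Generic N s) :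
    ∃ f : A N s →ₐ[ℂ] A N s, f.toLinearMap = Khat N s 1 ∧ ∀ i, 1 ≤ i → i ≤ N → f (X N s i) =
      (if i = 1 then qp s 1 else if i = pr N 1 then (qp s 1)⁻¹ else 1) • X N s i := by
  have hs := h.ne_zero
  have h2 := h.two_le
  have h4 := h.four_le
  have hN := rk_spec N
  let c : ℕ → ℂ := fun i => if i = 1 then qp s 1 else if i = pr N 1 then (qp s 1)⁻¹ else 1
  have hq := qp_ne hs 1
  have hp1 : pr N 1 = N := by rw [pr]; omega
  let g : ℕ → ℂ := fun i => if rk N - i = 1 then qp s 1 else 1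
  have hg : ∀ i, g i ≠ 0 := fun i => by
    simp only [g]; split_ifs
    · exact hq
    · exact one_ne_zero
  have hx : XRels N s (fun i => c i • X N s i) (rk N) := by
    have hm : mid N (fun i => c i • X N s i) = mid N (X N s) := by
      rcases odd01_cases N with ⟨ho, h1⟩ | ⟨ho, h1⟩
      · rw [mid, mid, if_pos ho, if_pos ho]
        simp only [c]
        rw [if_neg (by omega), if_neg (by omega), one_smul]
      · rw [mid, mid, if_neg ho, if_neg ho]
    rw [XRels, hm]
    refine PairRels.congr ((X_rels hs h.root).scale hg) fun i hi => ⟨?_, ?_⟩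
    · simp only [g, c]
      by_cases h1 : rk N - i = 1
      · rw [if_pos h1, if_pos h1]
      · rw [if_neg h1, if_neg h1, if_neg (by omega)]
    · have hpi : pr N (rk N - i) = N + 1 - (rk N - i) := rfl
      simp only [g, c]
      by_cases h1 : rk N - i = 1
      · rw [if_pos h1, if_neg (by omega), if_pos (by rw [h1])]
      · rw [if_neg h1, if_neg (by omega), if_neg (by omega), inv_one]
  obtain ⟨f, hf⟩ := exists_lift hs h.root (by omega) _ hx
  have hfK : f.toLinearMap = Khat N s 1 := by
    refine h.ext_mono fun ν => ?_
    rw [h.Khat_mono le_rfl (by omega), AlgHom.toLinearMap_apply, mono, map_list_prod, List.map_map]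
    have e1 : (List.range N).map (f ∘ fun i => X N s (i + 1) ^ ν (i + 1)) =
        (List.range N).map fun i => c (i + 1) ^ ν (i + 1) • X N s (i + 1) ^ ν (i + 1) := by
      refine List.map_congr_left fun i hi => ?_
      rw [List.mem_range] at hi
      rw [Function.comp_apply, map_pow, hf _ (by omega) (by omega), smul_pow]
    rw [e1, smul_list_prod (fun i => c (i + 1) ^ ν (i + 1)) fun i => X N s (i + 1) ^ ν (i + 1)]
    congr 1
    obtain ⟨M, hM⟩ : ∃ M, N = M + 2 := ⟨N - 2, by omega⟩
    have e2 : List.range N = 0 :: ((List.range M).map Nat.succ ++ [M + 1]) := by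
      rw [hM, List.range_succ, List.range_succ_eq_map]; rfl
    have e3 : pr N 1 = M + 1 + 1 := by omega
    rw [e2, List.map_cons, List.map_append, List.prod_cons, List.prod_append, List.map_map,
      List.prod_eq_one (l := List.map _ (List.range M)), one_mul, zero_add, List.map_singleton,
      List.prod_singleton, ← e3]
    · have h5 : c 1 = qp s 1 := if_pos rfl
      have h6 : c (pr N 1) = (qp s 1)⁻¹ := (if_neg (by omega)).trans (if_pos rfl)
      rw [h5, h6, qp_sub hs, qp_natCast, qp_natCast, qp_one,
        inv_pow, div_eq_mul_inv]
    · intro x hx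
      rw [List.mem_map] at hx
      obtain ⟨i, hi, rfl⟩ := hx
      rw [List.mem_range] at hi
      simp only [Function.comp_apply, c]
      rw [if_neg (by omega), if_neg (by omega), one_pow]
  exact ⟨f, hfK, hf⟩

theorem Generic.Khat_one_mul (h : Generic N s) (a b : A N s) :
    Khat N s 1 (a * b) = Khat N s 1 a * Khat N s 1 b := by
  obtain ⟨f, hf, -⟩ := h.exists_algHom_eq_Khat
  rw [← hf]
  exact map_mul f a b

theorem Generic.Khat_X (h : Generic N s) {i : ℕ} (hi : 1 ≤ i) (hi' : i ≤ N) :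
    Khat N s 1 (X N s i) =
      (if i = 1 then qp s 1 else if i = pr N 1 then (qp s 1)⁻¹ else 1) • X N s i := by
  obtain ⟨f, hf, hX⟩ := h.exists_algHom_eq_Khat
  rw [← hf]
  exact hX i hi hi'

/-- The invariant functional is invariant under `K̂_1`. -/
theorem Generic.haar_Khat (h : Generic N s) (p : A N s) :
    haar N s (τ N s (Khat N s 1 p)) = haar N s (τ N s p) := by
  have h2 := h.two_le
  have h4 := h.four_le
  have : haar N s ∘ₗ (τ N s).toLinearMap ∘ₗ Khat N s 1 = haar N s ∘ₗ (τ N s).toLinearMap := by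
    refine h.ext_mono fun ν => ?_
    rw [LinearMap.comp_apply, LinearMap.comp_apply, LinearMap.comp_apply, h.Khat_mono le_rfl
      (by omega), map_smul, map_smul, AlgHom.toLinearMap_apply, h.haar_spec]
    by_cases hb : Balanced N ν
    · rw [hb.1 1 (Finset.mem_Icc.2 ⟨le_rfl, by omega⟩), sub_self, qp_zero, one_smul]
    · rw [haarValue_of_not_balanced hb, smul_zero]
  exact LinearMap.congr_fun this p

/-- The invariant functional vanishes on eigenvectors of `K̂_1` of nonzero weight. -/
theorem Generic.haar_eq_zero (h : Generic N s) {p : A N s} {w : ℤ}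
    (hp : Khat N s 1 p = qp s w • p) (hw : w ≠ 0) : haar N s (τ N s p) = 0 := by
  have h1 := h.haar_Khat p
  rw [hp, map_smul, map_smul, smul_eq_mul] at h1
  have h2 : (qp s w - 1) * haar N s (τ N s p) = 0 := by rw [sub_mul, h1, one_mul, sub_self]
  exact (mul_eq_zero.1 h2).resolve_left (sub_ne_zero.2 (qp_ne_one h.root hw))

/-- The polynomial `φ` is an eigenvector of `K̂_1`. -/
theorem Generic.Khat_phi (h : Generic N s) (a b : ℕ) :
    Khat N s 1 (phi N s a b) = qp s ((a : ℤ) - b) • phi N s a b := by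
  have h4 := h.four_le
  rw [h.phi_eq, map_sum, Finset.smul_sum]
  refine Finset.sum_congr rfl fun k hk => ?_
  rw [Finset.mem_range] at hk
  rw [map_smul, h.map_Q_pow (h.Khat_rad le_rfl (by omega)), ← h.mono_edge, h.Khat_mono le_rfl
    (by omega), h.edge_one, h.edge_last, mul_smul_comm, smul_comm]
  congr 2
  omega

/-- The `*`-operation intertwines `K̂_1` with its inverse: `K̂_1 (K̂_1 p)^* = p^*`. -/
theorem Generic.Khat_star (h : Generic N s) {σ : ℂ →+* ℂ} (hσ : ∀ z, σ (σ z) = z)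
    (hσq : σ (s ^ 2) = s ^ 2) (hσs : Odd N → σ s = s) (p : A N s) :
    Khat N s 1 (starMap N s σ (Khat N s 1 p)) = starMap N s σ p := by
  have hs := h.ne_zero
  have h4 := h.four_le
  have hp1 : pr N 1 = N := by rw [pr]; omega
  obtain ⟨h1, h2, h3⟩ := h.starMap_spec hσ hσq hσs
  have hc : ∀ c, Khat N s 1 (algebraMap ℂ _ c) = algebraMap ℂ _ c := by
    intro c
    rw [Algebra.algebraMap_eq_smul_one, map_smul, ← mono_zero, h.Khat_mono le_rfl (by omega)]
    simp
  have hsm : ∀ (c : ℂ) a, starMap N s σ (c • a) = σ c • starMap N s σ a := by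
    intro c a
    rw [Algebra.smul_def, h2, h1, ← Algebra.commutes, ← Algebra.smul_def]
  have hσp : ∀ a : ℤ, σ (qp s a) = qp s a := fun a => by rw [qp, map_zpow₀, hσq]
  induction p using algebra_induction with
  | h₀ c => rw [hc, h1, hc]
  | hX i hi hi' =>
    have hpi : pr N i = N + 1 - i := rfl
    rw [h.Khat_X hi hi', hsm, h3 i hi hi', map_smul, map_smul, h.Khat_X (by omega) (by omega),
      smul_comm (σ _), smul_smul (σ _)]
    have : σ (if i = 1 then qp s 1 else if i = pr N 1 then (qp s 1)⁻¹ else 1) *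
        (if pr N i = 1 then qp s 1 else if pr N i = pr N 1 then (qp s 1)⁻¹ else 1) = 1 := by
      have hq := qp_ne hs 1
      by_cases h5 : i = 1
      · rw [if_pos h5, if_neg (by omega), if_pos (by omega), hσp, mul_inv_cancel₀ hq]
      · by_cases h6 : i = pr N 1
        · rw [if_neg h5, if_pos h6, if_pos (by omega), map_inv₀, hσp, inv_mul_cancel₀ hq]
        · rw [if_neg h5, if_neg h6, if_neg (by omega), if_neg (by omega), map_one, one_mul]
    rw [this, one_smul]
  | hmul a b ha hb => rw [h.Khat_one_mul, h2, h.Khat_one_mul, ha, hb, h2]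
  | hadd a b ha hb => rw [map_add, map_add, map_add, ha, hb, map_add]

/-- Orthogonality, from the weights: `φ_{a b}^* φ_{c d}` has the weight `(b - a) + (c - d)`. -/
theorem Generic.scal_phi_eq_zero (h : Generic N s) {σ : ℂ →+* ℂ} (hσ : ∀ z, σ (σ z) = z)
    (hσq : σ (s ^ 2) = s ^ 2) (hσs : Odd N → σ s = s) {a b c d : ℕ}
    (hne : (a : ℤ) - b ≠ c - d) : scal N s σ (phi N s a b) (phi N s c d) = 0 := by
  have hs := h.ne_zero
  obtain ⟨h1, h2, h3⟩ := h.starMap_spec hσ hσq hσs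
  have hsm : ∀ (c : ℂ) a, starMap N s σ (c • a) = σ c • starMap N s σ a := by
    intro c a
    rw [Algebra.smul_def, h2, h1, ← Algebra.commutes, ← Algebra.smul_def]
  have hσp : ∀ a : ℤ, σ (qp s a) = qp s a := fun a => by rw [qp, map_zpow₀, hσq]
  have h4 : Khat N s 1 (starMap N s σ (phi N s a b)) =
      qp s (b - a) • starMap N s σ (phi N s a b) := by
    have h5 := h.Khat_star hσ hσq hσs (phi N s a b)
    rw [h.Khat_phi, hsm, hσp, map_smul] at h5
    rw [← neg_sub, qp_neg, eq_inv_smul_iff₀ (qp_ne hs _), h5]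
  rw [scal, ← map_mul]
  refine h.haar_eq_zero (w := b - a + (c - d)) ?_ (by omega)
  rw [h.Khat_one_mul, h4, h.Khat_phi, smul_mul_smul_comm, qp_add hs]

/-! ### Linear independence -/

theorem map_radius {R R' : Type*} [Ring R] [Algebra ℂ R] [Ring R'] [Algebra ℂ R'] (f : R →ₐ[ℂ] R')
    (q κ : ℂ) (z : R) (u w : ℕ → R) (t : ℕ) :
    f (radius q κ z u w t) = radius q κ (f z) (fun i => f (u i)) (fun i => f (w i)) t := by
  induction t with
  | zero => rw [radius, radius, map_smul, map_mul]
  | succ t ih => rw [radius, radius, map_add, map_mul, map_smul, ih]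

/-- The shift on functions on `ℤ`. -/
def shiftZ : Module.End ℂ (ℤ → ℂ) := LinearMap.funLeft ℂ ℂ fun k => k + 1

/-- The inverse shift on functions on `ℤ`. -/
def shiftZInv : Module.End ℂ (ℤ → ℂ) := LinearMap.funLeft ℂ ℂ fun k => k - 1

/-- The multiplication by `q ^ k` of functions of `k ∈ ℤ`. -/
def diagZ (s : ℂ) : Module.End ℂ (ℤ → ℂ) :=
  LinearMap.pi fun k => qp s k • LinearMap.proj k

theorem shiftZ_mul_inv : shiftZ * shiftZInv = 1 := by
  ext f k
  simp [shiftZ, shiftZInv, LinearMap.funLeft_apply]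

theorem shiftZInv_mul : shiftZInv * shiftZ = 1 := by
  ext f k
  simp [shiftZ, shiftZInv, LinearMap.funLeft_apply]

theorem shiftZ_mul_diagZ (hs : s ≠ 0) : shiftZ * diagZ s = s ^ 2 • (diagZ s * shiftZ) := by
  refine LinearMap.ext fun f => funext fun k => ?_
  simp [shiftZ, diagZ, LinearMap.funLeft_apply, qp_add hs, qp_one]
  ring

theorem diagZ_mul_shiftZInv (hs : s ≠ 0) :
    diagZ s * shiftZInv = s ^ 2 • (shiftZInv * diagZ s) := by
  refine LinearMap.ext fun f => funext fun k => ?_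
  simp [shiftZInv, diagZ, LinearMap.funLeft_apply, qp_sub hs, qp_one]
  field_simp

theorem isUnit_diagZ (hs : s ≠ 0) : IsUnit (diagZ s) := by
  refine ⟨⟨diagZ s, LinearMap.pi fun k => qp s (-k) • LinearMap.proj k, ?_, ?_⟩, rfl⟩ <;>
  · refine LinearMap.ext fun f => funext fun k => ?_
    have := qp_ne hs k
    simp [diagZ, qp_neg, this]

/-- A representation of the algebra of functions on the isotropic cone `Q = 0`, in which `x_1` and
`x_{1'}` are invertible: `x_1` is the shift,
  `x_2` and `x_{2'}` are multiples of the diagonal operator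
`q ^ k`, and all `x_i` with `i ≠ 1, 2, 2', 1'` are zero. -/
theorem Generic.exists_cone_rep (h : Generic N s) :
    ∃ f : A N s →ₐ[ℂ] Module.End ℂ (ℤ → ℂ), f (Q N s) = 0 ∧ IsUnit (f (X N s 1)) ∧
      IsUnit (f (X N s (pr N 1))) := by
  have hs := h.ne_zero
  have hN := rk_spec N
  have h2 := h.two_le
  obtain ⟨r, hr⟩ : ∃ r, rk N = r + 2 := ⟨rk N - 2, by omega⟩
  have hodd := odd01_cases N
  have hp1 : pr N 1 = N := by rw [pr]; omega
  have hp2 : pr N 2 = N - 1 := by rw [pr]; omega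
  let x : ℕ → Module.End ℂ (ℤ → ℂ) := fun i => if i = 1 then shiftZ else if i = 2 then diagZ s else
    if i = pr N 1 then diagZ s * diagZ s * shiftZInv else
    if i = pr N 2 then (-s ^ 2) • diagZ s else 0
  let u : ℕ → Module.End ℂ (ℤ → ℂ) := fun i => x (rk N - i)
  let w : ℕ → Module.End ℂ (ℤ → ℂ) := fun i => x (pr N (rk N - i))
  have u1 : u (r + 1) = shiftZ := if_pos (by omega)
  have u2 : u r = diagZ s := (if_neg (by omega)).trans (if_pos (by omega))
  have u0 : ∀ i < r, u i = 0 := fun i hi => (if_neg (by omega)).trans ((if_neg (by omega)).trans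
    ((if_neg (by omega)).trans (if_neg (by omega))))
  have w1 : w (r + 1) = diagZ s * diagZ s * shiftZInv :=
    (if_neg (by rw [pr]; omega)).trans ((if_neg (by rw [pr]; omega)).trans
      (if_pos (by congr 1; omega)))
  have w2 : w r = (-s ^ 2) • diagZ s :=
    (if_neg (by rw [pr]; omega)).trans ((if_neg (by rw [pr]; omega)).trans
      ((if_neg (by rw [pr]; omega)).trans (if_pos (by congr 1; omega))))
  have w0 : ∀ i < r, w i = 0 := fun i hi => (if_neg (by rw [pr]; omega)).trans
    ((if_neg (by rw [pr]; omega)).trans ((if_neg (by rw [pr]; omega)).trans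
      (if_neg (by rw [pr]; omega))))
  have hm : mid N x = 0 := by
    rw [mid]
    split_ifs with ho
    · have : odd01 N = 1 := by tauto
      exact (if_neg (by omega)).trans ((if_neg (by omega)).trans
        ((if_neg (by omega)).trans (if_neg (by omega))))
    · rfl
  have hrad : ∀ t ≤ r, radius (s ^ 2) (kap N s) 0 u w t = 0 := by
    intro t
    induction t with
    | zero => intro _; rw [radius, mul_zero, smul_zero]
    | succ t ih => intro ht; rw [radius, ih (by omega), u0 t (by omega), zero_mul, smul_zero,
        add_zero]
  have c1 := shiftZ_mul_diagZ hs
  have c2 := diagZ_mul_shiftZInv hs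
  have c3 : shiftZ * (diagZ s * diagZ s * shiftZInv) = (s ^ 2) ^ 2 • (diagZ s * diagZ s) := by
    rw [← mul_assoc, ← mul_assoc, c1, smul_mul_assoc, smul_mul_assoc, mul_assoc (diagZ s), c1,
      mul_smul_comm, smul_mul_assoc, mul_assoc, mul_assoc, shiftZ_mul_inv, mul_one, smul_smul,
        sq (s ^ 2)]
  have hrad1 : radius (s ^ 2) (kap N s) 0 u w (r + 1) = (-s ^ 2) • (diagZ s * diagZ s) := by
    rw [radius, hrad r le_rfl, u2, w2, smul_zero, add_zero, mul_smul_comm]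
  have hrel : PairRels (s ^ 2) (kap N s) 0 u w (r + 2) := by
    refine ⟨fun i j hij hj => ?_, fun i j hij hj => ?_, fun i j hi hj hij => ?_, fun i hi => ?_,
      fun i hi => ?_, fun i hi => ?_⟩
    · by_cases hi : i < r
      · rw [u0 i hi, mul_zero, zero_mul, smul_zero]
      · obtain rfl : i = r := by omega
        obtain rfl : j = i + 1 := by omega
        rw [u1, u2, c1]
    · by_cases hi : i < r
      · rw [w0 i hi, mul_zero, zero_mul, smul_zero]
      · obtain rfl : i = r := by omega
        obtain rfl : j = i + 1 := by omega
        rw [w1, w2, smul_mul_assoc, mul_smul_comm, mul_assoc _ shiftZInv, smul_comm (s ^ 2),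
          ← mul_smul_comm (s ^ 2), ← c2]
        simp only [mul_assoc]
    · by_cases hi' : i < r
      · rw [u0 i hi', mul_zero, zero_mul, smul_zero]
      by_cases hj' : j < r
      · rw [w0 j hj', mul_zero, zero_mul, smul_zero]
      rcases (by omega : i = r ∧ j = r + 1 ∨ i = r + 1 ∧ j = r) with ⟨rfl, rfl⟩ | ⟨rfl, rfl⟩
      · rw [u2, w1, mul_assoc _ shiftZInv, ← mul_smul_comm (s ^ 2), ← c2]
        simp only [mul_assoc]
      · rw [u1, w2, mul_smul_comm, smul_mul_assoc, c1, smul_comm]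
    · rw [mul_zero, zero_mul, smul_zero]
    · rw [mul_zero, zero_mul, smul_zero]
    · by_cases hi' : i < r
      · rw [u0 i hi', w0 i hi', hrad i hi'.le, smul_zero, add_zero]
      rcases (by omega : i = r ∨ i = r + 1) with rfl | rfl
      · rw [u2, w2, hrad i le_rfl, smul_zero, add_zero, mul_smul_comm, smul_mul_assoc]
      · rw [u1, w1, hrad1, c3, mul_assoc, shiftZInv_mul, mul_one, smul_smul, ← add_smul]
        have : (s ^ 2) ^ 2 + (s ^ 2 - (s ^ 2)⁻¹) * -s ^ 2 = 1 := by field_simp; ring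
        rw [this, one_smul]
  have hx : XRels N s x (rk N) := by
    rw [← hr] at hrel
    rwa [XRels, hm]
  obtain ⟨f, hf⟩ := exists_lift hs h.root (by omega) x hx
  refine ⟨f, ?_, ?_, ?_⟩
  · have hfm : f (mid N (X N s)) = 0 := by
      rw [← hm, mid, mid]
      split_ifs with ho
      · have : odd01 N = 1 := by tauto
        exact hf _ (by omega) (by omega)
      · exact map_zero f
    have : f (rad N s) = radius (s ^ 2) (kap N s) 0 u w (rk N) := by
      rw [rad, xRadius, map_radius, hfm]
      refine radius_congr fun i hi => ⟨hf _ (by omega) (by omega), hf _ ?_ ?_⟩ <;>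
      · rw [pr]; omega
    rw [h.Q_eq, map_smul, this, hr, radius, hrad1, u1, w1, c3, smul_smul, ← add_smul]
    have : (s ^ 2) ^ 2 + s ^ 2 * -s ^ 2 = 0 := by ring
    rw [this, zero_smul, smul_zero]
  · rw [hf 1 le_rfl (by omega)]
    exact ⟨⟨shiftZ, shiftZInv, shiftZ_mul_inv, shiftZInv_mul⟩, (if_pos rfl).symm⟩
  · have : x (pr N 1) = diagZ s * diagZ s * shiftZInv :=
      (if_neg (by omega)).trans ((if_neg (by omega)).trans (if_pos rfl))
    rw [hf _ (by omega) (by omega), this]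
    exact ((isUnit_diagZ hs).mul (isUnit_diagZ hs)).mul
      ⟨⟨shiftZInv, shiftZ, shiftZInv_mul, shiftZ_mul_inv⟩, rfl⟩

/-- Up to a multiple of `Q`, the polynomial `φ` is the monomial `x_1^a x_{1'}^b`. -/
theorem Generic.phi_sub_mem_qMul (h : Generic N s) (a b : ℕ) :
    phi N s a b - X N s 1 ^ a * X N s (pr N 1) ^ b ∈ qMul N s (a + b) := by
  rw [h.phi_eq, Finset.sum_range_succ', coeffC_zero, one_smul, pow_zero, one_mul, Nat.sub_zero,
    Nat.sub_zero, add_sub_cancel_right]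
  refine Submodule.sum_mem _ fun k hk => Submodule.smul_mem _ _ (Submodule.subset_span
    ⟨a + b - 2, Q N s ^ k * (X N s 1 ^ (a - (k + 1)) * X N s (pr N 1) ^ (b - (k + 1))), ?_, ?_, ?_⟩)
  · rw [Finset.mem_range] at hk; omega
  · rw [Finset.mem_range] at hk
    have := h.Q_pow_mem_homog (h.edge_mem_homog (a - (k + 1)) (b - (k + 1))) k
    rwa [show a - (k + 1) + (b - (k + 1)) + 2 * k = a + b - 2 by omega] at this
  · rw [pow_succ', mul_assoc]

/-- If `φ` were zero, then `x_1^a x_{1'}^b` would be a multiple of `Q`, and hence zero in the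
representation of `Generic.exists_cone_rep`. -/
theorem Generic.phi_ne_zero (h : Generic N s) (a b : ℕ) : phi N s a b ≠ 0 := by
  intro h0
  obtain ⟨f, hQ, h1, h2⟩ := h.exists_cone_rep
  have h3 : f (X N s 1 ^ a * X N s (pr N 1) ^ b) = 0 := by
    rcases mem_qMul (h.phi_sub_mem_qMul a b) with h4 | ⟨k, r, -, -, h4⟩
    · rw [← sub_eq_zero.1 h4, h0, map_zero]
    · rw [h0, zero_sub, neg_eq_iff_eq_neg] at h4
      rw [h4, map_neg, map_mul, hQ, zero_mul, neg_zero]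
  rw [map_mul, map_pow, map_pow] at h3
  have h5 := (h1.pow a).mul (h2.pow b)
  rw [h3] at h5
  exact not_isUnit_zero h5

/-- The polynomials `φ` of the same degree belong to different eigenvalues of `K̂_1`. -/
theorem Generic.linearIndependent_phi (h : Generic N s) (m : ℕ) :
    LinearIndependent ℂ fun a : Fin (m + 1) => phi N s (a : ℕ) (m - (a : ℕ)) := by
  refine Module.End.eigenvectors_linearIndependent' (Khat N s 1)
    (fun a : Fin (m + 1) => qp s ((a : ℕ) - (m - a : ℕ))) (fun a b hab => ?_) _ fun a => ?_
  · have := sq_inj h.ne_zero h.root hab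
    ext
    omega
  · exact ⟨Module.End.mem_eigenspace_iff.2 (h.Khat_phi _ _), h.phi_ne_zero _ _⟩

/-! ### Coefficients and invariants -/

/-- The multi-index `ν`, set to zero outside of `{1, …, N}`. -/
def res (N : ℕ) (ν : ℕ → ℕ) : ℕ → ℕ := fun i => if i ∈ Finset.Icc 1 N then ν i else 0

theorem res_apply {ν : ℕ → ℕ} {i : ℕ} (h1 : 1 ≤ i) (h2 : i ≤ N) : res N ν i = ν i :=
  if_pos (Finset.mem_Icc.2 ⟨h1, h2⟩)

theorem mono_res (ν : ℕ → ℕ) : mono N s (res N ν) = mono N s ν :=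
  mono_congr' fun _ h1 h2 => res_apply h1 h2

theorem res_congr {ν ν' : ℕ → ℕ} (h : ∀ i, 1 ≤ i → i ≤ N → ν i = ν' i) : res N ν = res N ν' := by
  funext i
  rw [res, res]
  split_ifs with hi
  · exact h i (Finset.mem_Icc.1 hi).1 (Finset.mem_Icc.1 hi).2
  · rfl

/-- The multi-indices that vanish outside of `{1, …, N}`. -/
def Supp (N : ℕ) (v : ℕ → ℤ) : Prop := ∀ i, i ∉ Finset.Icc 1 N → v i = 0

theorem Supp.add {v w : ℕ → ℤ} (hv : Supp N v) (hw : Supp N w) : Supp N (v + w) :=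
  fun i hi => by rw [Pi.add_apply, hv i hi, hw i hi, add_zero]

theorem Supp.sub {v w : ℕ → ℤ} (hv : Supp N v) (hw : Supp N w) : Supp N (v - w) :=
  fun i hi => by rw [Pi.sub_apply, hv i hi, hw i hi, sub_zero]

theorem supp_ez {i : ℕ} (h1 : 1 ≤ i) (h2 : i ≤ N) : Supp N (ez i) := fun j hj => by
  refine ez_of_ne ?_
  rintro rfl
  exact hj (Finset.mem_Icc.2 ⟨h1, h2⟩)

theorem supp_ep {j : ℕ} (hj : j ∈ half N) : Supp N (ep N j) := by
  have := rk_spec N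
  have := odd01_cases N
  obtain ⟨h1, h2⟩ := mem_half hj
  have : pr N j = N + 1 - j := rfl
  exact (supp_ez h1 (by omega)).add (supp_ez (by omega) (by omega))

theorem supp_res (ν : ℕ → ℕ) : Supp N (up (res N ν)) := fun i hi => by
  rw [up_apply, res, if_neg hi, Nat.cast_zero]

/-- The coordinates with respect to the basis of monomials. -/
def coords (N : ℕ) (s : ℂ) : A N s →ₗ[ℂ] (ℕ → ℕ) →₀ ℂ :=
  linExt N s fun ν => Finsupp.single (res N ν) 1

theorem Generic.coords_mono (h : Generic N s) (ν : ℕ → ℕ) :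
    coords N s (mono N s ν) = Finsupp.single (res N ν) 1 :=
  h.linExt_mono (fun _ _ hν => by rw [res_congr hν]) ν

theorem Generic.coords_injective (h : Generic N s) {p : A N s} (hp : coords N s p = 0) : p = 0 := by
  have : Finsupp.linearCombination ℂ (mono N s) ∘ₗ coords N s = LinearMap.id :=
    h.ext_mono fun ν => by
      rw [LinearMap.comp_apply, h.coords_mono, Finsupp.linearCombination_single, one_smul,
        mono_res, LinearMap.id_apply]
  rw [← LinearMap.id_apply (R := ℂ) p, ← this, LinearMap.comp_apply, hp, map_zero]

open Classical in
/-- The coefficient of `p` at the element `y v` of the basis of divided powers. -/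
def cf (N : ℕ) (s : ℂ) (v : ℕ → ℤ) : A N s →ₗ[ℂ] ℂ :=
  linExt N s fun ν => if up (res N ν) = v then wt N s (res N ν) else 0

open Classical in
theorem Generic.cf_mono (h : Generic N s) (v : ℕ → ℤ) (ν : ℕ → ℕ) :
    cf N s v (mono N s ν) = if up (res N ν) = v then wt N s (res N ν) else 0 :=
  h.linExt_mono (fun _ _ hν => by rw [res_congr hν]) ν

open Classical in
theorem Generic.cf_y (h : Generic N s) {v w : ℕ → ℤ} (hw : Supp N w) (hv : ∀ i, 0 ≤ v i) :
    cf N s v (y N s w) = if w = v then 1 else 0 := by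
  by_cases hw' : ∀ i, 0 ≤ w i
  · obtain ⟨ν, rfl⟩ := exists_up hw'
    have : res N ν = ν := by
      funext i
      rw [res]
      split_ifs with hi
      · rfl
      · exact (Int.natCast_eq_zero.1 (hw i hi)).symm
    rw [y_up, map_smul, h.cf_mono, this]
    split_ifs
    · exact inv_mul_cancel₀ (h.wt_ne ν)
    · exact mul_zero _
  · push Not at hw'
    obtain ⟨i, hi⟩ := hw'
    rw [y_neg hi, map_zero, if_neg]
    rintro rfl
    exact absurd (hv i) (not_le.2 hi)

theorem Generic.cf_neg (h : Generic N s) {v : ℕ → ℤ} {i : ℕ} (hi : v i < 0) (p : A N s) :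
    cf N s v p = 0 := by
  have : cf N s v = 0 := h.ext_mono fun ν => by
    rw [h.cf_mono, if_neg, LinearMap.zero_apply]
    rintro rfl
    rw [up_apply] at hi
    omega
  rw [this, LinearMap.zero_apply]

theorem Generic.cf_not_supp (h : Generic N s) {v : ℕ → ℤ} (hv : ¬ Supp N v) (p : A N s) :
    cf N s v p = 0 := by
  have : cf N s v = 0 := h.ext_mono fun ν => by
    rw [h.cf_mono, if_neg, LinearMap.zero_apply]
    rintro rfl
    exact hv (supp_res ν)
  rw [this, LinearMap.zero_apply]

theorem Generic.eq_zero_of_cf (h : Generic N s) {p : A N s} (hp : ∀ v, cf N s v p = 0) : p = 0 := by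
  classical
  refine h.coords_injective (Finsupp.ext fun ν => ?_)
  have key : wt N s ν • (Finsupp.lapply ν ∘ₗ coords N s) = cf N s (up ν) := h.ext_mono fun μ => by
    rw [LinearMap.smul_apply, LinearMap.comp_apply, h.coords_mono, h.cf_mono, Finsupp.lapply_apply,
      Finsupp.single_apply, smul_eq_mul]
    by_cases hμ : res N μ = ν
    · rw [if_pos hμ, hμ, if_pos rfl, mul_one]
    · rw [if_neg hμ, if_neg, mul_zero]
      intro h1
      refine hμ (funext fun i => ?_)
      exact Int.natCast_inj.1 (congrFun h1 i)
  have := LinearMap.congr_fun key p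
  rw [hp] at this
  exact (mul_eq_zero.1 this).resolve_left (h.wt_ne ν)

theorem Generic.ext_supp (h : Generic N s) {M : Type*} [AddCommGroup M] [Module ℂ M]
    {f g : A N s →ₗ[ℂ] M}
    (hfg : ∀ v, Supp N v → (∀ i, 0 ≤ v i) → f (y N s v) = g (y N s v)) : f = g :=
  h.ext_mono fun ν => by
    rw [← mono_res, h.mono_eq_y, map_smul, map_smul,
      hfg _ (supp_res ν) fun i => Int.natCast_nonneg _]

/-- The transpose of a weighted shift, acting on coefficients. -/
theorem Generic.mul_cf_shift (h : Generic N s) {v w α : ℕ → ℤ} (hv : Supp N v)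
    (hv' : ∀ i, 0 ≤ v i) (hα : Supp N α) (hw : ∀ i, 0 ≤ w i) (a : (ℕ → ℤ) → ℂ) :
    a v * cf N s w (y N s (v + α)) = a (w - α) * cf N s (w - α) (y N s v) := by
  classical
  rw [h.cf_y (hv.add hα) hw]
  by_cases hvw : v + α = w
  · obtain rfl : v = w - α := eq_sub_of_add_eq hvw
    rw [if_pos hvw, h.cf_y hv hv', if_pos rfl]
  · rw [if_neg hvw, mul_zero]
    by_cases hp : ∀ i, 0 ≤ (w - α) i
    · rw [h.cf_y hv hp, if_neg, mul_zero]
      rintro rfl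
      exact hvw (sub_add_cancel _ _)
    · push Not at hp
      obtain ⟨i, hi⟩ := hp
      rw [h.cf_neg hi, mul_zero]

theorem Generic.cf_rad (h : Generic N s) {w : ℕ → ℤ} (hw : ∀ i, 0 ≤ w i) (p : A N s) :
    cf N s w (rad N s * p) =
      ∑ j ∈ half N, radC N s j (w - ep N j) * cf N s (w - ep N j) p := by
  have : cf N s w ∘ₗ LinearMap.mulLeft ℂ (rad N s) =
      ∑ j ∈ half N, radC N s j (w - ep N j) • cf N s (w - ep N j) := h.ext_supp fun v hv hv' => by
    rw [LinearMap.comp_apply, LinearMap.mulLeft_apply, h.rad_y', map_sum, LinearMap.sum_apply]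
    refine Finset.sum_congr rfl fun j hj => ?_
    rw [map_smul, smul_eq_mul, h.mul_cf_shift hv hv' (supp_ep hj) hw, LinearMap.smul_apply,
      smul_eq_mul]
  have := LinearMap.congr_fun this p
  rwa [LinearMap.sum_apply] at this

theorem Generic.cf_two_terms (h : Generic N s) {T : A N s →ₗ[ℂ] A N s} {a b : (ℕ → ℤ) → ℂ}
    {α β : ℕ → ℤ} (hα : Supp N α) (hβ : Supp N β)
    (hT : ∀ v, T (y N s v) = a v • y N s (v + α) - b v • y N s (v + β)) {w : ℕ → ℤ}
    (hw : ∀ i, 0 ≤ w i) (p : A N s) :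
    cf N s w (T p) = a (w - α) * cf N s (w - α) p - b (w - β) * cf N s (w - β) p := by
  have : cf N s w ∘ₗ T = a (w - α) • cf N s (w - α) - b (w - β) • cf N s (w - β) :=
    h.ext_supp fun v hv hv' => by
      rw [LinearMap.comp_apply, hT, map_sub, map_smul, map_smul, smul_eq_mul, smul_eq_mul,
        h.mul_cf_shift hv hv' hα hw, h.mul_cf_shift hv hv' hβ hw]
      rfl
  exact LinearMap.congr_fun this p

theorem Generic.cf_Khat (h : Generic N s) {i : ℕ} (hi : 1 ≤ i) (hi' : i ≤ N) {w : ℕ → ℤ}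
    (hw : ∀ i, 0 ≤ w i) (p : A N s) :
    cf N s w (Khat N s i p) = qp s (w i - w (pr N i)) * cf N s w p := by
  have : cf N s w ∘ₗ Khat N s i = qp s (w i - w (pr N i)) • cf N s w :=
    h.ext_supp fun v hv hv' => by
      have := h.mul_cf_shift hv hv' (α := 0) (fun _ _ => rfl) hw fun v => qp s (v i - v (pr N i))
      rw [add_zero, sub_zero] at this
      rw [LinearMap.comp_apply, h.Khat_y hi hi', map_smul, smul_eq_mul, this]
      rfl
  exact LinearMap.congr_fun this p

theorem Generic.cf_homog (h : Generic N s) {m : ℕ} {p : A N s} (hp : p ∈ homog N s m) {v : ℕ → ℤ}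
    (hv : SZ v 1 N ≠ m) : cf N s v p = 0 := by
  induction hp using Submodule.span_induction with
  | mem x hx =>
    obtain ⟨ν, rfl, rfl⟩ := hx
    rw [h.cf_mono, if_neg]
    rintro rfl
    refine hv ?_
    rw [SZ, Nat.cast_sum]
    refine Finset.sum_congr rfl fun i hi => ?_
    rw [up_apply, res, if_pos hi]
  | zero => exact map_zero _
  | add a b _ _ ha hb => rw [map_add, ha, hb, add_zero]
  | smul c a _ ha => rw [map_smul, ha, smul_zero]

/-- The monomials of an invariant have weight zero. -/
theorem Generic.cf_eq_zero_of_weight (h : Generic N s) {p : A N s} (hp : IsInvariant N s p)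
    {i : ℕ} (hi : 2 ≤ i) (hi' : i ≤ rk N) {v : ℕ → ℤ} (hv : v i ≠ v (pr N i)) :
    cf N s v p = 0 := by
  have := rk_spec N
  by_cases hv0 : ∀ i, 0 ≤ v i
  · have h1 := h.cf_Khat (i := i) (by omega) (by omega) hv0 p
    rw [(hp i hi hi').1] at h1
    have h2 : (1 - qp s (v i - v (pr N i))) * cf N s v p = 0 := by
      rw [sub_mul, ← h1, one_mul, sub_self]
    exact (mul_eq_zero.1 h2).resolve_left (h.one_sub_ne (sub_ne_zero.2 hv))
  · push Not at hv0
    obtain ⟨i, hi⟩ := hv0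
    exact h.cf_neg hi p

/-- The equation `E_k p = 0` determines the coefficient at a monomial that contains `x_{k+1}` by the one
at the monomial in which `x_{k+1} x_{(k+1)'}` is replaced by `x_k x_{k'}`. -/
theorem Generic.cf_reduce (h : Generic N s) {p : A N s} (hp : IsInvariant N s p) {k : ℕ}
    (hk : 2 ≤ k) (hk' : k + 1 ∈ half N) {v : ℕ → ℤ} (hv : ∀ i, 0 ≤ v i) (hv' : 1 ≤ v (k + 1)) :
    ∃ c : ℂ, cf N s v p = c * cf N s (v + ep N k - ep N (k + 1)) p := by
  have hN := rk_spec N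
  have hodd := odd01_cases N
  have hs := h.ne_zero
  obtain ⟨-, hk1⟩ := mem_half hk'
  have hpk : pr N k = N + 1 - k := rfl
  have hpk1 : pr N (k + 1) = N + 1 - (k + 1) := rfl
  have hE : E N s k p = 0 := ((hp k hk (by omega)).2 (by omega)).1
  have main : ∀ (a b : (ℕ → ℤ) → ℂ) (β : ℕ → ℤ), Supp N β →
      (∀ v, E N s k (y N s v) = a v • y N s (v + (ez k - ez (k + 1))) - b v • y N s (v + β)) →
      a v ≠ 0 → ez k - ez (k + 1) - β = ep N k - ep N (k + 1) →
      ∃ c : ℂ, cf N s v p = c * cf N s (v + ep N k - ep N (k + 1)) p := by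
    intro a b β hβ hT ha hαβ
    have hw : ∀ i, 0 ≤ (v + (ez k - ez (k + 1))) i := by
      intro i
      have h1 := hv i
      have h2 := ez_nonneg k i
      rw [Pi.add_apply, Pi.sub_apply]
      by_cases hi : i = k + 1
      · subst hi
        rw [ez_same]
        omega
      · rw [ez_of_ne hi]
        omega
    have h1 := h.cf_two_terms ((supp_ez (by omega) (by omega)).sub
      (supp_ez (by omega) (by omega))) hβ hT hw p
    have h2 : v + (ez k - ez (k + 1)) - β = v + ep N k - ep N (k + 1) := by
      rw [add_sub_assoc, hαβ, add_sub_assoc]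
    rw [hE, map_zero, add_sub_cancel_right, h2] at h1
    refine ⟨(a v)⁻¹ * b (v + ep N k - ep N (k + 1)), ?_⟩
    rw [mul_assoc, ← sub_eq_zero.1 h1.symm, inv_mul_cancel_left₀ ha]
  have hvk := hv k
  rcases hk1 with ⟨hk1, -⟩ | ⟨ho, hk1, hk2⟩
  · refine main _ _ _ ?_ (fun v => by
      rw [h.E_y (by omega) (by omega), add_sub_assoc, add_sub_assoc]) ?_ ?_
    · exact (supp_ez (by omega) (by omega)).sub (supp_ez (by omega) (by omega))
    · exact mul_ne_zero (h.br_ne _ (by omega)) (qp_ne hs _)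
    · rw [ep, ep]
      abel
  · obtain rfl : k = rk N := by omega
    refine main _ _ _ ?_ (fun v => by
      rw [h.E_y_odd ho, add_sub_assoc, add_sub_assoc]) ?_ ?_
    · exact (supp_ez (by omega) (by omega)).sub (supp_ez (by omega) (by omega))
    · exact mul_ne_zero (h.br_ne _ (by omega)) (qh_ne hs _)
    · rw [ep, ep, show pr N (rk N + 1) = rk N + 1 by omega, show pr N (rk N) = rk N + 2 by omega]
      abel

/-- The multi-index of the monomial `x_1^a x_2^K x_{2'}^K x_{1'}^b`. -/
def core (N a K b : ℕ) : ℕ → ℤ := up (edge N a b) + (K : ℤ) • ep N 2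

/-- An invariant is determined by its coefficients at `x_1^a x_2^K x_{2'}^K x_{1'}^b`. -/
theorem Generic.eq_zero_of_core (h : Generic N s) {p : A N s} (hp : IsInvariant N s p)
    (hc : ∀ a K b, cf N s (core N a K b) p = 0) : p = 0 := by
  have hN := rk_spec N
  have hodd := odd01_cases N
  have h2 := h.two_le
  refine h.eq_zero_of_cf fun v => ?_
  -- the invariance lowers the weighted degree `∑ i v_i` over the half of the indices
  suffices H : ∀ (M : ℕ) (v : ℕ → ℤ), (∑ i ∈ half N, (i : ℤ) * v i) < M → cf N s v p = 0 from
    H ((∑ i ∈ half N, (i : ℤ) * v i).toNat + 1) v (by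
      have := Int.self_le_toNat (∑ i ∈ half N, (i : ℤ) * v i); push_cast; omega)
  intro M
  induction M with
  | zero =>
    intro v hv
    by_cases hv0 : ∀ i, 0 ≤ v i
    · have : 0 ≤ ∑ i ∈ half N, (i : ℤ) * v i :=
        Finset.sum_nonneg fun i _ => mul_nonneg (Int.natCast_nonneg _) (hv0 i)
      push_cast at hv
      omega
    · push Not at hv0
      obtain ⟨i, hi⟩ := hv0
      exact h.cf_neg hi p
  | succ M ih =>
    intro v hv
    by_cases hv0 : ∀ i, 0 ≤ v i
    swap
    · push Not at hv0
      obtain ⟨i, hi⟩ := hv0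
      exact h.cf_neg hi p
    by_cases hsupp : Supp N v
    swap
    · exact h.cf_not_supp hsupp p
    by_cases hex : ∃ k, 2 ≤ k ∧ k + 1 ∈ half N ∧ 1 ≤ v (k + 1)
    · obtain ⟨k, hk, hk', hvk⟩ := hex
      obtain ⟨c, hcf⟩ := h.cf_reduce hp hk hk' hv0 hvk
      rw [hcf, ih, mul_zero]
      have hmem : k ∈ half N := by
        rw [half, Finset.mem_Icc] at hk' ⊢
        omega
      obtain ⟨-, hk1⟩ := mem_half hk'
      have hpk : pr N k = N + 1 - k := rfl
      have hpk1 : pr N (k + 1) = N + 1 - (k + 1) := rfl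
      have hdiff : ∑ i ∈ half N, (i : ℤ) * (v + ep N k - ep N (k + 1)) i =
          ∑ i ∈ half N, (i : ℤ) * v i + ∑ i ∈ half N, (i : ℤ) * ep N k i -
            ∑ i ∈ half N, (i : ℤ) * ep N (k + 1) i := by
        rw [← Finset.sum_add_distrib, ← Finset.sum_sub_distrib]
        refine Finset.sum_congr rfl fun i _ => ?_
        rw [Pi.sub_apply, Pi.add_apply]
        ring
      have hsum : ∑ i ∈ half N, (i : ℤ) * ep N k i = k := by
        rw [Finset.sum_eq_single_of_mem k hmem, (ep_same (by omega)).1, mul_one]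
        intro i hi hik
        rw [half, Finset.mem_Icc] at hi
        rw [ep_of_ne hik (by omega), mul_zero]
      have hsum' : ((k + 1 : ℕ) : ℤ) ≤ ∑ i ∈ half N, (i : ℤ) * ep N (k + 1) i := by
        have h1 : (1 : ℤ) ≤ ep N (k + 1) (k + 1) := by
          rw [ep, Pi.add_apply, ez_same]
          have := ez_nonneg (pr N (k + 1)) (k + 1)
          omega
        calc ((k + 1 : ℕ) : ℤ) ≤ ((k + 1 : ℕ) : ℤ) * ep N (k + 1) (k + 1) :=
              le_mul_of_one_le_right (Int.natCast_nonneg _) h1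
          _ ≤ _ := Finset.single_le_sum (f := fun i : ℕ => (i : ℤ) * ep N (k + 1) i)
              (fun i _ => mul_nonneg (Int.natCast_nonneg _)
                (add_nonneg (ez_nonneg _ _) (ez_nonneg _ _))) hk'
      rw [hdiff, hsum]
      push_cast at hv hsum'
      omega
    · push Not at hex
      by_cases hw : ∃ i, 2 ≤ i ∧ i ≤ rk N ∧ v i ≠ v (pr N i)
      · obtain ⟨i, hi, hi', hne⟩ := hw
        exact h.cf_eq_zero_of_weight hp hi hi' hne
      push Not at hw
      have hp1 : pr N 1 = N := by rw [pr]; omega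
      have hp2 : pr N 2 = N - 1 := by rw [pr]; omega
      have hcore : v = core N (v 1).toNat (v 2).toNat (v (pr N 1)).toNat := by
        have t1 := Int.toNat_of_nonneg (hv0 1)
        have t2 := Int.toNat_of_nonneg (hv0 2)
        have t3 := Int.toNat_of_nonneg (hv0 (pr N 1))
        have hsmall : ∀ i, 3 ≤ i → i ≤ rk N + odd01 N → v i = 0 := by
          intro i hi hi'
          have h1 := hv0 i
          have h2 := hex (i - 1) (by omega) (by rw [half, Finset.mem_Icc]; omega)
          rw [show i - 1 + 1 = i by omega] at h2
          omega
        have hep := ep_same (N := N) (j := 2) (by omega)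
        funext i
        rw [core, Pi.add_apply, Pi.smul_apply, up_apply, smul_eq_mul, t2]
        by_cases hi1 : i = 1
        · rw [hi1, h.edge_one, t1, ep_of_ne (by omega) (by omega), mul_zero, add_zero]
        by_cases hiN : i = pr N 1
        · rw [hiN, h.edge_last, t3, ep_of_ne (by omega) (by omega), mul_zero, add_zero]
        rw [edge_of_ne hi1 hiN, Nat.cast_zero, zero_add]
        by_cases hi2 : i = 2
        · rw [hi2, hep.1, mul_one]
        by_cases hi2' : i = pr N 2
        · rw [hi2', hep.2, mul_one, hw 2 le_rfl h2]
        rw [ep_of_ne hi2 hi2', mul_zero]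
        by_cases hiI : i ∈ Finset.Icc 1 N
        swap
        · exact hsupp i hiI
        rw [Finset.mem_Icc] at hiI
        by_cases hih : i ≤ rk N + odd01 N
        · exact hsmall i (by omega) hih
        · have h3 : pr N i = N + 1 - i := rfl
          have h4 := hw (pr N i) (by omega) (by omega)
          rw [pr_pr hiI.1 hiI.2] at h4
          rw [← h4]
          exact hsmall _ (by omega) (by omega)
      rw [hcore]
      exact hc _ _ _

/-! ### Completeness -/

theorem core_succ (a K b : ℕ) : core N a (K + 1) b - ep N 2 = core N a K b := by
  rw [core, core, Nat.cast_succ, add_smul, one_smul]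
  abel

theorem core_nonneg (a K b i : ℕ) : 0 ≤ core N a K b i :=
  add_nonneg (Int.natCast_nonneg _) (mul_nonneg (Int.natCast_nonneg _)
    (add_nonneg (ez_nonneg _ _) (ez_nonneg _ _)))

theorem Generic.ep_two (h : Generic N s) : ep N 2 1 = 0 ∧ ep N 2 (pr N 1) = 0 := by
  have h4 := h.four_le
  have hp1 : pr N 1 = N := by rw [pr]; omega
  have hp2 : pr N 2 = N - 1 := by rw [pr]; omega
  exact ⟨ep_of_ne (by omega) (by omega), ep_of_ne (by omega) (by omega)⟩

theorem Generic.core_one (h : Generic N s) (a K b : ℕ) : core N a K b 1 = a := by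
  rw [core, Pi.add_apply, Pi.smul_apply, h.ep_two.1, up_apply, h.edge_one, smul_zero, add_zero]

theorem Generic.core_last (h : Generic N s) (a K b : ℕ) : core N a K b (pr N 1) = b := by
  rw [core, Pi.add_apply, Pi.smul_apply, h.ep_two.2, up_apply, h.edge_last, smul_zero, add_zero]

theorem Generic.two_mem_half (h : Generic N s) : 2 ∈ half N := by
  have h2 := h.two_le
  rw [half, Finset.mem_Icc]
  omega

theorem Generic.core_degree (h : Generic N s) (a K b : ℕ) :
    SZ (core N a K b) 1 N = (a + b + 2 * K : ℕ) := by
  have h1 : SZ ((K : ℤ) • ep N 2) 1 N = K * SZ (ep N 2) 1 N := by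
    rw [SZ, SZ, Finset.mul_sum]
    rfl
  have h2 : SZ (up (edge N a b)) 1 N = (a + b : ℕ) := by
    rw [← h.edge_degree a b, Nat.cast_sum]
    rfl
  rw [core, SZ_add, h1, h2, SZ_ep_total h.two_mem_half]
  push_cast
  ring

/-- The product of `x_1^a x_{1'}^b` with the power `K` of the radius. -/
def radEdge (N : ℕ) (s : ℂ) (K a b : ℕ) : A N s :=
  rad N s ^ K * (X N s 1 ^ a * X N s (pr N 1) ^ b)

theorem radEdge_succ (K a b : ℕ) : radEdge N s (K + 1) a b = rad N s * radEdge N s K a b := by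
  rw [radEdge, radEdge, pow_succ', mul_assoc]

theorem Generic.cf_edge (h : Generic N s) (v : ℕ → ℤ) (a b : ℕ) :
    (∀ i, 1 ≤ i → i ≤ N → v i = edge N a b i) ∨
      cf N s v (X N s 1 ^ a * X N s (pr N 1) ^ b) = 0 := by
  rw [← h.mono_edge, h.cf_mono]
  by_cases hv : up (res N (edge N a b)) = v
  · left
    rintro i hi hi'
    rw [← hv, up_apply, res_apply hi hi']
  · right
    rw [if_neg hv]

/-- Multiplication by the radius does not lower exponents. -/
theorem Generic.cf_radEdge_eq_zero (h : Generic N s) (K a b : ℕ) {v : ℕ → ℤ}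
    (hv : v 1 < a ∨ v (pr N 1) < b) : cf N s v (radEdge N s K a b) = 0 := by
  have h4 := h.four_le
  induction K generalizing v with
  | zero =>
    rw [radEdge, pow_zero, one_mul]
    refine (h.cf_edge v a b).resolve_left fun hv' => ?_
    have h1 := hv' 1 le_rfl (by omega)
    have h2 := hv' (pr N 1) (by rw [pr]; omega) (by rw [pr]; omega)
    rw [h.edge_one] at h1
    rw [h.edge_last] at h2
    omega
  | succ K ih =>
    by_cases hv0 : ∀ i, 0 ≤ v i
    · rw [radEdge_succ, h.cf_rad hv0]
      refine Finset.sum_eq_zero fun j _ => ?_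
      rw [ih, mul_zero]
      have h0 : ∀ i, 0 ≤ ep N j i := fun i => add_nonneg (ez_nonneg _ _) (ez_nonneg _ _)
      have h1 := h0 1
      have h2 := h0 (pr N 1)
      rw [Pi.sub_apply, Pi.sub_apply]
      omega
    · push Not at hv0
      obtain ⟨i, hi⟩ := hv0
      exact h.cf_neg hi _

/-- The leading coefficient: the power of the radius has to be distributed to the index `2` only. -/
theorem Generic.cf_radEdge_ne_zero (h : Generic N s) (K a b : ℕ) :
    cf N s (core N a K b) (radEdge N s K a b) ≠ 0 := by
  have hN := rk_spec N
  have h4 := h.four_le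
  have h2 := h.two_le
  have hodd := odd01_cases N
  have hp1 : pr N 1 = N := by rw [pr]; omega
  have hp2 : pr N 2 = N - 1 := by rw [pr]; omega
  induction K with
  | zero =>
    have hcore : core N a 0 b = up (res N (edge N a b)) := by
      rw [core, Nat.cast_zero, zero_smul, add_zero]
      funext i
      rw [up_apply, up_apply, res]
      split_ifs with hi
      · rfl
      · rw [Finset.mem_Icc] at hi
        rw [edge_of_ne (by omega) (by omega)]
    rw [radEdge, pow_zero, one_mul, ← h.mono_edge, h.cf_mono, if_pos hcore.symm]
    exact h.wt_ne _
  | succ K ih =>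
    rw [radEdge_succ, h.cf_rad (core_nonneg a (K + 1) b),
      Finset.sum_eq_single_of_mem 2 h.two_mem_half]
    · rw [core_succ, radC_low (by omega) h2]
      have h5 := core_nonneg (N := N) a K b 2
      have h6 := core_nonneg (N := N) a K b (pr N 2)
      exact mul_ne_zero (mul_ne_zero (qp_ne h.ne_zero _) (mul_ne_zero
        (qsym_ne h.ne_zero h.root (by omega)) (qsym_ne h.ne_zero h.root (by omega)))) ih
    · intro j hj hj2
      obtain ⟨hj1, hjh⟩ := mem_half hj
      by_cases hj' : j = 1
      · subst hj'
        rw [h.cf_radEdge_eq_zero, mul_zero]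
        left
        rw [Pi.sub_apply, h.core_one, (ep_same (by omega)).1]
        omega
      · have hpj : pr N j = N + 1 - j := rfl
        have : (core N a (K + 1) b - ep N j) j < 0 := by
          have h5 := ez_nonneg (pr N j) j
          rw [Pi.sub_apply, core, Pi.add_apply, Pi.smul_apply,
            up_edge_apply_of_ne hj' (by omega), ep_of_ne hj2 (by omega), ep, Pi.add_apply, ez_same,
            smul_zero]
          omega
        rw [h.cf_neg this, mul_zero]

/-- The span of the elements `Q^k x_1^a x_{1'}^b` of degree `m`. -/
def invSpan (N : ℕ) (s : ℂ) (m : ℕ) : Submodule ℂ (A N s) :=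
  Submodule.span ℂ {r | ∃ k a b : ℕ, a + b + 2 * k = m ∧
    r = Q N s ^ k * (X N s 1 ^ a * X N s (pr N 1) ^ b)}

theorem Generic.radEdge_eq (h : Generic N s) (k a b : ℕ) : radEdge N s k a b =
    (dd N s (rk N) ^ k)⁻¹ • (Q N s ^ k * (X N s 1 ^ a * X N s (pr N 1) ^ b)) := by
  rw [h.Q_eq, smul_pow, smul_mul_assoc, inv_smul_smul₀ (pow_ne_zero _ (dd_ne N h.ne_zero h.root _)),
    radEdge]

theorem Generic.isInvariant_radEdge (h : Generic N s) (k a b : ℕ) :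
    IsInvariant N s (radEdge N s k a b) := by
  rw [h.radEdge_eq]
  exact (h.isInvariant_Q_pow (h.isInvariant_edge a b) k).smul _

theorem Generic.radEdge_mem_homog (h : Generic N s) (k a b : ℕ) :
    radEdge N s k a b ∈ homog N s (a + b + 2 * k) := by
  rw [h.radEdge_eq]
  exact Submodule.smul_mem _ _ (h.Q_pow_mem_homog (h.edge_mem_homog a b) k)

/-- All invariants are polynomials in `Q`,
  `x_1` and `x_{1'}`. The leading coefficients of `Q^K x_1^a x_{1'}^b`
at `x_1^a x_2^K x_{2'}^K x_{1'}^b` are nonzero,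
  so that the coefficients which determine an invariant can
be removed one power of `Q` after the other, the highest power first. -/
theorem Generic.mem_invSpan (h : Generic N s) {m : ℕ} {p : A N s} (hp : p ∈ homog N s m)
    (hinv : IsInvariant N s p) : p ∈ invSpan N s m := by
  suffices H : ∀ (K : ℕ) (p : A N s), p ∈ homog N s m → IsInvariant N s p →
      (∀ a K' b, K ≤ K' → cf N s (core N a K' b) p = 0) → p ∈ invSpan N s m by
    refine H (m + 1) p hp hinv fun a K' b hK => h.cf_homog hp ?_
    rw [h.core_degree]
    norm_cast
    omega
  intro K
  induction K with
  | zero =>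
    intro p _ hinv hc
    rw [h.eq_zero_of_core hinv fun a K b => hc a K b (Nat.zero_le _)]
    exact zero_mem _
  | succ K ih =>
    intro p hp hinv hc
    by_cases hK : 2 * K ≤ m
    swap
    · refine ih p hp hinv fun a K' b hK' => h.cf_homog hp ?_
      rw [h.core_degree]
      norm_cast
      omega
    let c : ℕ → ℂ := fun a => cf N s (core N a K (m - 2 * K - a)) p *
      (cf N s (core N a K (m - 2 * K - a)) (radEdge N s K a (m - 2 * K - a)))⁻¹
    let g : A N s := ∑ a ∈ Finset.range (m - 2 * K + 1), c a • radEdge N s K a (m - 2 * K - a)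
    have hg : g ∈ invSpan N s m := Submodule.sum_mem _ fun a ha => by
      rw [Finset.mem_range] at ha
      rw [h.radEdge_eq]
      exact Submodule.smul_mem _ _ (Submodule.smul_mem _ _
        (Submodule.subset_span ⟨K, a, m - 2 * K - a, by omega, rfl⟩))
    have hgh : g ∈ homog N s m := Submodule.sum_mem _ fun a ha => by
      rw [Finset.mem_range] at ha
      have := h.radEdge_mem_homog K a (m - 2 * K - a)
      rw [show a + (m - 2 * K - a) + 2 * K = m by omega] at this
      exact Submodule.smul_mem _ _ this
    have hgi : IsInvariant N s g :=
      isInvariant_sum fun a _ => (h.isInvariant_radEdge K a (m - 2 * K - a)).smul _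
    have hpg : p - g ∈ invSpan N s m := by
      refine ih _ (sub_mem hp hgh) ?_ fun a K' b hK' => ?_
      · have := hinv.add (hgi.smul (-1))
        rwa [neg_one_smul ℂ g, ← sub_eq_add_neg] at this
      by_cases hdeg : a + b + 2 * K' = m
      swap
      · refine h.cf_homog (sub_mem hp hgh) ?_
        rw [h.core_degree]
        exact_mod_cast hdeg
      rw [map_sub, map_sum]
      have hzero : ∀ d, d ≤ m - 2 * K → (d = a → K' ≠ K) →
          cf N s (core N a K' b) (c d • radEdge N s K d (m - 2 * K - d)) = 0 := by
        intro d hd hd'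
        rw [map_smul, h.cf_radEdge_eq_zero, smul_zero]
        rw [h.core_one, h.core_last]
        omega
      rcases hK'.eq_or_lt with rfl | hlt
      · have hb : b = m - 2 * K - a := by omega
        rw [Finset.sum_eq_single_of_mem a (Finset.mem_range.2 (by omega)), map_smul, smul_eq_mul,
          hb, inv_mul_cancel_right₀ (h.cf_radEdge_ne_zero _ _ _), sub_self]
        intro d hd hda
        rw [Finset.mem_range] at hd
        exact hzero d (by omega) fun h1 => absurd h1 hda
      · rw [hc a K' b hlt, Finset.sum_eq_zero, sub_zero]
        intro d hd
        rw [Finset.mem_range] at hd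
        exact hzero d (by omega) fun _ => by omega
    have := add_mem hpg hg
    rwa [sub_add_cancel] at this

/-- Modulo `Q 𝒜_{m-2}`, an invariant is a combination of the polynomials `φ`. -/
theorem Generic.exists_phi_combination (h : Generic N s) {m : ℕ} {p : A N s}
    (hp : p ∈ invSpan N s m) :
    ∃ u ∈ Submodule.span ℂ {r | ∃ a b : ℕ, a + b = m ∧ r = phi N s a b}, p - u ∈ qMul N s m := by
  induction hp using Submodule.span_induction with
  | mem x hx =>
    obtain ⟨k, a, b, rfl, rfl⟩ := hx
    cases k with
    | zero =>
      refine ⟨phi N s a b, Submodule.subset_span ⟨a, b, rfl, rfl⟩, ?_⟩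
      have := neg_mem (h.phi_sub_mem_qMul a b)
      rwa [neg_sub, ← one_mul (X N s 1 ^ a * X N s (pr N 1) ^ b), ← pow_zero (Q N s)] at this
    | succ k =>
      refine ⟨0, zero_mem _, ?_⟩
      rw [sub_zero, pow_succ', mul_assoc]
      exact Submodule.subset_span ⟨a + b + 2 * k, _, by omega,
        h.Q_pow_mem_homog (h.edge_mem_homog a b) k, rfl⟩
  | zero => exact ⟨0, zero_mem _, by rw [sub_zero]; exact zero_mem _⟩
  | add x y _ _ hx hy =>
    obtain ⟨u, hu, hu'⟩ := hx
    obtain ⟨v, hv, hv'⟩ := hy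
    exact ⟨u + v, add_mem hu hv, by rw [add_sub_add_comm]; exact add_mem hu' hv'⟩
  | smul c x _ hx =>
    obtain ⟨u, hu, hu'⟩ := hx
    exact ⟨c • u, Submodule.smul_mem _ _ hu, by rw [← smul_sub]; exact Submodule.smul_mem _ _ hu'⟩

theorem Generic.isZonal_of_mem_span (h : Generic N s) {m : ℕ} {p : A N s}
    (hp : p ∈ Submodule.span ℂ {r | ∃ a b : ℕ, a + b = m ∧ r = phi N s a b}) : IsZonal N s m p := by
  induction hp using Submodule.span_induction with
  | mem x hx =>
    obtain ⟨a, b, rfl, rfl⟩ := hx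
    exact h.isZonal_phi a b
  | zero => exact ⟨zero_mem _, isInvariant_zero⟩
  | add x y _ _ hx hy => exact ⟨add_mem hx.1 hy.1, hx.2.add hy.2⟩
  | smul c x _ hx => exact ⟨Submodule.smul_mem _ c hx.1, hx.2.smul c⟩

theorem Generic.isZonal_iff (h : Generic N s) (m : ℕ) (p : A N s) : IsZonal N s m p ↔
    p ∈ Submodule.span ℂ {r | ∃ a b : ℕ, a + b = m ∧ r = phi N s a b} := by
  refine ⟨fun hp => ?_, h.isZonal_of_mem_span⟩
  obtain ⟨u, hu, hpu⟩ := h.exists_phi_combination (h.mem_invSpan hp.1.1 hp.2)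
  have hL : Lap N s (p - u) = 0 := by
    rw [map_sub, LinearMap.mem_ker.1 hp.1.2,
      LinearMap.mem_ker.1 (h.isZonal_of_mem_span hu).1.2, sub_zero]
  rwa [sub_eq_zero.1 (h.harm_inf_qMul hL hpu)]

end QE
end

theorem theorem1 (N : ℕ) (hN : 4 ≤ N) (s : ℂ) (hs : s ≠ 0)
    (hroot : ∀ k : ℕ, 0 < k → (s ^ 2) ^ k ≠ 1) (m : ℕ) :
    -- the polynomials `φ^m_{a b}`, `a + b = m`, are zonal and have the explicit form
    (∀ a b : ℕ, a + b = m →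
      QE.IsZonal N s m (QE.phi N s a b) ∧
      QE.phi N s a b = ∑ k ∈ Finset.range (min a b + 1),
        QE.coeffC N s a b k • (QE.Q N s ^ k *
          (QE.X N s 1 ^ (a - k) * QE.X N s (QE.pr N 1) ^ (b - k)))) ∧
    -- they are pairwise orthogonal
    (∀ σ : ℂ →+* ℂ, (∀ z : ℂ, σ (σ z) = z) → σ (s ^ 2) = s ^ 2 → (Odd N → σ s = s) →
      ∀ a b c d : ℕ, a + b = m → c + d = m → (a, b) ≠ (c, d) →
        QE.scal N s σ (QE.phi N s a b) (QE.phi N s c d) = 0) ∧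
    -- they form a complete set of zonal polynomials: a basis of the space of all of them
    LinearIndependent ℂ (fun a : Fin (m + 1) => QE.phi N s (a : ℕ) (m - (a : ℕ))) ∧
    (∀ p : QE.A N s, QE.IsZonal N s m p ↔
      p ∈ Submodule.span ℂ {r | ∃ a b : ℕ, a + b = m ∧ r = QE.phi N s a b}) := by
  have h : QE.Generic N s := ⟨hN, hs, hroot⟩
  refine ⟨?_, fun σ hσ hσq hσs a b c d hab hcd hne => ?_, h.linearIndependent_phi m,
    h.isZonal_iff m⟩
  · rintro a b rfl
    exact ⟨h.isZonal_phi a b, h.phi_eq a b⟩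
  · refine h.scal_phi_eq_zero hσ hσq hσs fun h1 => hne ?_
    rw [Prod.mk.injEq]
    omega
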